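/- Let $k$ be a field, let $\mathcal O$ be an $E_\infty$-operad in differential graded vector spaces over $k$ (an operad concentrated in non-negative degrees with a quasi-isomorphism of operads to the commutative operad, such that every $\mathcal O(r)$ is projective over $k[\Sigma_r]$; for example the Barratt–Eccles operad), and call $\mathcal O$-algebras in ($\mathbb Z$-graded) differential graded vector spaces *$E_\infty$-algebras*. A morphism of $E_\infty$-algebras is a weak equivalence if it is a quasi-isomorphism, and an $E_\infty$-algebra is cofibrant if it has the left lifting property with respect to surjective quasi-isomorphisms. Suppose that for simplicial sets $X$ and $E_\infty$-algebras $B$ the normalized cochains $B^X=\operatorname{Hom}_k(N_*(X;k),B)$ are equipped with an $\mathcal O$-algebra structure, natural in $X$ and $B$ and equal to the given one on $B$ if $X$ is a point (for the Barratt–Eccles operad, the structure of Berger and Fresse). The tensor $X\otimes A$ of a simplicial set $X$ with an $E_\infty$-algebra $A$ is then defined by $\operatorname{Hom}(X\otimes A,B)\cong\operatorname{Hom}(A,B^X)$, naturally in $B$. Let $G$ be a (discrete) group, let $A$ be an $E_\infty$-algebra with a $G$-action, and let $q\colon QA\to A$ be a cofibrant replacement: a $G$-equivariant weak equivalence whose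 source is cofibrant as an $E_\infty$-algebra. Let $BG$ be the nerve of the one-object groupoid $\star/\!/G$ and $EG\to BG$ the universal $G$-bundle: $EG_n=G^{n+1}$, with $G$ acting by right multiplication, and $(x_0,\dots,x_n)$ maps to the $n$-simplex of $BG$ with edges $x_jx_i^{-1}$ for $i\le j$. For a simplicial set $X$ and a map $\varphi\colon X\to BG$, the equivariant higher Hochschild chains are $$\int_\varphi A:=\varphi^*EG\overset{\mathbb L}{\otimes}_G A=\int^{n}\coprod_{s\in G^n}(\varphi^*EG\times\Delta_n)\otimes QA,$$ the geometric realization of the simplicial bar construction $B_n(\varphi^*EG,\star/\!/G,QA)=\coprod_{s\in G^n}\varphi^*EG\otimes QA$, and the ordinary higher Hochschild chains are $X\overset{\mathbb L}{\otimes}A:=X\otimes QA$. Then the following holds. (1) Suppose that $\varphi$ classifies a trivial $G$-bundle, and let $\tau\colon\varphi^*EG\cong X\times G$ be a trivialization, i.e. an isomorphism over $X$ of simplicial sets with right $G$-action. Then there is a unique morphism of $E_\infty$-algebras $$\int_\varphi A\longrightarrow X\overset{\mathbb L}{\otimes}A$$ such that, for all $n\ge0$, all strings $s=(g_1,\dots,g_n)\in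 G^n$ of composable arrows of $\star/\!/G$ and all $h\in G$, its restriction to the summand with index $s$ and to the part $(X\times\{h\}\times\Delta_n)\otimes QA$ of that summand (identified through $\tau$) is the morphism $(X\times\Delta_n)\otimes QA\to X\otimes QA$ induced by the projection $X\times\Delta_n\to X$ and by the action of $h\,g_n\cdots g_1$ on $QA$. This canonical morphism is a weak equivalence. (2) In particular, the value on the point is $A$ itself: for $\varphi\colon\star\to BG$ there is a weak equivalence of $E_\infty$-algebras $\int_\varphi A\to A$. -/

import Mathlib

open CategoryTheory Limits Opposite MonoidalCategory

universe u

/-- A differential graded vector space over `k`: a `ℤ`-graded vector space with a differential of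
degree `-1`. The carrier is the direct sum of the homogeneous pieces `gr n`. -/
structure DGVect (k : Type u) [Field k] where
  carrier : Type u
  [addCommGroup : AddCommGroup carrier]
  [module : Module k carrier]
  gr : ℤ → Submodule k carrier
  isInternal : DirectSum.IsInternal gr
  d : carrier →ₗ[k] carrier
  d_mem : ∀ {n : ℤ} {x : carrier}, x ∈ gr n → d x ∈ gr (n - 1)
  d_d : ∀ x : carrier, d (d x) = 0

attribute [instance] DGVect.addCommGroup DGVect.module

namespace DGVect

variable {k : Type u} [Field k]

/-- A chain map `f` is a quasi-isomorphism if it is injective and surjective on homology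
`ker d / im d` (the direct sum over all degrees of the homology groups). -/
def QuasiIso {V W : DGVect k} (f : V.carrier →ₗ[k] W.carrier) : Prop :=
  (∀ x, V.d x = 0 → (∃ y, f x = W.d y) → ∃ z, x = V.d z) ∧
    (∀ y, W.d y = 0 → ∃ x z, V.d x = 0 ∧ y = f x + W.d z)

/-- Submodules which a jointly injective family of maps sends to distinct homogeneous pieces of
graded vector spaces are independent. -/
lemma iSupIndep_of_joint {W : Type*} [AddCommGroup W] [Module k W] (S : ℤ → Submodule k W)
    {ι : Type*} (V : ι → DGVect k) (s : ι → ℤ) (f : ∀ i, W →ₗ[k] (V i).carrier)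
    (hf : ∀ i n x, x ∈ S n → f i x ∈ (V i).gr (n + s i))
    (inj : ∀ x, (∀ i, f i x = 0) → x = 0) : iSupIndep S := by
  intro n
  rw [Submodule.disjoint_def]
  intro x hx hx'
  refine inj x fun i => ?_
  have ind := (V i).isInternal.submodule_iSupIndep (n + s i)
  rw [Submodule.disjoint_def] at ind
  refine ind _ (hf i n x hx) ?_
  have : (⨆ j, ⨆ (_ : j ≠ n), S j) ≤
      (⨆ j, ⨆ (_ : j ≠ n + s i), (V i).gr j).comap (f i) := by
    refine iSup₂_le fun j hj y hy => ?_
    refine Submodule.mem_iSup_of_mem (j + s i) (Submodule.mem_iSup_of_mem ?_ (hf i j y hy))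
    omega
  exact this hx'

lemma iSup_gr (V : DGVect k) : ⨆ n, V.gr n = ⊤ := V.isInternal.submodule_iSup_eq_top

/-- Two linear maps that agree on homogeneous elements are equal. -/
lemma hom_ext {V : DGVect k} {M : Type*} [AddCommGroup M] [Module k M]
    {f g : V.carrier →ₗ[k] M} (h : ∀ n, ∀ x ∈ V.gr n, f x = g x) : f = g := by
  ext x
  have hx : x ∈ ⨆ n, V.gr n := by rw [V.iSup_gr]; trivial
  induction hx using Submodule.iSup_induction' with
  | mem n x hx => exact h n x hx
  | zero => simp
  | add x y _ _ h1 h2 => simp [h1, h2]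

end DGVect

/-- The input slot of the composite `a ∘ᵢ b` (with `a` of arity `m`, `b` of arity `n`) that
corresponds to the slot `j ≠ i` of `a`. -/
def outerSlot {m n r : ℕ} (h : m + n = r + 1) (i j : Fin m) (hj : j ≠ i) : Fin r :=
  ⟨if j < i then (j : ℕ) else j + n - 1, by
    have := i.2; have := j.2; have : (j : ℕ) ≠ i := fun e => hj (Fin.ext e)
    split_ifs with hlt
    · have : (j : ℕ) < i := hlt
      omega
    · have : ¬ (j : ℕ) < i := hlt
      omega⟩

/-- The input slot of the composite `a ∘ᵢ b` that corresponds to the slot `s` of `b`. -/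
def innerSlot {m n r : ℕ} (h : m + n = r + 1) (i : Fin m) (s : Fin n) : Fin r :=
  ⟨i + s, by have := i.2; have := s.2; omega⟩

/-- A symmetric operad in differential graded vector spaces, presented by partial compositions
`a ∘ᵢ b`. The symmetric group `Perm (Fin r)` acts on `O r` from the right; slot `j` of `a · σ` is
slot `σ j` of `a`. Signs follow the Koszul rule. -/
structure DGOperad (k : Type u) [Field k] where
  O : ℕ → DGVect k
  one : (O 1).carrier
  perm (r : ℕ) : Equiv.Perm (Fin r) → (O r).carrier →ₗ[k] (O r).carrier
  comp {m n r : ℕ} (h : m + n = r + 1) (i : Fin m) :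
    (O m).carrier →ₗ[k] (O n).carrier →ₗ[k] (O r).carrier
  one_mem : one ∈ (O 1).gr 0
  d_one : (O 1).d one = 0
  perm_mem : ∀ {r p} (σ : Equiv.Perm (Fin r)) {a}, a ∈ (O r).gr p → perm r σ a ∈ (O r).gr p
  perm_d : ∀ {r} (σ : Equiv.Perm (Fin r)) (a), perm r σ ((O r).d a) = (O r).d (perm r σ a)
  perm_one : ∀ {r} (a : (O r).carrier), perm r 1 a = a
  perm_mul : ∀ {r} (σ τ : Equiv.Perm (Fin r)) (a), perm r (σ * τ) a = perm r τ (perm r σ a)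
  comp_mem : ∀ {m n r} (h : m + n = r + 1) (i : Fin m) {p q a b}, a ∈ (O m).gr p →
    b ∈ (O n).gr q → comp h i a b ∈ (O r).gr (p + q)
  comp_d : ∀ {m n r} (h : m + n = r + 1) (i : Fin m) {p a} (b), a ∈ (O m).gr p →
    (O r).d (comp h i a b) = comp h i ((O m).d a) b + p.negOnePow • comp h i a ((O n).d b)
  comp_one : ∀ {m} (i : Fin m) (a), comp (n := 1) (r := m) rfl i a one = a
  one_comp : ∀ {n} (b : (O n).carrier),
    comp (m := 1) (n := n) (r := n) (Nat.add_comm 1 n) 0 one b = b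
  /-- `(a ∘ᵢ b) ∘ⱼ c = a ∘ᵢ (b ∘ⱼ c)` when `c` is inserted into a slot of `b`. -/
  comp_assoc : ∀ {m n l r₁ r₂ r₃ : ℕ} (h₁ : m + n = r₁ + 1) (h₂ : r₁ + l = r₂ + 1)
    (h₃ : n + l = r₃ + 1) (h₄ : m + r₃ = r₂ + 1) (i : Fin m) (j : Fin n) (a b c),
    comp h₂ (innerSlot h₁ i j) (comp h₁ i a b) c = comp h₄ i a (comp h₃ j b c)
  /-- Insertions into two different slots `i < j` of `a` commute up to the Koszul sign. -/
  comp_comm : ∀ {m n l r₁ r₂ r₃ : ℕ} (h₁ : m + n = r₁ + 1) (h₂ : r₁ + l = r₂ + 1)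
    (h₃ : m + l = r₃ + 1) (h₄ : r₃ + n = r₂ + 1) (i j : Fin m) (hij : i < j) {p q : ℤ} (a)
    {b c}, b ∈ (O n).gr p → c ∈ (O l).gr q →
    comp h₂ (outerSlot h₁ i j hij.ne') (comp h₁ i a b) c =
      (p * q).negOnePow • comp h₄ (outerSlot h₃ j i hij.ne) (comp h₃ j a c) b
  /-- Equivariance: `ρ` is the permutation of the slots of the composite induced by `σ` and
  `τ`. -/
  comp_perm : ∀ {m n r : ℕ} (h : m + n = r + 1) (i : Fin m) (σ : Equiv.Perm (Fin m))
    (τ : Equiv.Perm (Fin n)) (ρ : Equiv.Perm (Fin r)) (a b),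
    (∀ s, ρ (innerSlot h i s) = innerSlot h (σ i) (τ s)) →
    (∀ j hj, ρ (outerSlot h i j hj) =
      outerSlot h (σ i) (σ j) (fun e => hj (σ.injective e))) →
    comp h i (perm m σ a) (perm n τ b) = perm r ρ (comp h (σ i) a b)

variable {k : Type u} [Field k]

/-- The left representation of `Perm (Fin r)` on `O r` corresponding to the right action. -/
def DGOperad.rep (O : DGOperad k) (r : ℕ) :
    Representation k (Equiv.Perm (Fin r)) (O.O r).carrier where
  toFun σ := O.perm r σ⁻¹
  map_one' := by ext a; simp [O.perm_one]
  map_mul' σ τ := by ext a; simp [O.perm_mul]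

/-- An `E_∞`-operad: every `O r` is a resolution of the trivial representation `k` by projective
`k[Σ_r]`-modules, compatibly with the operad structure. -/
structure DGOperad.IsEInfty (O : DGOperad k) : Prop where
  nonneg : ∀ r, ∀ p < 0, (O.O r).gr p = ⊥
  projective : ∀ r, Module.Projective (MonoidAlgebra k (Equiv.Perm (Fin r))) (O.rep r).asModule
  /-- a quasi-isomorphism of operads to the commutative operad `r ↦ k` -/
  resolution : ∃ aug : ∀ r, (O.O r).carrier →ₗ[k] k,
    (∀ r p a, p ≠ 0 → a ∈ (O.O r).gr p → aug r a = 0) ∧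
    (∀ r a, aug r ((O.O r).d a) = 0) ∧
    aug 1 O.one = 1 ∧
    (∀ r σ a, aug r (O.perm r σ a) = aug r a) ∧
    (∀ (m n r : ℕ) (h : m + n = r + 1) (i : Fin m) a b,
      aug r (O.comp h i a b) = aug m a * aug n b) ∧
    (∀ r a, (O.O r).d a = 0 → aug r a = 0 → ∃ b, a = (O.O r).d b) ∧
    (∀ r, ∃ a, (O.O r).d a = 0 ∧ aug r a = 1)

/-- The structure of an algebra over the operad `O` on a differential graded vector space: the
operation `act r e` is the value at `e` of `O r ⊗ V^{⊗ r} → V`. -/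
structure AlgStr (O : DGOperad k) (V : DGVect k) where
  act (r : ℕ) :
    (O.O r).carrier →ₗ[k] MultilinearMap k (fun _ : Fin r => V.carrier) V.carrier
  act_mem : ∀ {r p} {q : Fin r → ℤ} {e x}, e ∈ (O.O r).gr p → (∀ i, x i ∈ V.gr (q i)) →
    act r e x ∈ V.gr (p + ∑ i, q i)
  /-- the structure maps are chain maps -/
  act_d : ∀ {r p} {q : Fin r → ℤ} {e x}, e ∈ (O.O r).gr p → (∀ i, x i ∈ V.gr (q i)) →
    V.d (act r e x) = act r ((O.O r).d e) x +
      ∑ i, (p + ∑ j ∈ Finset.Iio i, q j).negOnePow • act r e (Function.update x i (V.d (x i)))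
  act_one : ∀ x, act 1 O.one x = x 0
  /-- equivariance; it suffices to state it for adjacent transpositions -/
  act_swap : ∀ {r} {q : Fin r → ℤ} (i j : Fin r) (_ : (j : ℕ) = i + 1) (e) {x},
    (∀ i, x i ∈ V.gr (q i)) → act r (O.perm r (Equiv.swap i j) e) x =
      (q i * q j).negOnePow • act r e (x ∘ Equiv.swap i j)
  /-- compatibility with the partial compositions -/
  act_comp : ∀ {m n r} (h : m + n = r + 1) (i : Fin m) {p} {q : Fin r → ℤ} (a) {b x},
    b ∈ (O.O n).gr p → (∀ t, x t ∈ V.gr (q t)) → act r (O.comp h i a b) x =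
      (p * ∑ t ∈ Finset.univ.filter (fun t : Fin r => (t : ℕ) < i), q t).negOnePow • act m a (fun j =>
        if hj : j = i then act n b (fun s => x (innerSlot h i s))
        else x (outerSlot h i j hj))

/-- An algebra over `O` in differential graded vector spaces. -/
structure DGAlg (O : DGOperad k) extends DGVect k where
  str : AlgStr O toDGVect

namespace DGAlg

variable {O : DGOperad k}

/-- A morphism of `O`-algebras. -/
@[ext]
structure Hom (A B : DGAlg O) where
  toFun : A.carrier →ₗ[k] B.carrier
  map_mem : ∀ {n x}, x ∈ A.gr n → toFun x ∈ B.gr n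
  map_d : ∀ x, toFun (A.d x) = B.d (toFun x)
  map_act : ∀ {r} (e : (O.O r).carrier) (x : Fin r → A.carrier),
    toFun (A.str.act r e x) = B.str.act r e (fun i => toFun (x i))

instance : Category.{u} (DGAlg O) where
  Hom := Hom
  id A := ⟨LinearMap.id, fun h => h, fun _ => rfl, fun _ _ => rfl⟩
  comp f g := ⟨g.toFun ∘ₗ f.toFun, fun h => g.map_mem (f.map_mem h),
    fun x => by simp [f.map_d, g.map_d], fun e x => by simp [f.map_act, g.map_act]⟩

@[ext]
lemma hom_ext {A B : DGAlg O} {f g : A ⟶ B} (h : ∀ x, f.toFun x = g.toFun x) : f = g :=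
  Hom.ext (LinearMap.ext h)

@[simp] lemma id_toFun (A : DGAlg O) (x : A.carrier) : Hom.toFun (𝟙 A) x = x := rfl

@[simp] lemma comp_toFun {A B C : DGAlg O} (f : A ⟶ B) (g : B ⟶ C) (x : A.carrier) :
    (f ≫ g).toFun x = g.toFun (f.toFun x) := rfl

end DGAlg

/-! ### Algebras generated by graded vector spaces -/

section Generated

/-- A family of graded vector spaces `V j` with linear maps, homogeneous of degree `shift j`, to a
class of `O`-algebras. -/
structure GenData (O : DGOperad k) where
  J : Type u
  V : J → DGVect k
  shift : J → ℤ
  Pt : Type (u + 1)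
  alg : Pt → DGAlg O
  φ (p : Pt) (j : J) : (V j).carrier →ₗ[k] (alg p).carrier
  φ_mem : ∀ p j n x, x ∈ (V j).gr n → φ p j x ∈ (alg p).gr (n + shift j)

namespace GenData

variable {O : DGOperad k} (D : GenData O)

/-- Formal expressions in the generators. -/
inductive Term : Type u
  | gen (j : D.J) (n : ℤ) (x : (D.V j).gr n)
  | d (t : Term)
  | op (r : ℕ) (p : ℤ) (e : (O.O r).gr p) (t : Fin r → Term)

/-- The degree of an expression. -/
def Term.deg : D.Term → ℤ
  | .gen j n _ => n + D.shift j
  | .d t => t.deg - 1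
  | .op _ p _ t => p + ∑ i, (t i).deg

/-- The value of an expression. -/
def Term.eval (p : D.Pt) : D.Term → (D.alg p).carrier
  | .gen j _ x => D.φ p j x
  | .d t => (D.alg p).d (t.eval p)
  | .op r _ e t => (D.alg p).str.act r e (fun i => (t i).eval p)

lemma Term.eval_mem (p : D.Pt) (t : D.Term) : t.eval D p ∈ (D.alg p).gr (t.deg D) := by
  induction t with
  | gen j n x => exact D.φ_mem p j n x x.2
  | d t ih => exact (D.alg p).d_mem ih
  | op r q e t ih => exact (D.alg p).str.act_mem e.2 ih

/-- Linear combinations of expressions. -/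
noncomputable def lin (p : D.Pt) : (D.Term →₀ k) →ₗ[k] (D.alg p).carrier :=
  Finsupp.linearCombination k (fun t => t.eval D p)

/-- Linear combinations of expressions, up to equality of all values. -/
abbrev T : Type u := (D.Term →₀ k) ⧸ (⨅ p, LinearMap.ker (D.lin p))

/-- Evaluation. -/
noncomputable def ev (p : D.Pt) : D.T →ₗ[k] (D.alg p).carrier :=
  Submodule.liftQ _ (D.lin p) (iInf_le _ p)

/-- The class of an expression. -/
noncomputable def cls (t : D.Term) : D.T := Submodule.Quotient.mk (Finsupp.single t 1)

@[simp] lemma ev_cls (p : D.Pt) (t : D.Term) : D.ev p (D.cls t) = t.eval D p := by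
  have : D.ev p (D.cls t) = D.lin p (Finsupp.single t 1) := rfl
  rw [this]
  simp [lin]

lemma ev_inj {x y : D.T} (h : ∀ p, D.ev p x = D.ev p y) : x = y := by
  rw [← sub_eq_zero]
  obtain ⟨z, hz⟩ := Submodule.Quotient.mk_surjective _ (x - y)
  rw [← hz, Submodule.Quotient.mk_eq_zero, Submodule.mem_iInf]
  intro p
  have : D.ev p (x - y) = 0 := by rw [map_sub, h p, sub_self]
  rw [← hz] at this
  exact this

lemma span_cls : Submodule.span k (Set.range D.cls) = ⊤ := by
  rw [eq_top_iff]
  rintro x -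
  obtain ⟨z, rfl⟩ := Submodule.Quotient.mk_surjective _ x
  induction z using Finsupp.induction_linear with
  | zero => exact zero_mem _
  | add f g hf hg => exact add_mem hf hg
  | single t c =>
    have : (Submodule.Quotient.mk (Finsupp.single t c) : D.T) = c • D.cls t := by
      rw [cls, ← Submodule.Quotient.mk_smul, Finsupp.smul_single, smul_eq_mul, mul_one]
    rw [this]
    exact Submodule.smul_mem _ _ (Submodule.subset_span ⟨t, rfl⟩)

/-- The homogeneous pieces. -/
noncomputable def gr (n : ℤ) : Submodule k D.T :=
  Submodule.span k (D.cls '' {t | t.deg D = n})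

lemma cls_mem (t : D.Term) : D.cls t ∈ D.gr (t.deg D) := Submodule.subset_span ⟨t, rfl, rfl⟩

lemma ev_mem (p : D.Pt) {n : ℤ} {x : D.T} (hx : x ∈ D.gr n) : D.ev p x ∈ (D.alg p).gr n := by
  have : D.gr n ≤ ((D.alg p).gr n).comap (D.ev p) := by
    rw [gr, Submodule.span_le]
    rintro _ ⟨t, rfl, rfl⟩
    simpa using t.eval_mem D p
  exact this hx

lemma exists_d (x : D.T) : ∃ y : D.T, (∀ p, D.ev p y = (D.alg p).d (D.ev p x)) ∧
    ∀ n, x ∈ D.gr n → y ∈ D.gr (n - 1) := by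
  let δ : D.T →ₗ[k] D.T := Submodule.mapQ _ _ (Finsupp.lmapDomain k k Term.d) (by
    intro z hz
    rw [Submodule.mem_comap, Submodule.mem_iInf]
    rw [Submodule.mem_iInf] at hz
    intro p
    have h1 : D.lin p ∘ₗ Finsupp.lmapDomain k k Term.d = (D.alg p).d ∘ₗ D.lin p := by
      ext t
      simp [lin, Term.eval]
    have := LinearMap.congr_fun h1 z
    rw [LinearMap.mem_ker]
    simp only [LinearMap.comp_apply] at this
    rw [this, LinearMap.mem_ker.1 (hz p), map_zero])
  have hδ : ∀ t, δ (D.cls t) = D.cls (Term.d t) := fun t => by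
    simp [δ, cls, Submodule.mapQ_apply]
  refine ⟨δ x, fun p => ?_, fun n hx => ?_⟩
  · clear_value δ
    have hx : x ∈ Submodule.span k (Set.range D.cls) := by rw [D.span_cls]; trivial
    induction hx using Submodule.span_induction with
    | mem x hx => obtain ⟨t, rfl⟩ := hx; simp [hδ, Term.eval]
    | zero => simp
    | add x y _ _ h1 h2 => simp [h1, h2]
    | smul c x _ h => simp [h]
  · have : D.gr n ≤ (D.gr (n - 1)).comap δ := by
      rw [gr, Submodule.span_le]
      rintro _ ⟨t, rfl, rfl⟩
      rw [SetLike.mem_coe, Submodule.mem_comap, hδ]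
      exact D.cls_mem (Term.d t)
    exact this hx

lemma exists_act_aux {r : ℕ} {p : ℤ} (e : (O.O r).gr p) (x : Fin r → D.T)
    (P : Fin r → Set D.Term) (hx : ∀ i, x i ∈ Submodule.span k (D.cls '' P i)) :
    ∃ y : D.T, y ∈ Submodule.span k (D.cls '' {t | ∃ s, t = Term.op r p e s ∧ ∀ i, s i ∈ P i}) ∧
      ∀ a, D.ev a y = (D.alg a).str.act r e (fun i => D.ev a (x i)) := by
  classical
  have h : ∀ i, ∃ (A : Finset D.Term) (c : D.Term → k), (∀ t ∈ A, t ∈ P i) ∧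
      x i = ∑ t ∈ A, c t • D.cls t := by
    intro i
    obtain ⟨l, hl, hl'⟩ := (Finsupp.mem_span_image_iff_linearCombination k).1 (hx i)
    exact ⟨l.support, l, fun t ht => (Finsupp.mem_supported k l).1 hl ht, by
      rw [← hl', Finsupp.linearCombination_apply, Finsupp.sum]⟩
  choose A c hA hc using h
  refine ⟨∑ s ∈ Fintype.piFinset A, (∏ i, c i (s i)) • D.cls (Term.op r p e s),
    Submodule.sum_mem _ fun s hs => Submodule.smul_mem _ _ (Submodule.subset_span
      ⟨_, ⟨s, rfl, fun i => hA i _ (Fintype.mem_piFinset.1 hs i)⟩, rfl⟩), fun a => ?_⟩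
  have : (fun i => D.ev a (x i)) = fun i => ∑ t ∈ A i, c i t • Term.eval D a t := by
    funext i
    simp [hc i]
  rw [this, MultilinearMap.map_sum_finset, map_sum]
  refine Finset.sum_congr rfl fun s _ => ?_
  rw [map_smul, ev_cls, Term.eval, MultilinearMap.map_smul_univ]

lemma exists_act {r : ℕ} (e : (O.O r).carrier) (x : Fin r → D.T) :
    ∃ y : D.T, (∀ a, D.ev a y = (D.alg a).str.act r e (fun i => D.ev a (x i))) := by
  have he : e ∈ ⨆ n, (O.O r).gr n := by rw [DGVect.iSup_gr]; trivial
  induction he using Submodule.iSup_induction' with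
  | mem p e he =>
    obtain ⟨y, -, hy⟩ := D.exists_act_aux ⟨e, he⟩ x (fun _ => Set.univ)
      (fun i => by rw [Set.image_univ, D.span_cls]; trivial)
    exact ⟨y, hy⟩
  | zero => exact ⟨0, by simp⟩
  | add e e' _ _ h h' =>
    obtain ⟨y, hy⟩ := h
    obtain ⟨y', hy'⟩ := h'
    exact ⟨y + y', fun a => by simp [hy, hy']⟩

lemma exists_act_mem {r : ℕ} {p : ℤ} {q : Fin r → ℤ} {e : (O.O r).carrier} {x : Fin r → D.T}
    (he : e ∈ (O.O r).gr p) (hx : ∀ i, x i ∈ D.gr (q i)) {y : D.T}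
    (hy : ∀ a, D.ev a y = (D.alg a).str.act r e (fun i => D.ev a (x i))) :
    y ∈ D.gr (p + ∑ i, q i) := by
  obtain ⟨y', h1, h2⟩ := D.exists_act_aux ⟨e, he⟩ x (fun i => {t | t.deg D = q i}) hx
  obtain rfl : y = y' := D.ev_inj fun a => by rw [hy, h2]
  refine Submodule.span_mono (Set.image_mono ?_) h1
  rintro _ ⟨s, rfl, hs⟩
  simp only [Set.mem_ofPred_eq] at hs ⊢
  simp [Term.deg, hs]

/-- The differential. -/
noncomputable def dd : D.T →ₗ[k] D.T where
  toFun x := (D.exists_d x).choose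
  map_add' x y := D.ev_inj fun p => by
    rw [map_add, (D.exists_d _).choose_spec.1 p, (D.exists_d _).choose_spec.1 p,
      (D.exists_d _).choose_spec.1 p, map_add, map_add]
  map_smul' c x := D.ev_inj fun p => by
    rw [map_smul, (D.exists_d _).choose_spec.1 p, (D.exists_d _).choose_spec.1 p, map_smul,
      map_smul, RingHom.id_apply]

@[simp] lemma ev_d (p : D.Pt) (x : D.T) : D.ev p (D.dd x) = (D.alg p).d (D.ev p x) :=
  (D.exists_d x).choose_spec.1 p

/-- The underlying differential graded vector space. -/
@[reducible] noncomputable def vect : DGVect k where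
  carrier := D.T
  gr := D.gr
  isInternal := by
    refine DirectSum.isInternal_submodule_of_iSupIndep_of_iSup_eq_top ?_ ?_
    · refine DGVect.iSupIndep_of_joint D.gr (fun p => (D.alg p).toDGVect) (fun _ => 0) D.ev ?_ ?_
      · intro p n x hx
        simpa using D.ev_mem p hx
      · intro x hx
        exact D.ev_inj fun p => by simpa using hx p
    · rw [eq_top_iff, ← D.span_cls, Submodule.span_le]
      rintro _ ⟨t, rfl⟩
      exact Submodule.mem_iSup_of_mem _ (D.cls_mem t)
  d := D.dd
  d_mem hx := (D.exists_d _).choose_spec.2 _ hx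
  d_d x := D.ev_inj fun p => by rw [ev_d, ev_d, DGVect.d_d, map_zero]

/-- The operations. -/
noncomputable def act (r : ℕ) : (O.O r).carrier →ₗ[k] MultilinearMap k (fun _ : Fin r => D.T) D.T where
  toFun e := MultilinearMap.mk' (fun x => (D.exists_act e x).choose)
    (fun x i a b => D.ev_inj fun p => by
      classical
      simp only [map_add, (D.exists_act _ _).choose_spec p]
      have h : ∀ z, (fun j => D.ev p (Function.update x i z j)) =
          Function.update (fun j => D.ev p (x j)) i (D.ev p z) := fun z => by
        funext j; by_cases hj : j = i
        · subst hj; simp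
        · simp [hj]
      simp only [h, map_add, MultilinearMap.map_update_add])
    (fun x i c a => D.ev_inj fun p => by
      classical
      simp only [map_smul, (D.exists_act _ _).choose_spec p]
      have h : ∀ z, (fun j => D.ev p (Function.update x i z j)) =
          Function.update (fun j => D.ev p (x j)) i (D.ev p z) := fun z => by
        funext j; by_cases hj : j = i
        · subst hj; simp
        · simp [hj]
      simp only [h, map_smul, MultilinearMap.map_update_smul])
  map_add' e e' := by
    ext x
    refine D.ev_inj fun p => ?_
    change D.ev p (D.exists_act _ _).choose =
      D.ev p ((D.exists_act _ _).choose + (D.exists_act _ _).choose)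
    rw [map_add, (D.exists_act _ _).choose_spec p, (D.exists_act _ _).choose_spec p,
      (D.exists_act _ _).choose_spec p, map_add, add_apply]
  map_smul' c e := by
    ext x
    refine D.ev_inj fun p => ?_
    change D.ev p (D.exists_act _ _).choose = D.ev p (c • (D.exists_act _ _).choose)
    rw [map_smul, (D.exists_act _ _).choose_spec p, (D.exists_act _ _).choose_spec p, map_smul,
      smul_apply]

lemma ev_act (p : D.Pt) {r : ℕ} (e : (O.O r).carrier) (x : Fin r → D.T) :
    D.ev p (D.act r e x) = (D.alg p).str.act r e (fun i => D.ev p (x i)) :=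
  (D.exists_act e x).choose_spec p

/-- The algebra generated by the `V j`. -/
@[reducible] noncomputable def algebra : DGAlg O where
  toDGVect := D.vect
  str :=
    { act := D.act
      act_mem := fun he hx => D.exists_act_mem he hx (fun a => D.ev_act a _ _)
      act_d := fun {r p q e x} he hx => D.ev_inj fun a => by
        rw [ev_d, ev_act, (D.alg a).str.act_d he (fun i => D.ev_mem a (hx i)), map_add, ev_act,
          map_sum]
        congr 1
        refine Finset.sum_congr rfl fun i _ => ?_
        rw [Units.smul_def, Units.smul_def, map_zsmul, ev_act]
        congr 2
        funext j
        by_cases hj : j = i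
        · subst hj; simp
        · simp [hj]
      act_one := fun x => D.ev_inj fun a => by
        rw [ev_act, (D.alg a).str.act_one]
      act_swap := fun i j h e x hx => D.ev_inj fun a => by
        rw [ev_act, (D.alg a).str.act_swap i j h e (fun i => D.ev_mem a (hx i)), Units.smul_def,
          Units.smul_def, map_zsmul, ev_act]
        rfl
      act_comp := fun h i p q a b x hb hx => D.ev_inj fun c => by
        rw [ev_act, (D.alg c).str.act_comp h i a hb (fun i => D.ev_mem c (hx i)), Units.smul_def,
          Units.smul_def, map_zsmul, ev_act]
        congr 2
        funext j
        split_ifs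
        · rw [ev_act]
        · rfl }

/-- Evaluation is a morphism of algebras. -/
noncomputable def π (p : D.Pt) : D.algebra ⟶ D.alg p where
  toFun := D.ev p
  map_mem := D.ev_mem p
  map_d := D.ev_d p
  map_act := D.ev_act p

lemma exists_ψ (j : D.J) (x : (D.V j).carrier) : ∃ y : D.T,
    (∀ p, D.ev p y = D.φ p j x) ∧ (∀ n, x ∈ (D.V j).gr n → y ∈ D.gr (n + D.shift j)) := by
  have key : ∀ n (x : (D.V j).gr n), ∀ p, D.ev p (D.cls (Term.gen j n x)) = D.φ p j x :=
    fun n x p => by rw [ev_cls, Term.eval]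
  have : ∃ y : D.T, ∀ p, D.ev p y = D.φ p j x := by
    have hx : x ∈ ⨆ n, (D.V j).gr n := by rw [DGVect.iSup_gr]; trivial
    induction hx using Submodule.iSup_induction' with
    | mem n x hx => exact ⟨_, key n ⟨x, hx⟩⟩
    | zero => exact ⟨0, fun p => by rw [map_zero, map_zero]⟩
    | add x x' _ _ h h' =>
      obtain ⟨y, hy⟩ := h
      obtain ⟨y', hy'⟩ := h'
      exact ⟨y + y', fun a => by rw [map_add, map_add, hy, hy']⟩
  obtain ⟨y, hy⟩ := this
  refine ⟨y, hy, fun n hx => ?_⟩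
  have h1 : y = D.cls (Term.gen j n ⟨x, hx⟩) :=
    D.ev_inj fun p => (hy p).trans (key n ⟨x, hx⟩ p).symm
  have h2 := D.cls_mem (Term.gen j n ⟨x, hx⟩)
  rw [Term.deg] at h2
  rw [h1]
  exact h2

/-- The universal maps from the generating vector spaces. -/
noncomputable def ψ (j : D.J) : (D.V j).carrier →ₗ[k] D.algebra.carrier where
  toFun x := (D.exists_ψ j x).choose
  map_add' x y := D.ev_inj fun p => by
    rw [map_add, (D.exists_ψ j _).choose_spec.1, (D.exists_ψ j _).choose_spec.1,
      (D.exists_ψ j _).choose_spec.1, map_add]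
  map_smul' c x := D.ev_inj fun p => by
    rw [map_smul, (D.exists_ψ j _).choose_spec.1, (D.exists_ψ j _).choose_spec.1, map_smul,
      RingHom.id_apply]

@[simp] lemma π_ψ (p : D.Pt) (j : D.J) (x : (D.V j).carrier) :
    (D.π p).toFun (D.ψ j x) = D.φ p j x := (D.exists_ψ j x).choose_spec.1 p

lemma ψ_mem {j : D.J} {n : ℤ} {x : (D.V j).carrier} (hx : x ∈ (D.V j).gr n) :
    D.ψ j x ∈ D.algebra.gr (n + D.shift j) := (D.exists_ψ j x).choose_spec.2 n hx

lemma algebra_inj {x y : D.algebra.carrier} (h : ∀ p, (D.π p).toFun x = (D.π p).toFun y) :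
    x = y := D.ev_inj h

lemma algebra_hom_ext {B : DGAlg O} {f g : D.algebra ⟶ B}
    (h : ∀ j x, f.toFun (D.ψ j x) = g.toFun (D.ψ j x)) : f = g := by
  have key : ∀ t : D.Term, f.toFun (D.cls t) = g.toFun (D.cls t) := by
    intro t
    induction t with
    | gen j n x =>
      have : D.cls (Term.gen j n x) = D.ψ j x := D.ev_inj fun p => by
        rw [ev_cls]; exact (D.π_ψ p j x).symm
      rw [this, h]
    | d t ih =>
      have : D.cls (Term.d t) = D.dd (D.cls t) := D.ev_inj fun p => by
        rw [ev_cls]; exact ((D.ev_d p _).trans (by rw [ev_cls]; rfl)).symm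
      rw [this]
      exact (f.map_d _).trans (ih ▸ (g.map_d _).symm)
    | op r p e t ih =>
      have : D.cls (Term.op r p e t) = D.algebra.str.act r e (fun i => D.cls (t i)) :=
        D.ev_inj fun p => by
          rw [ev_cls]; exact ((D.ev_act p _ _).trans (by simp only [ev_cls]; rfl)).symm
      rw [this]
      refine (f.map_act _ _).trans (Eq.trans ?_ (g.map_act _ _).symm)
      exact congrArg _ (funext ih)
  refine DGAlg.hom_ext fun x => ?_
  have hx : x ∈ Submodule.span k (Set.range D.cls) := by rw [D.span_cls]; trivial
  induction hx using Submodule.span_induction with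
  | mem x hx => obtain ⟨t, rfl⟩ := hx; exact key t
  | zero => rw [map_zero, map_zero]
  | add x y _ _ h1 h2 => exact (map_add f.toFun x y).trans (h1 ▸ h2 ▸ (map_add g.toFun x y).symm)
  | smul c x _ h => exact (map_smul f.toFun c x).trans (h ▸ (map_smul g.toFun c x).symm)

end GenData

end Generated

/-! ### Colimits of algebras -/

section Colimits

variable {O : DGOperad k} {J : Type u} [Category.{u} J] (F : J ⥤ DGAlg O)

/-- The values of `F` with all their cocones. -/
def colimGenData : GenData O where
  J := J
  V j := (F.obj j).toDGVect
  shift _ := 0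
  Pt := Cocone F
  alg c := c.pt
  φ c j := (c.ι.app j).toFun
  φ_mem c j n x hx := by simpa using (c.ι.app j).map_mem hx

/-- The colimit cocone. -/
noncomputable def colimCocone : Cocone F where
  pt := (colimGenData F).algebra
  ι :=
    { app j :=
        { toFun := (colimGenData F).ψ j
          map_mem := fun {n x} hx => by
            have h := (colimGenData F).ψ_mem (j := j) hx
            have e : n + (colimGenData F).shift j = n := add_zero n
            rw [e] at h
            exact h
          map_d := fun x => (colimGenData F).algebra_inj fun p =>
            ((colimGenData F).π_ψ p j _).trans <| ((p.ι.app j).map_d x).trans <|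
              (congrArg p.pt.d ((colimGenData F).π_ψ p j x).symm).trans
                (((colimGenData F).π p).map_d _).symm
          map_act := fun e x => (colimGenData F).algebra_inj fun p =>
            ((colimGenData F).π_ψ p j _).trans <| ((p.ι.app j).map_act e x).trans <|
              (congrArg (p.pt.str.act _ e)
                (funext fun i => ((colimGenData F).π_ψ p j (x i)).symm)).trans
                (((colimGenData F).π p).map_act _ _).symm }
      naturality i j f := DGAlg.hom_ext fun x => (colimGenData F).algebra_inj fun p =>
        ((colimGenData F).π_ψ p j _).trans <|
          (congrArg (fun g => DGAlg.Hom.toFun g x) (p.w f)).trans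
            ((colimGenData F).π_ψ p i x).symm }

instance : HasColimitsOfSize.{u, u} (DGAlg O) where
  has_colimits_of_shape _ _ :=
    { has_colimit F := ⟨⟨colimCocone F,
        { desc c := (colimGenData F).π c
          fac c j := DGAlg.hom_ext fun x => (colimGenData F).π_ψ c j x
          uniq c _ hm := (colimGenData F).algebra_hom_ext fun j x =>
            (congrArg (fun g => DGAlg.Hom.toFun g x) (hm j)).trans
              ((colimGenData F).π_ψ c j x).symm }⟩⟩ }

end Colimits

/-! ### Normalized cochains with coefficients -/

section Cochains

open Simplicial

namespace DGVect

/-- The homogeneous normalized cochains of degree `n` on `X` with coefficients in `V`: families of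
functions on the `q`-simplices, with values of degree `n + q`, that vanish on the degenerate
simplices. Equivalently, linear maps `N_*(X; k) → V` of degree `n`. -/
def cochainGr (X : SSet.{u}) (V : DGVect k) (n : ℤ) :
    Submodule k (∀ q : ℕ, X _⦋q⦌ → V.carrier) where
  carrier := {c | (∀ (q : ℕ) (x), c q x ∈ V.gr (n + q)) ∧ ∀ q, ∀ x ∈ X.degenerate q, c q x = 0}
  zero_mem' := ⟨fun _ _ => zero_mem _, fun _ _ _ => rfl⟩
  add_mem' h h' := ⟨fun q x => add_mem (h.1 q x) (h'.1 q x), fun q x hx => by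
    simp [h.2 q x hx, h'.2 q x hx]⟩
  smul_mem' a c h := ⟨fun q x => Submodule.smul_mem _ _ (h.1 q x), fun q x hx => by
    simp [h.2 q x hx]⟩

/-- The total differential: the simplicial coboundary plus `(-1) ^ q` times the differential of
`V` on `q`-cochains. -/
def cochainD (X : SSet.{u}) (V : DGVect k) :
    (∀ q : ℕ, X _⦋q⦌ → V.carrier) →ₗ[k] (∀ q : ℕ, X _⦋q⦌ → V.carrier) where
  toFun c
    | 0, x => V.d (c 0 x)
    | q + 1, x => ∑ i : Fin (q + 2), (-1 : k) ^ (i : ℕ) • c q (X.δ i x) +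
        (-1 : k) ^ (q + 1) • V.d (c (q + 1) x)
  map_add' c c' := by
    funext q x
    cases q with
    | zero => simp
    | succ q => simp [Finset.sum_add_distrib]; abel
  map_smul' a c := by
    funext q x
    cases q with
    | zero => simp
    | succ q =>
      simp only [Pi.smul_apply, map_smul, RingHom.id_apply, smul_add, Finset.smul_sum]
      simp only [smul_comm a]

lemma cochain_sum_sum (X : SSet.{u}) (V : DGVect k) {q : ℕ} (c : X _⦋q⦌ → V.carrier)
    (x : X _⦋q + 2⦌) : ∑ i : Fin (q + 3), (-1 : k) ^ (i : ℕ) •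
      ∑ j : Fin (q + 2), (-1 : k) ^ (j : ℕ) • c (X.δ j (X.δ i x)) = 0 := by
  let C : SimplexCategory ⥤ ModuleCat.{u} k :=
    { obj n := ModuleCat.of k (X.obj (op n) → V.carrier)
      map f := ModuleCat.ofHom (LinearMap.funLeft k V.carrier (X.map f.op))
      map_id n := by ext; simp [LinearMap.funLeft]
      map_comp f g := by ext; simp [LinearMap.funLeft] }
  have h := AlgebraicTopology.AlternatingCofaceMapComplex.d_squared C q
  have h' := congrFun (LinearMap.congr_fun (congrArg ModuleCat.Hom.hom h) c) x
  have key : ∀ (m : ℕ) (c' : X _⦋m⦌ → V.carrier) (y : X _⦋m + 1⦌),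
      (AlgebraicTopology.AlternatingCofaceMapComplex.objD C m).hom c' y =
        ∑ i : Fin (m + 2), (-1 : k) ^ (i : ℕ) • c' (X.δ i y) := by
    intro m c' y
    have e : (AlgebraicTopology.AlternatingCofaceMapComplex.objD C m).hom =
        ∑ i : Fin (m + 2), (-1 : ℤ) ^ (i : ℕ) • (CosimplicialObject.δ C i).hom := by
      simp [AlgebraicTopology.AlternatingCofaceMapComplex.objD, ModuleCat.hom_sum]
    rw [e]
    rw [LinearMap.sum_apply, Finset.sum_apply]
    refine Finset.sum_congr rfl fun i _ => ?_
    rcases Nat.even_or_odd (i : ℕ) with hi | hi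
    · rw [hi.neg_one_pow, hi.neg_one_pow, one_smul, one_smul]; rfl
    · rw [hi.neg_one_pow, hi.neg_one_pow, neg_one_smul, neg_one_smul]; rfl
  rw [ModuleCat.hom_comp, LinearMap.comp_apply, key] at h'
  simp only [key] at h'
  exact h'

lemma cochainD_cochainD (X : SSet.{u}) (V : DGVect k) (c) :
    cochainD X V (cochainD X V c) = 0 := by
  funext q x
  match q with
  | 0 => simp [cochainD, V.d_d]
  | 1 =>
    simp only [cochainD, LinearMap.coe_mk, AddHom.coe_mk, map_add, map_sum, map_smul, V.d_d,
      smul_zero, add_zero, Finset.smul_sum, Pi.zero_apply]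
    rw [← Finset.sum_add_distrib]
    refine Finset.sum_eq_zero fun i _ => ?_
    module
  | q + 2 =>
    simp only [cochainD, LinearMap.coe_mk, AddHom.coe_mk, map_add, map_sum, map_smul, V.d_d,
      smul_zero, add_zero, smul_add, Finset.sum_add_distrib, Pi.zero_apply]
    rw [cochain_sum_sum, zero_add, Finset.smul_sum, ← Finset.sum_add_distrib]
    refine Finset.sum_eq_zero fun i _ => ?_
    rw [pow_succ (-1 : k) (q + 1)]
    module

lemma cochainD_mem {X : SSet.{u}} {V : DGVect k} {n : ℤ} {c} (hc : c ∈ cochainGr X V n) :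
    cochainD X V c ∈ cochainGr X V (n - 1) := by
  refine ⟨fun q x => ?_, fun q x hx => ?_⟩
  · cases q with
    | zero => simpa [cochainD] using V.d_mem (hc.1 0 x)
    | succ q =>
      refine add_mem (sum_mem fun i _ => Submodule.smul_mem _ _ ?_) (Submodule.smul_mem _ _ ?_)
      · have := hc.1 q (X.δ i x)
        rwa [show n + (q : ℤ) = n - 1 + ((q + 1 : ℕ) : ℤ) by push_cast; ring] at this
      · have := V.d_mem (hc.1 (q + 1) x)
        rwa [show n + ((q + 1 : ℕ) : ℤ) - 1 = n - 1 + ((q + 1 : ℕ) : ℤ) by ring] at this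
  · cases q with
    | zero => simp at hx
    | succ q =>
      have h1 : V.d (c (q + 1) x) = 0 := by rw [hc.2 _ x hx, map_zero]
      change ∑ i : Fin (q + 2), (-1 : k) ^ (i : ℕ) • c q (X.δ i x) +
        (-1 : k) ^ (q + 1) • V.d (c (q + 1) x) = 0
      rw [h1, smul_zero, add_zero]
      rw [SSet.degenerate_eq_iUnion_range_σ] at hx
      obtain ⟨s, hs⟩ := Set.mem_iUnion.1 hx
      obtain ⟨y, rfl⟩ := hs
      have hne : s.castSucc ≠ s.succ := (Fin.castSucc_lt_succ (i := s)).ne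
      rw [← Finset.sum_subset (Finset.subset_univ {s.castSucc, s.succ})]
      · rw [Finset.sum_pair hne]
        rw [SSet.δ_comp_σ_self_apply, SSet.δ_comp_σ_succ_apply, Fin.val_castSucc, Fin.val_succ,
          pow_succ]
        module
      · intro i _ hi
        have hd : X.δ i (X.σ s y) ∈ X.degenerate q := by
          simp only [Finset.mem_insert, Finset.mem_singleton, not_or] at hi
          cases q with
          | zero => exact absurd (Fin.ext (by have := Fin.val_ne_of_ne hi.1
                                              have := Fin.val_ne_of_ne hi.2
                                              have := i.2; have := s.2
                                              simp only [Fin.val_castSucc, Fin.val_succ] at *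
                                              omega)) hi.1
          | succ q =>
            rcases lt_trichotomy i s.castSucc with h | h | h
            · obtain ⟨i, rfl⟩ := Fin.eq_castSucc_of_ne_last (Fin.ne_last_of_lt h)
              obtain ⟨s, rfl⟩ := Fin.eq_succ_of_ne_zero (i := s) (by
                rintro rfl; simp at h)
              rw [SSet.δ_comp_σ_of_le_apply (by
                rw [Fin.lt_def] at h; rw [Fin.le_def]
                simp only [Fin.val_castSucc, Fin.val_succ] at *; omega)]
              exact X.σ_mem_degenerate _ _
            · exact absurd h hi.1
            · have h' : s.succ < i := by
                have := Fin.val_ne_of_ne hi.2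
                rw [Fin.lt_def] at *; simp only [Fin.val_castSucc, Fin.val_succ] at *; omega
              rw [SSet.δ_comp_σ_of_gt'_apply h']
              exact X.σ_mem_degenerate _ _
        rw [hc.2 _ _ hd, smul_zero]

/-- The differential graded vector space of normalized cochains on `X` with coefficients in `V`,
that is, the internal Hom complex from the normalized chains `N_*(X; k)` to `V`. -/
noncomputable def cochains (X : SSet.{u}) (V : DGVect k) : DGVect k where
  carrier := ↥(⨆ n, cochainGr X V n)
  gr n := (cochainGr X V n).comap (Submodule.subtype _)
  isInternal := by
    refine DirectSum.isInternal_submodule_of_iSupIndep_of_iSup_eq_top ?_ ?_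
    · refine iSupIndep_of_joint _ (fun _ : Σ q : ℕ, X _⦋q⦌ => V) (fun i => (i.1 : ℤ))
        (fun i => (LinearMap.proj i.2 ∘ₗ LinearMap.proj i.1) ∘ₗ Submodule.subtype _) ?_ ?_
      · intro i n x hx
        exact hx.1 i.1 i.2
      · intro x hx
        ext q y
        exact hx ⟨q, y⟩
    · rw [eq_top_iff]
      rintro ⟨x, hx⟩ -
      induction hx using Submodule.iSup_induction' with
      | mem n x hx => exact Submodule.mem_iSup_of_mem n hx
      | zero => exact zero_mem _
      | add x y _ _ h1 h2 => exact add_mem h1 h2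
  d := (cochainD X V).restrict (fun c hc => by
    have : (⨆ n, cochainGr X V n) ≤ (⨆ n, cochainGr X V n).comap (cochainD X V) :=
      iSup_le fun n c hc => Submodule.mem_iSup_of_mem (n - 1) (cochainD_mem hc)
    exact this hc)
  d_mem hx := cochainD_mem hx
  d_d x := Subtype.ext (cochainD_cochainD X V x.1)

/-- The value of a cochain on a simplex. -/
noncomputable def cochainEval {X : SSet.{u}} {V : DGVect k} {q : ℕ} (x : X _⦋q⦌) :
    (V.cochains X).carrier →ₗ[k] V.carrier :=
  (LinearMap.proj x ∘ₗ LinearMap.proj q) ∘ₗ Submodule.subtype _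

lemma cochain_ext {X : SSet.{u}} {V : DGVect k} {c c' : (V.cochains X).carrier}
    (h : ∀ q (x : X _⦋q⦌), cochainEval x c = cochainEval x c') : c = c' := by
  refine Subtype.ext ?_
  funext q x
  exact h q x

lemma cochainEval_degenerate {X : SSet.{u}} {V : DGVect k} {q : ℕ} {x : X _⦋q⦌}
    (hx : x ∈ X.degenerate q) (c : (V.cochains X).carrier) : cochainEval x c = 0 := by
  have h : (⨆ n, cochainGr X V n) ≤
      LinearMap.ker (LinearMap.proj x ∘ₗ LinearMap.proj q :
        (∀ q : ℕ, X _⦋q⦌ → V.carrier) →ₗ[k] V.carrier) :=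
    iSup_le fun n c hc => hc.2 q x hx
  exact h c.2

/-- The map on families of functions induced by `f : X ⟶ Y` and a linear map on values. -/
def precompCochain {X Y : SSet.{u}} (f : X ⟶ Y) {V W : DGVect k}
    (g : V.carrier →ₗ[k] W.carrier) :
    (∀ q : ℕ, Y _⦋q⦌ → V.carrier) →ₗ[k] (∀ q : ℕ, X _⦋q⦌ → W.carrier) where
  toFun c q x := g (c q (f.app _ x))
  map_add' c c' := by funext q x; simp
  map_smul' a c := by funext q x; exact map_smul g a _

/-- The map on normalized cochains induced by `f : X ⟶ Y` and a linear map `g` of degree `0` on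
the coefficients: `c ↦ g ∘ c ∘ f`. -/
noncomputable def cochainMap {X Y : SSet.{u}} (f : X ⟶ Y) {V W : DGVect k}
    (g : V.carrier →ₗ[k] W.carrier) (hg : ∀ {n x}, x ∈ V.gr n → g x ∈ W.gr n) :
    (V.cochains Y).carrier →ₗ[k] (W.cochains X).carrier :=
  (precompCochain f g).restrict (fun c hc => by
    have : (⨆ n, cochainGr Y V n) ≤ (⨆ n, cochainGr X W n).comap (precompCochain f g) :=
      iSup_le fun n c hc => Submodule.mem_iSup_of_mem n
        ⟨fun q x => hg (hc.1 q _), fun q x hx => by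
          change g _ = 0
          rw [hc.2 q _ (SSet.degenerate_le_preimage f q hx), map_zero]⟩
    exact this hc)

lemma cochainMap_mem {X Y : SSet.{u}} (f : X ⟶ Y) {V W : DGVect k}
    {g : V.carrier →ₗ[k] W.carrier} (hg : ∀ {n x}, x ∈ V.gr n → g x ∈ W.gr n) {n : ℤ}
    {c : (V.cochains Y).carrier} (hc : c ∈ (V.cochains Y).gr n) :
    cochainMap f g hg c ∈ (W.cochains X).gr n :=
  ⟨fun q x => hg (hc.1 q _), fun q x hx => by
    change g _ = 0
    rw [hc.2 q _ (SSet.degenerate_le_preimage f q hx), map_zero]⟩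

lemma cochainMap_d {X Y : SSet.{u}} (f : X ⟶ Y) {V W : DGVect k}
    {g : V.carrier →ₗ[k] W.carrier} (hg : ∀ {n x}, x ∈ V.gr n → g x ∈ W.gr n)
    (hd : ∀ x, g (V.d x) = W.d (g x)) (c : (V.cochains Y).carrier) :
    cochainMap f g hg ((V.cochains Y).d c) = (W.cochains X).d (cochainMap f g hg c) := by
  refine Subtype.ext ?_
  funext q x
  cases q with
  | zero => exact hd _
  | succ q =>
    change g (∑ i : Fin (q + 2), (-1 : k) ^ (i : ℕ) • c.1 q (Y.δ i (f.app _ x)) +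
        (-1 : k) ^ (q + 1) • V.d (c.1 (q + 1) (f.app _ x))) =
      ∑ i : Fin (q + 2), (-1 : k) ^ (i : ℕ) • g (c.1 q (f.app _ (X.δ i x))) +
        (-1 : k) ^ (q + 1) • W.d (g (c.1 (q + 1) (f.app _ x)))
    simp only [map_add, map_sum, map_smul, hd, SSet.δ_naturality_apply]

end DGVect

end Cochains

/-! ### The simplicial tensoring of algebras -/

section Tensoring

open Simplicial

/-- A natural `O`-algebra structure on the normalized cochains on simplicial sets with
coefficients in `O`-algebras, which for the point is the given structure on the coefficients.
(For the Barratt–Eccles operad such a structure was constructed by Berger and Fresse from its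
diagonal and its action on `N_*(X; k)`.) -/
structure CochainAlgebras (O : DGOperad k) where
  str (X : SSet.{u}) (A : DGAlg O) : AlgStr O (A.toDGVect.cochains X)
  natural : ∀ {X Y : SSet.{u}} (f : X ⟶ Y) {A B : DGAlg O} (g : A ⟶ B) {r : ℕ}
    (e : (O.O r).carrier) (c : Fin r → (A.toDGVect.cochains Y).carrier),
    DGVect.cochainMap f g.toFun g.map_mem ((str Y A).act r e c) =
      (str X B).act r e (fun i => DGVect.cochainMap f g.toFun g.map_mem (c i))
  point : ∀ (A : DGAlg O) (x : (Δ[0] : SSet.{u}) _⦋0⦌) {r : ℕ} (e : (O.O r).carrier)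
    (c : Fin r → (A.toDGVect.cochains Δ[0]).carrier),
    DGVect.cochainEval x ((str Δ[0] A).act r e c) =
      A.str.act r e (fun i => DGVect.cochainEval x (c i))

namespace CochainAlgebras

variable {O : DGOperad k} (K : CochainAlgebras O)

/-- The cotensor `A ^ X`: the algebra of normalized cochains on `X` with coefficients in `A`. -/
@[simps obj]
noncomputable def cotensor (X : SSet.{u}) : DGAlg O ⥤ DGAlg O where
  obj A := ⟨A.toDGVect.cochains X, K.str X A⟩
  map g := ⟨DGVect.cochainMap (𝟙 X) g.toFun g.map_mem, DGVect.cochainMap_mem _ _,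
    DGVect.cochainMap_d _ _ g.map_d, K.natural (𝟙 X) g⟩

/-- The restriction `A ^ Y ⟶ A ^ X` along `f : X ⟶ Y`. -/
noncomputable def restr {X Y : SSet.{u}} (f : X ⟶ Y) : K.cotensor Y ⟶ K.cotensor X where
  app A := ⟨DGVect.cochainMap f LinearMap.id id, DGVect.cochainMap_mem _ _,
    DGVect.cochainMap_d _ _ (fun _ => rfl), K.natural f (𝟙 A)⟩

/-- All algebra maps from `A` to cochain algebras `B ^ X`. -/
noncomputable def tensorGenData (X : SSet.{u}) (A : DGAlg O) : GenData O where
  J := Σ q : ℕ, X _⦋q⦌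
  V _ := A.toDGVect
  shift j := j.1
  Pt := StructuredArrow A (K.cotensor X)
  alg p := p.right
  φ p j := DGVect.cochainEval j.2 ∘ₗ p.hom.toFun
  φ_mem p j _ _ hx := (p.hom.map_mem hx).1 j.1 j.2

lemma exists_tensorUnit (X : SSet.{u}) (A : DGAlg O) :
    ∃ η : A ⟶ (K.cotensor X).obj (K.tensorGenData X A).algebra,
      ∀ x q (y : X _⦋q⦌), DGVect.cochainEval y (η.toFun x) =
        (K.tensorGenData X A).ψ ⟨q, y⟩ x := by
  let D := K.tensorGenData X A
  let f : A.carrier →ₗ[k] (∀ q : ℕ, X _⦋q⦌ → D.algebra.carrier) :=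
    LinearMap.pi fun q => LinearMap.pi fun y => D.ψ ⟨q, y⟩
  have hgr : ∀ n x, x ∈ A.gr n → f x ∈ DGVect.cochainGr X D.algebra.toDGVect n := by
    intro n x hx
    refine ⟨fun q y => D.ψ_mem (j := ⟨q, y⟩) hx, fun q y hy => ?_⟩
    refine D.algebra_inj fun p => (D.π_ψ p ⟨q, y⟩ x).trans ?_
    exact (DGVect.cochainEval_degenerate hy (p.hom.toFun x)).trans
      (map_zero (D.π p).toFun).symm
  have hf : ∀ x, f x ∈ ⨆ n, DGVect.cochainGr X D.algebra.toDGVect n := by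
    intro x
    have h : (⨆ n, A.gr n) ≤ (⨆ n, DGVect.cochainGr X D.algebra.toDGVect n).comap f :=
      iSup_le fun n x hx => Submodule.mem_iSup_of_mem n (hgr n x hx)
    exact h (by rw [DGVect.iSup_gr]; trivial)
  let F : A.carrier →ₗ[k] (D.algebra.toDGVect.cochains X).carrier := f.codRestrict _ hf
  have hF : ∀ (p : D.Pt) x,
      DGVect.cochainMap (𝟙 X) (D.π p).toFun (D.π p).map_mem (F x) = p.hom.toFun x :=
    fun p x => DGVect.cochain_ext fun q y => D.π_ψ p ⟨q, y⟩ x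
  have inj : ∀ c c' : (D.algebra.toDGVect.cochains X).carrier,
      (∀ p, DGVect.cochainMap (𝟙 X) (D.π p).toFun (D.π p).map_mem c =
        DGVect.cochainMap (𝟙 X) (D.π p).toFun (D.π p).map_mem c') → c = c' :=
    fun c c' h => DGVect.cochain_ext fun q y => D.algebra_inj fun p =>
      congrArg (DGVect.cochainEval y) (h p)
  refine ⟨⟨F, fun {n x} hx => hgr n x hx, fun x => inj _ _ fun p => ?_,
    fun e x => inj _ _ fun p => ?_⟩, fun x q y => rfl⟩
  · refine (hF p _).trans ((p.hom.map_d x).trans ?_)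
    refine Eq.trans ?_ (DGVect.cochainMap_d (𝟙 X) (D.π p).map_mem (D.π p).map_d (F x)).symm
    exact congrArg _ (hF p x).symm
  · refine (hF p _).trans ((p.hom.map_act e x).trans ?_)
    refine Eq.trans ?_ (K.natural (𝟙 X) (D.π p) e (fun i => F (x i))).symm
    exact congrArg _ (funext fun i => (hF p (x i)).symm)

instance (X : SSet.{u}) : (K.cotensor X).IsRightAdjoint := by
  have : ∀ A, HasInitial (StructuredArrow A (K.cotensor X)) := by
    intro A
    obtain ⟨η, hη⟩ := K.exists_tensorUnit X A
    let D := K.tensorGenData X A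
    refine (IsInitial.ofUniqueHom (X := StructuredArrow.mk η)
      (fun p => StructuredArrow.homMk (D.π p) ?_) ?_).hasInitial
    · refine DGAlg.hom_ext fun x => DGVect.cochain_ext fun q y => ?_
      exact (congrArg (D.π p).toFun (hη x q y)).trans (D.π_ψ p ⟨q, y⟩ x)
    · intro p m
      refine StructuredArrow.hom_ext _ _ (D.algebra_hom_ext fun j x => ?_)
      refine Eq.trans ?_ (D.π_ψ p j x).symm
      refine (congrArg m.right.toFun (hη x j.1 j.2).symm).trans ?_
      exact congrArg (fun g => DGVect.cochainEval j.2 (DGAlg.Hom.toFun g x))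
        (StructuredArrow.w m)
  exact isRightAdjointOfStructuredArrowInitials _

/-- The tensor `X ⊗ A` of a simplicial set and an algebra: the value at `A` of the left adjoint
of `B ↦ B ^ X`. -/
noncomputable def tensor (X : SSet.{u}) (A : DGAlg O) : DGAlg O :=
  (K.cotensor X).leftAdjoint.obj A

/-- Morphisms `X ⊗ A ⟶ B` are the same as morphisms `A ⟶ B ^ X`. -/
noncomputable def tensorHomEquiv (X : SSet.{u}) (A B : DGAlg O) :
    (K.tensor X A ⟶ B) ≃ (A ⟶ (K.cotensor X).obj B) :=
  (Adjunction.ofIsRightAdjoint (K.cotensor X)).homEquiv A B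

/-- The tensor is functorial in both variables. -/
noncomputable def tensorMap {X Y : SSet.{u}} (f : X ⟶ Y) {A B : DGAlg O} (g : A ⟶ B) :
    K.tensor X A ⟶ K.tensor Y B :=
  (K.tensorHomEquiv X A _).symm
    (g ≫ K.tensorHomEquiv Y B _ (𝟙 _) ≫ (K.restr f).app (K.tensor Y B))

end CochainAlgebras

end Tensoring

/-! ### Homotopy theory of algebras -/

section Homotopy

variable {O : DGOperad k}

/-- Weak equivalences of algebras: the quasi-isomorphisms. -/
def DGAlg.WeakEquiv {A B : DGAlg O} (f : A ⟶ B) : Prop := DGVect.QuasiIso f.toFun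

/-- An algebra is cofibrant if it has the left lifting property with respect to the trivial
fibrations, that is, the surjective quasi-isomorphisms. -/
def DGAlg.IsCofibrant (A : DGAlg O) : Prop :=
  ∀ (B C : DGAlg O) (p : B ⟶ C) (f : A ⟶ C), Function.Surjective p.toFun →
    DGAlg.WeakEquiv p → ∃ l : A ⟶ B, l ≫ p = f

/-- `q : Q ⟶ A` exhibits the `G`-equivariant algebra `Q` as a cofibrant replacement of the
`G`-equivariant algebra `A`: it is a `G`-equivariant weak equivalence, and `Q` is cofibrant as an
algebra. -/
structure IsCofibrantReplacement {G : Type u} [Group G] {Q A : SingleObj G ⥤ DGAlg O}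
    (q : Q ⟶ A) : Prop where
  cofibrant : (Q.obj (SingleObj.star G)).IsCofibrant
  weakEquiv : DGAlg.WeakEquiv (q.app (SingleObj.star G))

end Homotopy

/-! ### Principal bundles over simplicial sets -/

section Bundles

open Simplicial

lemma types_hom_ext {S T : Type u} {f g : S ⟶ T} (h : ∀ x, f x = g x) : f = g := by
  ext x
  exact h x

/-- The classifying space of a group: the nerve of the groupoid with one object. -/
abbrev BG (G : Type u) [Group G] : SSet.{u} := nerve (SingleObj G)

/-- The total space of the universal bundle: its `n`-simplices are families `Fin (n + 1) → G`. -/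
def EG (G : Type u) : SSet.{u} where
  obj n := Fin (n.unop.len + 1) → G
  map f := ↾fun x => x ∘ f.unop.toOrderHom

/-- The universal bundle `EG ⟶ BG`, which sends `(x₀, …, xₙ)` to the simplex with edges
`xⱼ xᵢ⁻¹`. It is the quotient by the action of `G` by right multiplication. -/
def universalBundle (G : Type u) [Group G] : EG G ⟶ BG G where
  app _ := ↾fun x =>
    { obj _ := SingleObj.star G
      map {i j} _ := (x j * (x i)⁻¹ : G)
      map_id i := mul_inv_cancel (x i)
      map_comp {i j l} _ _ := by
        change x l * (x i)⁻¹ = (x l * (x j)⁻¹) * (x j * (x i)⁻¹)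
        group }
  naturality _ _ _ := rfl

variable {G : Type u} [Group G] {X : SSet.{u}} (φ : X ⟶ BG G)

/-- The total space `φ^* EG` of the bundle classified by `φ`: the pullback of the universal bundle
along `φ`. -/
def totalSpace : SSet.{u} where
  obj n := {z : X.obj n × (EG G).obj n // φ.app n z.1 = (universalBundle G).app n z.2}
  map f := ↾fun z => ⟨(X.map f z.1.1, (EG G).map f z.1.2), by
    have h1 := NatTrans.naturality_apply φ f z.1.1
    have h2 := NatTrans.naturality_apply (universalBundle G) f z.1.2
    exact h1.trans ((congrArg _ z.2).trans h2.symm)⟩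
  map_id n := by
    refine types_hom_ext fun z => Subtype.ext (Prod.ext ?_ rfl)
    exact congrArg (fun f => f z.1.1) (X.map_id n)
  map_comp f g := by
    refine types_hom_ext fun z => Subtype.ext (Prod.ext ?_ rfl)
    exact congrArg (fun f => f z.1.1) (X.map_comp f g)

/-- The right action of `g : G` on the total space. -/
def totalSpaceMul (g : G) : totalSpace φ ⟶ totalSpace φ where
  app n := ↾fun z => ⟨(z.1.1, fun i => z.1.2 i * g), by
    refine z.2.trans ?_
    refine CategoryTheory.Functor.ext (fun _ => rfl) (fun i j f => ?_)
    simp only [eqToHom_refl, Category.id_comp, Category.comp_id]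
    change z.1.2 j * (z.1.2 i)⁻¹ = (z.1.2 j * g) * (z.1.2 i * g)⁻¹
    group⟩
  naturality _ _ _ := rfl

/-- The total space with its right action, as a functor `(∗ // G)ᵒᵖ ⥤ SSet`. -/
def bundle : (SingleObj G)ᵒᵖ ⥤ SSet.{u} where
  obj _ := totalSpace φ
  map g := totalSpaceMul φ (Quiver.Hom.unop g : G)
  map_id _ := by
    refine SSet.hom_ext fun n => types_hom_ext fun z =>
      Subtype.ext (Prod.ext rfl (funext fun i => ?_))
    exact mul_one (z.1.2 i)
  map_comp f g := by
    refine SSet.hom_ext fun n => types_hom_ext fun z =>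
      Subtype.ext (Prod.ext rfl (funext fun i => ?_))
    exact (mul_assoc (z.1.2 i) _ _).symm

/-- The product `X × G` of `X` with the discrete simplicial set `G`. -/
def prodDiscrete (X : SSet.{u}) (G : Type u) : SSet.{u} where
  obj n := X.obj n × G
  map f := ↾fun z => (X.map f z.1, z.2)
  map_id n := by
    refine types_hom_ext fun z => Prod.ext ?_ rfl
    exact congrArg (fun f => f z.1) (X.map_id n)
  map_comp f g := by
    refine types_hom_ext fun z => Prod.ext ?_ rfl
    exact congrArg (fun f => f z.1) (X.map_comp f g)

/-- A trivialization of the principal `G`-bundle classified by `φ`: an isomorphism over `X`,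
compatible with the right actions of `G`, from `φ^* EG` to the trivial bundle `X × G`. -/
structure Trivialization where
  iso : totalSpace φ ≅ prodDiscrete X G
  over_base : ∀ n (z : (totalSpace φ).obj n), (iso.hom.app n z).1 = z.1.1
  equivariant : ∀ n (z : (totalSpace φ).obj n) (g : G),
    (iso.hom.app n ((totalSpaceMul φ g).app n z)).2 = (iso.hom.app n z).2 * g

variable {φ} in
/-- The section of the bundle that corresponds to `x ↦ (x, h)` under a trivialization. -/
def Trivialization.sect (τ : Trivialization φ) (h : G) : X ⟶ totalSpace φ where
  app n := ↾fun x => τ.iso.inv.app n ((x, h) : X.obj n × G)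
  naturality n _ f := by
    refine types_hom_ext fun x => ?_
    exact NatTrans.naturality_apply τ.iso.inv f ((x, h) : X.obj n × G)

end Bundles

/-! ### Equivariant higher Hochschild chains -/

section Chains

open Simplicial

variable {O : DGOperad k} (K : CochainAlgebras O) {G : Type u} [Group G]

namespace CochainAlgebras

lemma tensorMap_id (X : SSet.{u}) (A : DGAlg O) : K.tensorMap (𝟙 X) (𝟙 A) = 𝟙 _ := by
  rw [tensorMap, Equiv.symm_apply_eq, Category.id_comp]
  have : K.restr (𝟙 X) = 𝟙 _ := rfl
  rw [this, NatTrans.id_app, Category.comp_id]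

lemma tensorHomEquiv_naturality (X : SSet.{u}) {A B C : DGAlg O} (f : K.tensor X A ⟶ B)
    (g : B ⟶ C) :
    K.tensorHomEquiv X A C (f ≫ g) = K.tensorHomEquiv X A B f ≫ (K.cotensor X).map g :=
  (Adjunction.ofIsRightAdjoint (K.cotensor X)).homEquiv_naturality_right f g

lemma tensorHomEquiv_tensorMap {X Y : SSet.{u}} (f : X ⟶ Y) {A B C : DGAlg O} (g : A ⟶ B)
    (h : K.tensor Y B ⟶ C) :
    K.tensorHomEquiv X A C (K.tensorMap f g ≫ h) =
      g ≫ K.tensorHomEquiv Y B C h ≫ (K.restr f).app C := by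
  rw [tensorHomEquiv_naturality, tensorMap, Equiv.apply_symm_apply, Category.assoc,
    Category.assoc, ← NatTrans.naturality, ← Category.assoc (K.tensorHomEquiv Y B _ (𝟙 _)),
    ← tensorHomEquiv_naturality, Category.id_comp]

lemma tensorMap_comp {X Y Z : SSet.{u}} (f : X ⟶ Y) (f' : Y ⟶ Z) {A B C : DGAlg O} (g : A ⟶ B)
    (g' : B ⟶ C) : K.tensorMap f g ≫ K.tensorMap f' g' = K.tensorMap (f ≫ f') (g ≫ g') := by
  apply (K.tensorHomEquiv X A _).injective
  have := K.tensorHomEquiv_tensorMap f g (K.tensorMap f' g')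
  rw [this]
  have h1 := K.tensorHomEquiv_tensorMap f' g' (𝟙 _)
  have h2 := K.tensorHomEquiv_tensorMap (f ≫ f') (g ≫ g') (𝟙 _)
  rw [Category.comp_id] at h1 h2
  rw [h1, h2]
  simp only [Category.assoc]
  rfl

lemma tensorMap_of_id {X : SSet.{u}} {A : DGAlg O} {f : X ⟶ X} {g : A ⟶ A} (hf : f = 𝟙 X)
    (hg : g = 𝟙 A) : K.tensorMap f g = 𝟙 _ := by rw [hf, hg, tensorMap_id]

lemma tensorMap_whiskerLeft_comp (W : SSet.{u}) (A : DGAlg O) {n n' n'' : SimplexCategory}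
    (g : n ⟶ n') (g' : n' ⟶ n'') :
    K.tensorMap (W ◁ SSet.stdSimplex.map (g ≫ g')) (𝟙 A) =
      K.tensorMap (W ◁ SSet.stdSimplex.map g) (𝟙 A) ≫
        K.tensorMap (W ◁ SSet.stdSimplex.map g') (𝟙 A) := by
  rw [tensorMap_comp, ← MonoidalCategory.whiskerLeft_comp, Category.comp_id]
  exact congrArg (fun y => K.tensorMap (W ◁ y) (𝟙 A)) (SSet.stdSimplex.map_comp g g')

lemma tensorMap_exchange {W W' : SSet.{u}} (w : W ⟶ W') {A A' : DGAlg O} (a : A ⟶ A')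
    {Y Y' : SSet.{u}} (y : Y ⟶ Y') :
    K.tensorMap (W ◁ y) (𝟙 A) ≫ K.tensorMap (w ▷ Y') a =
      K.tensorMap (w ▷ Y) a ≫ K.tensorMap (W' ◁ y) (𝟙 A') := by
  rw [tensorMap_comp, tensorMap_comp, MonoidalCategory.whisker_exchange, Category.id_comp,
    Category.comp_id]

lemma tensorMap_whiskerRight_comp {W W' W'' : SSet.{u}} {w : W ⟶ W'} {w' : W' ⟶ W''}
    {w'' : W ⟶ W''} (hw : w ≫ w' = w'') {A A' A'' : DGAlg O} {a : A ⟶ A'} {a' : A' ⟶ A''}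
    {a'' : A ⟶ A''} (ha : a ≫ a' = a'') (Y : SSet.{u}) :
    K.tensorMap (w'' ▷ Y) a'' = K.tensorMap (w ▷ Y) a ≫ K.tensorMap (w' ▷ Y) a' := by
  rw [tensorMap_comp, ← hw, ← ha, MonoidalCategory.comp_whiskerRight]

/-- The coproduct `∐_{s ∈ G ^ m} (W × Δ[n]) ⊗ A`, indexed by the `m`-simplices `s` of the nerve
of `∗ // G`. -/
noncomputable abbrev barObj (W : (SingleObj G)ᵒᵖ ⥤ SSet.{u}) (A : SingleObj G ⥤ DGAlg O)
    (m : SimplexCategoryᵒᵖ) (n : SimplexCategory) : DGAlg O :=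
  ∐ fun s : (nerve (SingleObj G)).obj m =>
    K.tensor (W.obj (op (s.obj (Fin.last _))) ⊗ SSet.stdSimplex.obj n) (A.obj (s.obj 0))

/-- The inclusion of the summand with index `s`. -/
noncomputable abbrev barι (W : (SingleObj G)ᵒᵖ ⥤ SSet.{u}) (A : SingleObj G ⥤ DGAlg O)
    (m : SimplexCategoryᵒᵖ) (n : SimplexCategory) (s : (nerve (SingleObj G)).obj m) :
    K.tensor (W.obj (op (s.obj (Fin.last _))) ⊗ SSet.stdSimplex.obj n) (A.obj (s.obj 0)) ⟶
      K.barObj W A m n :=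
  Limits.Sigma.ι (fun s : (nerve (SingleObj G)).obj m =>
    K.tensor (W.obj (op (s.obj (Fin.last _))) ⊗ SSet.stdSimplex.obj n) (A.obj (s.obj 0))) s

/-- The bifunctor `(m, n) ↦ ∐_{s ∈ G ^ m} (W × Δ[n]) ⊗ A` given by the simplicial bar
construction `B_m(W, ∗ // G, A) = ∐_{s ∈ G ^ m} W ⊗ A` and the standard simplices. An `m`-simplex
`s` of the nerve of `∗ // G` is a string of `m` composable arrows; a simplicial operator `f` from
`[m']` to `[m]` acts through the arrow of `s` from `0` to `f 0` on `A`, and through the arrow of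
`s` from `f m'` to `m` on `W`. -/
noncomputable def bar (W : (SingleObj G)ᵒᵖ ⥤ SSet.{u}) (A : SingleObj G ⥤ DGAlg O) :
    SimplexCategoryᵒᵖ ⥤ SimplexCategory ⥤ DGAlg O where
  obj m :=
    { obj n := K.barObj W A m n
      map g := Limits.Sigma.desc fun s =>
        K.tensorMap (_ ◁ SSet.stdSimplex.map g) (𝟙 _) ≫ K.barι W A m _ s
      map_id n := by
        refine Limits.Sigma.hom_ext _ _ fun s => (Limits.Sigma.ι_desc _ _).trans ?_
        refine Eq.trans ?_ (Category.comp_id _).symm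
        refine Eq.trans ?_ (Category.id_comp _)
        refine congrArg (· ≫ K.barι W A m n s) (K.tensorMap_of_id ?_ rfl)
        exact (congrArg _ (SSet.stdSimplex.map_id n)).trans (MonoidalCategory.whiskerLeft_id _ _)
      map_comp g g' := by
        refine Limits.Sigma.hom_ext _ _ fun s => (Limits.Sigma.ι_desc _ _).trans ?_
        rw [Limits.Sigma.ι_desc_assoc, Category.assoc, Limits.Sigma.ι_desc, ← Category.assoc]
        exact congrArg (· ≫ K.barι W A m _ s) (K.tensorMap_whiskerLeft_comp _ _ g g') }
  map {m m'} f :=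
    { app n := Limits.Sigma.desc fun s =>
        K.tensorMap (W.map (s.map (homOfLE (Fin.le_last (f.unop.toOrderHom (Fin.last _))))).op ▷ _)
          (A.map (s.map (homOfLE (Fin.zero_le (f.unop.toOrderHom 0))))) ≫
        K.barι W A m' n ((nerve (SingleObj G)).map f s)
      naturality n n' g := by
        refine Limits.Sigma.hom_ext _ _ fun s => ?_
        rw [Limits.Sigma.ι_desc_assoc, Limits.Sigma.ι_desc_assoc, Category.assoc, Category.assoc,
          Limits.Sigma.ι_desc, Limits.Sigma.ι_desc, ← Category.assoc, ← Category.assoc]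
        exact congrArg (· ≫ K.barι W A m' n' _) (K.tensorMap_exchange _ _ _) }
  map_id m := by
    refine NatTrans.ext (funext fun n => Limits.Sigma.hom_ext _ _ fun s =>
      (Limits.Sigma.ι_desc _ _).trans ?_)
    refine Eq.trans ?_ (Category.comp_id _).symm
    refine Eq.trans ?_ (Category.id_comp _)
    refine congrArg (· ≫ K.barι W A m n s) (K.tensorMap_of_id ?_ ?_)
    · refine (congrArg (· ▷ _) ?_).trans (MonoidalCategory.id_whiskerRight _ _)
      exact (congrArg (fun g => W.map (Quiver.Hom.op g)) (s.map_id _)).trans (W.map_id _)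
    · exact (congrArg A.map (s.map_id _)).trans (A.map_id _)
  map_comp {m m' m''} f f' := by
    refine NatTrans.ext (funext fun n => Limits.Sigma.hom_ext _ _ fun s =>
      (Limits.Sigma.ι_desc _ _).trans ?_)
    rw [NatTrans.comp_app, Limits.Sigma.ι_desc_assoc, Category.assoc, Limits.Sigma.ι_desc,
      ← Category.assoc]
    refine congrArg (· ≫ K.barι W A m'' n _) (K.tensorMap_whiskerRight_comp ?_ ?_ _)
    · exact (W.map_comp _ _).symm.trans
        (congrArg (fun g => W.map (Quiver.Hom.op g)) (s.map_comp _ _).symm)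
    · exact (A.map_comp _ _).symm.trans (congrArg A.map (s.map_comp _ _).symm)

/-- The derived tensor product `W ⊗^L_G A`, computed from an equivariant cofibrant replacement
`Q` of `A`: the geometric realization `∫^n ∐_{s ∈ G ^ n} (W × Δ[n]) ⊗ Q` of the bar
construction. -/
noncomputable def derivedTensor (W : (SingleObj G)ᵒᵖ ⥤ SSet.{u}) (Q : SingleObj G ⥤ DGAlg O) :
    DGAlg O := coend (K.bar W Q)

/-- The equivariant higher Hochschild chains `∫_φ A = φ^* EG ⊗^L_G A`, computed from an
equivariant cofibrant replacement `Q` of `A`. -/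
noncomputable def equivariantChains {X : SSet.{u}} (φ : X ⟶ BG G) (Q : SingleObj G ⥤ DGAlg O) :
    DGAlg O := K.derivedTensor (bundle φ) Q

/-- The canonical map of the summand `(φ^* EG × Δ[n]) ⊗ Q` with index `s ∈ G ^ n` to
`∫_φ A`. -/
noncomputable def equivariantChainsι {X : SSet.{u}} (φ : X ⟶ BG G) (Q : SingleObj G ⥤ DGAlg O)
    {n : SimplexCategory} (s : (nerve (SingleObj G)).obj (op n)) :
    K.tensor (totalSpace φ ⊗ SSet.stdSimplex.obj n) (Q.obj (SingleObj.star G)) ⟶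
      K.equivariantChains φ Q :=
  K.barι (bundle φ) Q (op n) n s ≫ coend.ι (K.bar (bundle φ) Q) n

/-- The higher Hochschild chains `X ⊗^L A` (without a group action), computed from a cofibrant
replacement `Q` of `A`. -/
noncomputable def hochschildChains (X : SSet.{u}) (Q : DGAlg O) : DGAlg O := K.tensor X Q

/-- The product of all the arrows of a string `s` in `∗ // G`. -/
def total {n : SimplexCategory} (s : (nerve (SingleObj G)).obj (op n)) : G :=
  s.map (homOfLE (Fin.zero_le (Fin.last n.len)))

/-- `f : ∫_φ A ⟶ X ⊗^L A` is the augmentation induced by the action of `G` on the coefficients and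
the trivialization `τ : φ^* EG ≅ X × G`: on the summand with index `s`, restricted to the copy of
`X` in `φ^* EG` that corresponds to `X × {h}`, it is induced by the projection `X × Δ[n] ⟶ X` and
by the action on `Q` of the product of `h` and the arrows of `s`. -/
def IsAugmentation {X : SSet.{u}} {φ : X ⟶ BG G} (τ : Trivialization φ)
    {Q : SingleObj G ⥤ DGAlg O}
    (f : K.equivariantChains φ Q ⟶ K.hochschildChains X (Q.obj (SingleObj.star G))) : Prop :=
  ∀ (n : SimplexCategory) (s : (nerve (SingleObj G)).obj (op n)) (h : G),
    K.tensorMap (τ.sect h ▷ SSet.stdSimplex.obj n) (𝟙 (Q.obj (SingleObj.star G))) ≫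
      K.equivariantChainsι φ Q s ≫ f =
    K.tensorMap (CartesianMonoidalCategory.fst X (SSet.stdSimplex.obj n))
      (Q.map ((h * total s : G) : SingleObj.star G ⟶ SingleObj.star G))

end CochainAlgebras

end Chains

/-! ### Linear algebra of differential graded vector spaces -/

namespace DGVect

variable {k : Type u} [Field k]

/-! The proof has two halves: an isomorphism of algebras between `∫_φ A` and `(X × EG) ⊗ Q`, where
the group no longer acts, and the contractibility of `EG`.

Isomorphism. Through the trivialization, a cell of the bar construction is a simplex `x` of `X`, an
element `h` of `G`, a string `s = (g₁, …, gₙ)` and a simplex of `Δ[n]`. The pair `(h, s)` is the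
same as the tuple `yᵢ = h gₙ ⋯ gᵢ₊₁`, an `n`-simplex of `EG` with last vertex `h`; the arrows of `s`
are recovered as `yⱼ⁻¹ yᵢ`. The bar construction changes `h` by the arrows at the end of `s` and
acts on `Q` by the arrows at its beginning. In terms of `y` the first is just restriction of tuples,
and twisting `Q` by `y₀ = h gₙ ⋯ g₁` absorbs the second. Since a tensor is glued from its simplices
(`tensor_hom_ext`, `tensorDesc`), these formulas define mutually inverse maps `ofChains` and
`toChains`. Under this isomorphism the augmentation is induced by the projection `X × EG ⟶ X`.
Uniqueness holds because the sections `x ↦ (x, h)` cover the bundle.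

Contractibility. It remains to see that `(X × EG) ⊗ Q ⟶ X ⊗ Q` is a quasi-isomorphism, and it
suffices to treat its section induced by a vertex `e`. For every surjection `p : B ⟶ C` the map `B ^
(X × EG) ⟶ C ^ (X × EG) ×_{C ^ X} B ^ X` is a surjective quasi-isomorphism: its kernel consists of
cochains with values in `ker p` that vanish on `X × {e}`, and the explicit contraction of `EG` to
`e` contracts it (`pullbackCotensor_weakEquiv`). By adjunction and cofibrancy of `Q`, the section
lifts against all surjections. Factoring it as a quasi-isomorphism followed by a surjection
(`exists_factorization`, a mapping path space) and lifting exhibits it as a retract of a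
quasi-isomorphism.

Over the point every bundle is trivial and `Δ[0] ⊗ Q ≅ Q`, so the second claim follows by composing
with `q`. -/

lemma QuasiIso.comp {U V W : DGVect k} {f : U.carrier →ₗ[k] V.carrier}
    {g : V.carrier →ₗ[k] W.carrier} (hfd : ∀ x, f (U.d x) = V.d (f x))
    (hgd : ∀ x, g (V.d x) = W.d (g x)) (hf : QuasiIso f) (hg : QuasiIso g) :
    QuasiIso (V := U) (W := W) (g ∘ₗ f) := by
  refine ⟨fun x hx h => hf.1 x hx (hg.1 _ (by rw [← hfd, hx, map_zero]) h), fun w hw => ?_⟩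
  obtain ⟨v, z, hv, rfl⟩ := hg.2 w hw
  obtain ⟨x, y, hx, rfl⟩ := hf.2 v hv
  exact ⟨x, g y + z, hx, by simp [hgd, add_assoc]⟩

/-- A retraction of a quasi-isomorphism is a quasi-isomorphism. -/
lemma QuasiIso.of_section {U V : DGVect k} {i : U.carrier →ₗ[k] V.carrier}
    {p : V.carrier →ₗ[k] U.carrier} (hid : ∀ x, i (U.d x) = V.d (i x))
    (hpd : ∀ x, p (V.d x) = U.d (p x)) (hpi : ∀ x, p (i x) = x) (hi : QuasiIso i) :
    QuasiIso p := by
  refine ⟨fun v hv ⟨y, hy⟩ => ?_, fun u hu => ⟨i u, 0, by rw [← hid, hu, map_zero],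
    by simp [hpi]⟩⟩
  obtain ⟨x, z, hx, rfl⟩ := hi.2 v hv
  -- Applying `p` to `i x + d z` gives `x + d (p z) = d y`, so `x` is the boundary of `y - p z`.
  refine ⟨i (y - p z) + z, ?_⟩
  rw [map_add, hpi, hpd] at hy
  rw [map_add, ← hid, map_sub, ← hy, add_sub_cancel_right]

/-- A section of a quasi-isomorphism is a quasi-isomorphism. -/
lemma QuasiIso.of_retraction {U V : DGVect k} {i : U.carrier →ₗ[k] V.carrier}
    {p : V.carrier →ₗ[k] U.carrier} (hid : ∀ x, i (U.d x) = V.d (i x))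
    (hpd : ∀ x, p (V.d x) = U.d (p x)) (hpi : ∀ x, p (i x) = x) (hp : QuasiIso p) :
    QuasiIso i := by
  refine ⟨fun x _ ⟨y, hy⟩ => ⟨p y, by rw [← hpd, ← hy, hpi]⟩, fun v hv => ?_⟩
  have hpv : U.d (p v) = 0 := by rw [← hpd, hv, map_zero]
  obtain ⟨z, hz⟩ := hp.1 (v - i (p v)) (by rw [map_sub, hv, ← hid, hpv, map_zero, sub_zero])
    ⟨0, by rw [map_sub, hpi, sub_self, map_zero]⟩
  exact ⟨p v, z, hpv, by rw [← hz]; abel⟩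

/-- A map `i` is a quasi-isomorphism if some composite `l ∘ i` is one and `l` has a left
inverse. -/
lemma QuasiIso.of_retract {U V W : DGVect k} {i : U.carrier →ₗ[k] V.carrier}
    {l : V.carrier →ₗ[k] W.carrier} {p : W.carrier →ₗ[k] V.carrier}
    (hld : ∀ x, l (V.d x) = W.d (l x)) (hpd : ∀ x, p (W.d x) = V.d (p x))
    (hpl : ∀ x, p (l x) = x) (h : QuasiIso (V := U) (W := W) (l ∘ₗ i)) : QuasiIso i := by
  refine ⟨fun x hx ⟨y, hy⟩ => h.1 x hx ⟨l y, by rw [LinearMap.comp_apply, hy, hld]⟩,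
    fun v hv => ?_⟩
  obtain ⟨x, z, hx, hz⟩ := h.2 (l v) (by rw [← hld, hv, map_zero])
  refine ⟨x, p z, hx, ?_⟩
  rw [← hpl v, hz, map_add, LinearMap.comp_apply, hpl, hpd]

/-- A surjective chain map with acyclic kernel is a quasi-isomorphism. -/
lemma QuasiIso.of_surjective {V W : DGVect k} {f : V.carrier →ₗ[k] W.carrier}
    (hfd : ∀ x, f (V.d x) = W.d (f x)) (hf : Function.Surjective f)
    (hker : ∀ x, f x = 0 → V.d x = 0 → ∃ z, f z = 0 ∧ x = V.d z) : QuasiIso f := by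
  refine ⟨fun x hx ⟨y, hy⟩ => ?_, fun w hw => ?_⟩
  · obtain ⟨y, rfl⟩ := hf y
    obtain ⟨z, -, hz⟩ := hker (x - V.d y) (by rw [map_sub, hy, hfd, sub_self])
      (by rw [map_sub, hx, V.d_d, sub_self])
    exact ⟨z + y, by rw [map_add, ← hz, sub_add_cancel]⟩
  · obtain ⟨x, rfl⟩ := hf w
    obtain ⟨z, hz, hxz⟩ := hker (V.d x) (by rw [hfd, hw]) (V.d_d x)
    exact ⟨x - z, 0, by rw [map_sub, hxz, sub_self], by simp [hz]⟩

lemma bijective_coeLinearMap (V : DGVect k) :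
    Function.Bijective (DirectSum.coeLinearMap V.gr) := V.isInternal

/-- The projection to the homogeneous component of degree `n`. -/
noncomputable def component (V : DGVect k) (n : ℤ) : V.carrier →ₗ[k] V.carrier :=
  (V.gr n).subtype ∘ₗ DirectSum.component k ℤ (fun n => V.gr n) n ∘ₗ
    (LinearEquiv.ofBijective (DirectSum.coeLinearMap V.gr) V.bijective_coeLinearMap).symm.toLinearMap

lemma component_mem (V : DGVect k) (n : ℤ) (x : V.carrier) : V.component n x ∈ V.gr n :=
  Subtype.property _

lemma component_of_mem (V : DGVect k) {m n : ℤ} {x : V.carrier} (hx : x ∈ V.gr m) :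
    V.component n x = if m = n then x else 0 := by
  have : (LinearEquiv.ofBijective (DirectSum.coeLinearMap V.gr) V.bijective_coeLinearMap).symm x =
      DirectSum.lof k ℤ (fun n => V.gr n) m ⟨x, hx⟩ := by
    rw [LinearEquiv.symm_apply_eq]
    simp
  simp only [component, LinearMap.comp_apply, LinearEquiv.coe_coe, this]
  split_ifs with h
  · subst h
    simp [DirectSum.component.lof_self]
  · simp [DirectSum.component.of, h]

lemma component_self (V : DGVect k) {n : ℤ} {x : V.carrier} (hx : x ∈ V.gr n) :
    V.component n x = x := by simp [V.component_of_mem hx]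

lemma component_map {V W : DGVect k} {f : V.carrier →ₗ[k] W.carrier}
    (hf : ∀ {n x}, x ∈ V.gr n → f x ∈ W.gr n) (n : ℤ) (x : V.carrier) :
    f (V.component n x) = W.component n (f x) := by
  have : f ∘ₗ V.component n = W.component n ∘ₗ f := hom_ext fun m x hx => by
    simp only [LinearMap.comp_apply]
    rw [V.component_of_mem hx, W.component_of_mem (hf hx)]
    split_ifs <;> simp
  exact LinearMap.congr_fun this x

/-- All larger index sets are allowed so that two elements can be decomposed over a common finite
set, as the grading of a pullback requires. -/
lemma exists_sum_component (V : DGVect k) (x : V.carrier) :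
    ∃ S : Finset ℤ, ∀ T, S ⊆ T → ∑ n ∈ T, V.component n x = x := by
  have hx : x ∈ ⨆ n, V.gr n := by rw [V.iSup_gr]; trivial
  induction hx using Submodule.iSup_induction' with
  | mem m x hx =>
    refine ⟨{m}, fun T hT => ?_⟩
    rw [Finset.sum_congr rfl fun n _ => V.component_of_mem hx, Finset.sum_ite_eq,
      if_pos (hT (Finset.mem_singleton_self m))]
  | zero => exact ⟨∅, fun T _ => by simp⟩
  | add x y _ _ h1 h2 =>
    obtain ⟨S, hS⟩ := h1
    obtain ⟨S', hS'⟩ := h2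
    refine ⟨S ∪ S', fun T hT => ?_⟩
    simp only [map_add, Finset.sum_add_distrib]
    rw [hS T (Finset.union_subset_left hT), hS' T (Finset.union_subset_right hT)]

/-- Any lift may be replaced by its component of degree `n`, because `f` commutes with taking
components. -/
lemma exists_homogeneous_lift {V W : DGVect k} {f : V.carrier →ₗ[k] W.carrier}
    (hf : ∀ {n x}, x ∈ V.gr n → f x ∈ W.gr n) (hs : Function.Surjective f) {n : ℤ}
    {y : W.carrier} (hy : y ∈ W.gr n) : ∃ x ∈ V.gr n, f x = y := by
  obtain ⟨x, rfl⟩ := hs y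
  exact ⟨V.component n x, V.component_mem n x, by rw [component_map hf, component_self _ hy]⟩

lemma surjective_of_homogeneous {V W : DGVect k} {f : V.carrier →ₗ[k] W.carrier}
    (h : ∀ n, ∀ y ∈ W.gr n, ∃ x, f x = y) : Function.Surjective f := by
  rw [← LinearMap.range_eq_top, eq_top_iff, ← W.iSup_gr]
  exact iSup_le fun n y hy => h n y hy

end DGVect

/-! ### Constructing and evaluating normalized cochains -/

namespace DGVect

open Simplicial

variable {k : Type u} [Field k]

/-- Linear maps into a cochain complex, homogeneous of degree `s`, given by their values on the
simplices. -/
noncomputable def toCochains {V W : DGVect k} {X : SSet.{u}} (s : ℤ)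
    (F : ∀ q : ℕ, X _⦋q⦌ → V.carrier →ₗ[k] W.carrier)
    (hF : ∀ (q : ℕ) x n v, v ∈ V.gr n → F q x v ∈ W.gr (n + s + q))
    (hF' : ∀ q, ∀ x ∈ X.degenerate q, ∀ v, F q x v = 0) :
    V.carrier →ₗ[k] (W.cochains X).carrier :=
  (LinearMap.pi fun q => LinearMap.pi fun x => F q x).codRestrict _ (fun v => by
    have h : (⨆ n, V.gr n) ≤ (⨆ n, cochainGr X W n).comap
        (LinearMap.pi fun q => LinearMap.pi fun x => F q x) :=
      iSup_le fun n v hv => Submodule.mem_iSup_of_mem (n + s)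
        ⟨fun q x => hF q x n v hv, fun q x hx => hF' q x hx v⟩
    exact h (by rw [V.iSup_gr]; trivial))

@[simp] lemma cochainEval_toCochains {V W : DGVect k} {X : SSet.{u}} (s : ℤ)
    (F : ∀ q : ℕ, X _⦋q⦌ → V.carrier →ₗ[k] W.carrier) (hF hF') (v : V.carrier) {q : ℕ}
    (x : X _⦋q⦌) : cochainEval x (toCochains s F hF hF' v) = F q x v := rfl

/-- A homogeneous cochain given by its values. -/
noncomputable def mkCochain {W : DGVect k} {X : SSet.{u}} (n : ℤ)
    (F : ∀ q : ℕ, X _⦋q⦌ → W.carrier) (hF : F ∈ cochainGr X W n) : (W.cochains X).carrier :=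
  ⟨F, Submodule.mem_iSup_of_mem n hF⟩

/-- Vanishing on degenerate simplices is automatic for an element of the cochain complex, so only
the degrees of the values have to be checked. -/
lemma mem_cochains_gr {W : DGVect k} {X : SSet.{u}} {n : ℤ} {c : (W.cochains X).carrier} :
    c ∈ (W.cochains X).gr n ↔ ∀ q (x : X _⦋q⦌), cochainEval x c ∈ W.gr (n + q) :=
  ⟨fun h q x => h.1 q x, fun h => ⟨h, fun _ _ hx => cochainEval_degenerate hx c⟩⟩

@[simp] lemma cochainEval_cochainMap {X Y : SSet.{u}} (f : X ⟶ Y) {V W : DGVect k}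
    {g : V.carrier →ₗ[k] W.carrier} (hg : ∀ {n x}, x ∈ V.gr n → g x ∈ W.gr n)
    (c : (V.cochains Y).carrier) {q : ℕ} (x : X _⦋q⦌) :
    cochainEval x (cochainMap f g hg c) = g (cochainEval (f.app _ x) c) := rfl

lemma cochainEval_d_zero {X : SSet.{u}} {V : DGVect k} (c : (V.cochains X).carrier)
    (x : X _⦋0⦌) : cochainEval x ((V.cochains X).d c) = V.d (cochainEval x c) := rfl

lemma cochainEval_d_succ {X : SSet.{u}} {V : DGVect k} (c : (V.cochains X).carrier) {q : ℕ}
    (x : X _⦋q + 1⦌) : cochainEval x ((V.cochains X).d c) =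
      ∑ i : Fin (q + 2), (-1 : k) ^ (i : ℕ) • cochainEval (X.δ i x) c +
        (-1 : k) ^ (q + 1) • V.d (cochainEval x c) := rfl

/-! ### Simplicial homotopies acting on normalized cochains -/

section Homotopy

variable {X : SSet.{u}} {f g : X ⟶ X}

/-- The relations between `h` and the degeneracies rewrite `h i (σ j y)` as a degeneracy of some `h
i' y`. This is what lets the homotopy operator preserve normalized cochains. -/
lemma mem_degenerate_of_homotopy (H : SimplicialObject.Homotopy f g) {q : ℕ} {x : X _⦋q⦌}
    (hx : x ∈ X.degenerate q) (i : Fin (q + 1)) : H.h i x ∈ X.degenerate (q + 1) := by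
  cases q with
  | zero => simp at hx
  | succ q =>
    rw [SSet.degenerate_eq_iUnion_range_σ] at hx
    obtain ⟨j, hj⟩ := Set.mem_iUnion.1 hx
    obtain ⟨y, rfl⟩ := hj
    rcases lt_or_ge j.castSucc i with h | h
    · obtain ⟨i, rfl⟩ := Fin.eq_succ_of_ne_zero (Fin.ne_zero_of_lt h)
      have := ConcreteCategory.congr_hom (H.h_comp_σ_castSucc_of_le j i
        (by rwa [Fin.castSucc_lt_succ_iff] at h)) y
      erw [← this]
      exact X.σ_mem_degenerate _ _
    · obtain ⟨i, rfl⟩ := Fin.eq_castSucc_of_ne_last (x := i)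
        (fun e => by subst e; exact absurd (Fin.castSucc_lt_last j) (not_lt.2 h))
      have := ConcreteCategory.congr_hom (H.h_comp_σ_succ_of_lt j i
        (by simpa using h)) y
      erw [← this]
      exact X.σ_mem_degenerate _ _

/-- The operator on cochains induced by a simplicial homotopy. -/
noncomputable def cochainHomotopy (H : SimplicialObject.Homotopy f g) (V : DGVect k) :
    (V.cochains X).carrier →ₗ[k] (V.cochains X).carrier :=
  toCochains 1 (fun q x => ∑ i : Fin (q + 1), (-1 : k) ^ (i : ℕ) • cochainEval (H.h i x))
    (fun q x n v hv => by
      rw [LinearMap.sum_apply]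
      refine sum_mem fun i _ => Submodule.smul_mem _ _ ?_
      have := mem_cochains_gr.1 hv _ (H.h i x)
      rwa [show n + ((q + 1 : ℕ) : ℤ) = n + 1 + q by push_cast; ring] at this)
    (fun q x hx v => by
      rw [LinearMap.sum_apply]
      refine Finset.sum_eq_zero fun i _ => ?_
      rw [LinearMap.smul_apply, cochainEval_degenerate (mem_degenerate_of_homotopy H hx i),
        smul_zero])

lemma cochainEval_cochainHomotopy (H : SimplicialObject.Homotopy f g) (V : DGVect k)
    (c : (V.cochains X).carrier) {q : ℕ} (x : X _⦋q⦌) :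
    cochainEval x (cochainHomotopy H V c) =
      ∑ i : Fin (q + 1), (-1 : k) ^ (i : ℕ) • cochainEval (H.h i x) c := by
  simp [cochainHomotopy]

/-- Pure linear expansion of the right-hand side of a chain homotopy identity. The minus signs are
those of the chain homotopy associated with a simplicial homotopy, whose components are `-∑ (-1)ⁱ
hᵢ`. -/
lemma comp_sum_add_sum_comp_apply {M N N' V : Type*} [AddCommGroup M] [AddCommGroup N]
    [AddCommGroup N'] [AddCommGroup V] [Module k M] [Module k N] [Module k N'] [Module k V]
    {q r q' r' : ℕ} (h : Fin q → N →ₗ[k] M) (δ : Fin r → M →ₗ[k] N)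
    (h' : Fin q' → M →ₗ[k] N') (δ' : Fin r' → N' →ₗ[k] M) (φ : M →ₗ[k] M) (l : M →ₗ[k] V)
    (x : M) :
    l (((-∑ i : Fin q, (-1 : ℤ) ^ (i : ℕ) • h i) ∘ₗ (∑ j : Fin r, (-1 : ℤ) ^ (j : ℕ) • δ j) +
      (∑ j : Fin r', (-1 : ℤ) ^ (j : ℕ) • δ' j) ∘ₗ
        (-∑ i : Fin q', (-1 : ℤ) ^ (i : ℕ) • h' i) + φ) x) =
    -(∑ j : Fin r, (-1 : ℤ) ^ (j : ℕ) • ∑ i : Fin q, (-1 : ℤ) ^ (i : ℕ) • l (h i (δ j x)) +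
      ∑ i : Fin q', (-1 : ℤ) ^ (i : ℕ) • ∑ j : Fin r', (-1 : ℤ) ^ (j : ℕ) • l (δ' j (h' i x))) +
      l (φ x) := by
  simp only [LinearMap.add_apply, LinearMap.comp_apply, LinearMap.neg_apply, LinearMap.sum_apply,
    LinearMap.smul_apply, map_add, map_neg, map_sum, map_zsmul, neg_add, smul_neg,
    Finset.sum_neg_distrib, Finset.smul_sum]

/-- In dimension `0` the prism is a single edge, and its two faces are `x` and `f x`. -/
lemma sum_comp_homotopy_zero (H : SimplicialObject.Homotopy f (𝟙 X)) {V : DGVect k}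
    (c : X _⦋0⦌ → V.carrier) (x : X _⦋0⦌) :
    ∑ j : Fin 2, (-1 : k) ^ (j : ℕ) • c (X.δ j (H.h 0 x)) = c x - c (f.app _ x) := by
  have h0 := ConcreteCategory.congr_hom (H.h_zero_comp_δ_zero 0) x
  have h1 := ConcreteCategory.congr_hom (H.h_last_comp_δ_last 0) x
  rw [Fin.sum_univ_two]
  erw [h0, h1]
  simp [sub_eq_add_neg]

/-- This is the chain homotopy identity on the free simplicial module on `X`, evaluated at the basis
element `x` and followed by the linear extension of `c`. -/
lemma sum_comp_homotopy_succ (H : SimplicialObject.Homotopy f (𝟙 X)) {V : DGVect k} {q : ℕ}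
    (c : X _⦋q + 1⦌ → V.carrier) (x : X _⦋q + 1⦌) :
    ∑ j : Fin (q + 2), (-1 : k) ^ (j : ℕ) •
        ∑ i : Fin (q + 1), (-1 : k) ^ (i : ℕ) • c (H.h i (X.δ j x)) +
      ∑ i : Fin (q + 2), (-1 : k) ^ (i : ℕ) •
        ∑ j : Fin (q + 3), (-1 : k) ^ (j : ℕ) • c (X.δ j (H.h i x)) = c x - c (f.app _ x) := by
  let F := ModuleCat.free.{u} k
  have h := (SimplicialObject.Homotopy.whiskerRight H F).toChainHomotopy.comm (q + 1)
  rw [prevD_eq (j' := q + 2) (w := by simp), dNext_eq (i' := q) (w := by simp)] at h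
  let l : F.obj (X _⦋q + 1⦌) →ₗ[k] V.carrier := Finsupp.linearCombination k c
  have h' := congrArg l (ConcreteCategory.congr_hom h (ModuleCat.freeMk x))
  have el : ∀ y, l (ModuleCat.freeMk y) = c y := fun y =>
    (Finsupp.linearCombination_single k 1 y).trans (one_smul k _)
  have eh : ∀ {n : ℕ} (i : Fin (n + 1)) y, ModuleCat.Hom.hom ((H.whiskerRight F).h i)
      (ModuleCat.freeMk y) = ModuleCat.freeMk (H.h i y) := fun i y =>
    ModuleCat.free_map_apply (H.h i) y
  have eδ : ∀ {n : ℕ} (i : Fin (n + 2)) (y : X _⦋n + 1⦌), ModuleCat.Hom.hom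
      ((((SimplicialObject.whiskering (Type u) (ModuleCat k)).obj F).obj X).δ i)
      (ModuleCat.freeMk y) = ModuleCat.freeMk (X.δ i y) := fun i y =>
    ModuleCat.free_map_apply (X.δ i) y
  have ef : ∀ (f : X ⟶ X) y, ModuleCat.Hom.hom
      ((((SimplicialObject.whiskering (Type u) (ModuleCat k)).obj F).map f).app (op ⦋q + 1⦌))
      (ModuleCat.freeMk y) = ModuleCat.freeMk (f.app _ y) := fun f y =>
    ModuleCat.free_map_apply (f.app _) y
  -- The alternating face complex has integer signs, the cochain differential has signs in `k`.
  have es : ∀ (n : ℕ) (v : V.carrier), (-1 : k) ^ n • v = (-1 : ℤ) ^ n • v := fun n v => by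
    rcases Nat.even_or_odd n with hn | hn
    · rw [hn.neg_one_pow, hn.neg_one_pow, one_smul, one_smul]
    · rw [hn.neg_one_pow, hn.neg_one_pow, neg_one_smul, neg_one_smul]
  simp only [SimplicialObject.Homotopy.toChainHomotopy,
    SimplicialObject.Homotopy.ToChainHomotopy.hom_eq,
    AlgebraicTopology.alternatingFaceMapComplex_obj_d,
    AlgebraicTopology.alternatingFaceMapComplex_map_f,
    AlgebraicTopology.AlternatingFaceMapComplex.objD, ModuleCat.hom_sum, ModuleCat.hom_add,
    ModuleCat.hom_comp, ModuleCat.hom_neg, ModuleCat.hom_zsmul] at h'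
  have h₁ := (congrArg l (ef f x)).symm.trans
    (h'.trans (comp_sum_add_sum_comp_apply _ _ _ _ _ l (ModuleCat.freeMk x)))
  have e₁ : ∀ i j, l (ModuleCat.Hom.hom ((H.whiskerRight F).h i) (ModuleCat.Hom.hom
      ((((SimplicialObject.whiskering (Type u) (ModuleCat k)).obj F).obj X).δ j)
      (ModuleCat.freeMk x))) = c (H.h i (X.δ j x)) := fun i j =>
    (congrArg (fun y => l (ModuleCat.Hom.hom ((H.whiskerRight F).h i) y)) (eδ j x)).trans
      ((congrArg l (eh i _)).trans (el _))
  have e₂ : ∀ i j, l (ModuleCat.Hom.hom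
      ((((SimplicialObject.whiskering (Type u) (ModuleCat k)).obj F).obj X).δ j)
      (ModuleCat.Hom.hom ((H.whiskerRight F).h i)
      (ModuleCat.freeMk x))) = c (X.δ j (H.h i x)) := fun i j =>
    (congrArg (fun y => l (ModuleCat.Hom.hom
      ((((SimplicialObject.whiskering (Type u) (ModuleCat k)).obj F).obj X).δ j) y))
        (eh i x)).trans ((congrArg l (eδ j _)).trans (el _))
  have e₃ := (congrArg l (ef (𝟙 X) x)).trans (el _)
  simp only [es]
  have h₂ := (el _).symm.trans (h₁.trans (congrArg₂ (· + ·) (congrArg Neg.neg (congrArg₂ (· + ·)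
    (Finset.sum_congr rfl fun j _ => congrArg (HSMul.hSMul ((-1 : ℤ) ^ (j : ℕ)))
      (Finset.sum_congr rfl fun i _ => congrArg (HSMul.hSMul ((-1 : ℤ) ^ (i : ℕ))) (e₁ i j)))
    (Finset.sum_congr rfl fun i _ => congrArg (HSMul.hSMul ((-1 : ℤ) ^ (i : ℕ)))
      (Finset.sum_congr rfl fun j _ => congrArg (HSMul.hSMul ((-1 : ℤ) ^ (j : ℕ))) (e₂ i j)))))
    e₃))
  rw [h₂]
  simp

/-- A cocycle is homotopic to its restriction along a map that is homotopic to the identity. -/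
lemma d_cochainHomotopy (H : SimplicialObject.Homotopy f (𝟙 X)) {V : DGVect k}
    {c : (V.cochains X).carrier} (hc : (V.cochains X).d c = 0) :
    (V.cochains X).d (cochainHomotopy H V c) = c - cochainMap f LinearMap.id id c := by
  refine cochain_ext fun q x => ?_
  rw [map_sub, cochainEval_cochainMap, LinearMap.id_apply]
  -- The cocycle condition trades the differential of `V` on values for the simplicial coboundary;
  -- the internal part of `d (h c)` thus becomes the `δ ∘ h` half of the homotopy identity.
  have key : ∀ {q : ℕ} (y : X _⦋q + 1⦌), (-1 : k) ^ q • V.d (cochainEval y c) =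
      ∑ i : Fin (q + 2), (-1 : k) ^ (i : ℕ) • cochainEval (X.δ i y) c := fun {q} y => by
    have := cochainEval_d_succ c y
    rw [hc, map_zero, pow_succ, mul_neg_one, neg_smul, ← sub_eq_add_neg] at this
    exact (sub_eq_zero.1 this.symm).symm
  cases q with
  | zero =>
    rw [cochainEval_d_zero, cochainEval_cochainHomotopy]
    have e : ∀ F : Fin (0 + 1) → V.carrier, ∑ i : Fin (0 + 1), (-1 : k) ^ (i : ℕ) • F i = F 0 :=
      fun F => by simp
    have := key (H.h 0 x)
    rw [pow_zero, one_smul] at this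
    rw [e, this]
    exact sum_comp_homotopy_zero H (fun y => cochainEval y c) x
  | succ q =>
    rw [cochainEval_d_succ]
    simp only [cochainEval_cochainHomotopy]
    rw [← sum_comp_homotopy_succ H (fun y => cochainEval y c) x, map_sum, Finset.smul_sum]
    congr 1
    refine Finset.sum_congr rfl fun i _ => ?_
    rw [map_smul, smul_comm, key]

end Homotopy

end DGVect

/-! ### The product with a contractible simplicial set -/

/-- Together with `val_succAbove` this turns the simplicial identities of the contraction below into
linear arithmetic on vertices. -/
lemma val_predAbove {n : ℕ} (i : Fin n) (l : Fin (n + 1)) :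
    (i.predAbove l : ℕ) = if (i : ℕ) < l then (l : ℕ) - 1 else l := by
  simp only [Fin.predAbove, Fin.lt_def, Fin.val_castSucc]
  split_ifs <;> rfl

lemma val_succAbove {n : ℕ} (i : Fin (n + 1)) (l : Fin n) :
    (i.succAbove l : ℕ) = if (l : ℕ) < i then (l : ℕ) else l + 1 := by
  grind [Fin.succAbove]

section ProdEG

open Simplicial

variable (X : SSet.{u}) (S : Type u)

/-- The product `X × EG S`. -/
def prodEG : SSet.{u} where
  obj n := X.obj n × (Fin (n.unop.len + 1) → S)
  map f := ↾fun z => (X.map f z.1, z.2 ∘ f.unop.toOrderHom)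
  map_id n := types_hom_ext fun z => Prod.ext (congrArg (fun f => f z.1) (X.map_id n)) rfl
  map_comp f g := types_hom_ext fun z =>
    Prod.ext (congrArg (fun f => f z.1) (X.map_comp f g)) rfl

/-- The projection `X × EG S ⟶ X`. -/
def prodEGFst : prodEG X S ⟶ X where
  app _ := ↾fun z => z.1
  naturality _ _ _ := rfl

variable {S}

/-- The inclusion of `X` at the vertex `e` of `EG S`. -/
def prodEGIncl (e : S) : X ⟶ prodEG X S where
  app _ := ↾fun x => (x, fun _ => e)
  naturality _ _ _ := rfl

@[simp] lemma prodEGIncl_fst (e : S) : prodEGIncl X e ≫ prodEGFst X S = 𝟙 X := rfl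

variable {X} in
lemma prodEG_hom_ext {m n : SimplexCategoryᵒᵖ} {f g : (prodEG X S).obj m ⟶ (prodEG X S).obj n}
    (h₁ : ∀ (x : X.obj m) (y : Fin (m.unop.len + 1) → S),
      (f ((x, y) : X.obj m × _)).1 = (g ((x, y) : X.obj m × _)).1)
    (h₂ : ∀ (x : X.obj m) (y : Fin (m.unop.len + 1) → S) j,
      (f ((x, y) : X.obj m × _)).2 j = (g ((x, y) : X.obj m × _)).2 j) : f = g :=
  types_hom_ext fun z => Prod.ext (h₁ z.1 z.2) (funext fun j => h₂ z.1 z.2 j)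

/-- The contraction of `X × EG S` onto `X × {e}`. -/
def prodEGHomotopy (e : S) :
    SimplicialObject.Homotopy (prodEGFst X S ≫ prodEGIncl X e) (𝟙 (prodEG X S)) where
  -- On the tuple, `h i` is `(y₀, …, yₙ) ↦ (e, …, e, yᵢ, …, yₙ)` with `i + 1` copies of `e`; on `X`
  -- it is the constant homotopy. The identities in the `X`-coordinate are therefore those of
  -- `Homotopy.refl`.
  h {n} i := ↾fun z => (X.σ i z.1, fun j : Fin (n + 2) =>
    if j ≤ i.castSucc then e else z.2 (i.predAbove j))
  h_zero_comp_δ_zero n := prodEG_hom_ext (fun x _ => congrArg (fun f => f x)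
      ((SimplicialObject.Homotopy.refl (𝟙 X)).h_zero_comp_δ_zero n))
    (fun x y j => by
      change (if Fin.succAbove 0 j ≤ Fin.castSucc (0 : Fin (n + 1)) then e else
          y (Fin.predAbove (0 : Fin (n + 1)) (Fin.succAbove 0 j))) = y j
      simp)
  h_last_comp_δ_last n := prodEG_hom_ext (fun x _ => congrArg (fun f => f x)
      ((SimplicialObject.Homotopy.refl (𝟙 X)).h_last_comp_δ_last n))
    (fun x y j => by
      change (if Fin.succAbove (Fin.last _) j ≤ _ then e else _) = e
      rw [if_pos]
      simpa using Fin.le_last j)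
  h_succ_comp_δ_castSucc_of_lt {n} i j hij := prodEG_hom_ext (fun x _ =>
      congrArg (fun f => f x)
      ((SimplicialObject.Homotopy.refl (𝟙 X)).h_succ_comp_δ_castSucc_of_lt i j hij))
    (fun x y l => by
      change (if Fin.succAbove i.castSucc l ≤ j.succ.castSucc then e else
          y (Fin.predAbove j.succ (Fin.succAbove i.castSucc l))) =
        (if l ≤ j.castSucc then e else y (Fin.succAbove i (Fin.predAbove j l)))
      refine ite_congr (propext ?_) (fun _ => rfl) (fun h => congrArg y (Fin.ext ?_)) <;>
      simp only [Fin.le_def, val_predAbove, val_succAbove, Fin.val_castSucc,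
        Fin.val_succ, not_le] at * <;> split_ifs at * <;> omega)
  h_succ_comp_δ_castSucc_succ {n} j := prodEG_hom_ext (fun x _ => congrArg (fun f => f x)
      ((SimplicialObject.Homotopy.refl (𝟙 X)).h_succ_comp_δ_castSucc_succ j))
    (fun x y l => by
      change (if Fin.succAbove j.castSucc.succ l ≤ j.succ.castSucc then e else
          y (Fin.predAbove j.succ (Fin.succAbove j.castSucc.succ l))) =
        (if Fin.succAbove j.castSucc.succ l ≤ j.castSucc.castSucc then e else
          y (Fin.predAbove j.castSucc (Fin.succAbove j.castSucc.succ l)))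
      refine ite_congr (propext ?_) (fun _ => rfl) (fun h => congrArg y (Fin.ext ?_)) <;>
      simp only [Fin.le_def, val_predAbove, val_succAbove, Fin.val_castSucc,
        Fin.val_succ, not_le] at * <;> split_ifs at * <;> omega)
  h_castSucc_comp_δ_succ_of_lt {n} i j hji := prodEG_hom_ext (fun x _ =>
      congrArg (fun f => f x)
      ((SimplicialObject.Homotopy.refl (𝟙 X)).h_castSucc_comp_δ_succ_of_lt i j hji))
    (fun x y l => by
      change (if Fin.succAbove i.succ l ≤ j.castSucc.castSucc then e else
          y (Fin.predAbove j.castSucc (Fin.succAbove i.succ l))) =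
        (if l ≤ j.castSucc then e else y (Fin.succAbove i (Fin.predAbove j l)))
      refine ite_congr (propext ?_) (fun _ => rfl) (fun h => congrArg y (Fin.ext ?_)) <;>
      simp only [Fin.le_def, Fin.lt_def, val_predAbove, val_succAbove, Fin.val_castSucc,
        Fin.val_succ, not_le] at * <;> split_ifs at * <;> omega)
  h_comp_σ_castSucc_of_le {n} i j hij := prodEG_hom_ext (fun x _ => congrArg (fun f => f x)
      ((SimplicialObject.Homotopy.refl (𝟙 X)).h_comp_σ_castSucc_of_le i j hij))
    (fun x y l => by
      change (if Fin.predAbove i.castSucc l ≤ j.castSucc then e else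
          y (Fin.predAbove j (Fin.predAbove i.castSucc l))) =
        (if l ≤ j.succ.castSucc then e else y (Fin.predAbove i (Fin.predAbove j.succ l)))
      refine ite_congr (propext ?_) (fun _ => rfl) (fun h => congrArg y (Fin.ext ?_)) <;>
      simp only [Fin.le_def, val_predAbove, Fin.val_castSucc,
        Fin.val_succ, not_le] at * <;> split_ifs at * <;> omega)
  h_comp_σ_succ_of_lt {n} i j hji := prodEG_hom_ext (fun x _ => congrArg (fun f => f x)
      ((SimplicialObject.Homotopy.refl (𝟙 X)).h_comp_σ_succ_of_lt i j hji))
    (fun x y l => by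
      change (if Fin.predAbove i.succ l ≤ j.castSucc then e else
          y (Fin.predAbove j (Fin.predAbove i.succ l))) =
        (if l ≤ j.castSucc.castSucc then e else y (Fin.predAbove i (Fin.predAbove j.castSucc l)))
      refine ite_congr (propext ?_) (fun _ => rfl) (fun h => congrArg y (Fin.ext ?_)) <;>
      simp only [Fin.le_def, val_predAbove, Fin.val_castSucc,
        Fin.val_succ, not_le] at * <;> split_ifs at * <;> omega)

end ProdEG

/-! ### Pullbacks of algebras -/

namespace DGAlg

variable {k : Type u} [Field k] {O : DGOperad k} {A B C : DGAlg O} (f : A ⟶ C) (g : B ⟶ C)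

/-- The underlying vector space of the pullback. -/
abbrev pullbackCarrier : Submodule k (A.carrier × B.carrier) :=
  LinearMap.eqLocus (f.toFun ∘ₗ LinearMap.fst k _ _) (g.toFun ∘ₗ LinearMap.snd k _ _)

/-- The underlying differential graded vector space of the pullback. -/
def pullbackVect : DGVect k where
  carrier := pullbackCarrier f g
  gr n := ((A.gr n).prod (B.gr n)).comap (Submodule.subtype _)
  isInternal := by
    refine DirectSum.isInternal_submodule_of_iSupIndep_of_iSup_eq_top ?_ ?_
    · refine DGVect.iSupIndep_of_joint _
        (fun b : Bool => if b then A.toDGVect else B.toDGVect) (fun _ => 0)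
        (fun b => match b with
          | true => LinearMap.fst k _ _ ∘ₗ Submodule.subtype _
          | false => LinearMap.snd k _ _ ∘ₗ Submodule.subtype _) ?_ ?_
      · rintro (_ | _) n x hx
        · simpa using hx.2
        · simpa using hx.1
      · intro x hx
        exact Subtype.ext (Prod.ext (hx true) (hx false))
    · rw [eq_top_iff]
      rintro ⟨⟨a, b⟩, h⟩ -
      obtain ⟨S, hS⟩ := A.exists_sum_component a
      obtain ⟨T, hT⟩ := B.exists_sum_component b
      -- Both maps preserve degrees, so the components of a compatible pair are again compatible
      -- pairs; these generate the pullback.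
      have hab : ∀ n, (A.component n a, B.component n b) ∈ pullbackCarrier f g := fun n => by
        have h' : f.toFun a = g.toFun b := h
        change f.toFun (A.component n a) = g.toFun (B.component n b)
        rw [DGVect.component_map f.map_mem, DGVect.component_map g.map_mem, h']
      have e : (⟨(a, b), h⟩ : pullbackCarrier f g) = ∑ n ∈ S ∪ T, ⟨_, hab n⟩ := by
        refine Subtype.ext ?_
        rw [AddSubmonoidClass.coe_finsetSum]
        refine Prod.ext ?_ ?_
        · rw [Prod.fst_sum]
          exact (hS _ Finset.subset_union_left).symm
        · rw [Prod.snd_sum]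
          exact (hT _ Finset.subset_union_right).symm
      rw [e]
      exact Submodule.sum_mem _ fun n _ => Submodule.mem_iSup_of_mem n
        ⟨A.component_mem n a, B.component_mem n b⟩
  d := (A.d.prodMap B.d).restrict (fun x hx => by
    have h : f.toFun x.1 = g.toFun x.2 := hx
    change f.toFun (A.d x.1) = g.toFun (B.d x.2)
    rw [f.map_d, g.map_d, h])
  d_mem hx := ⟨A.d_mem hx.1, B.d_mem hx.2⟩
  d_d x := Subtype.ext (Prod.ext (A.d_d _) (B.d_d _))

/-- The first projection, as a linear map. -/
def pullbackFstLin : (pullbackVect f g).carrier →ₗ[k] A.carrier :=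
  LinearMap.fst k _ _ ∘ₗ Submodule.subtype _

/-- The second projection, as a linear map. -/
def pullbackSndLin : (pullbackVect f g).carrier →ₗ[k] B.carrier :=
  LinearMap.snd k _ _ ∘ₗ Submodule.subtype _

variable {f g} in
lemma pullback_ext {x y : (pullbackVect f g).carrier}
    (h₁ : pullbackFstLin f g x = pullbackFstLin f g y)
    (h₂ : pullbackSndLin f g x = pullbackSndLin f g y) : x = y :=
  Subtype.ext (Prod.ext h₁ h₂)

lemma pullback_condition_lin (x : (pullbackVect f g).carrier) :
    f.toFun (pullbackFstLin f g x) = g.toFun (pullbackSndLin f g x) := x.2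

/-- The operations on the pullback. -/
def pullbackAct (r : ℕ) : (O.O r).carrier →ₗ[k]
    MultilinearMap k (fun _ : Fin r => (pullbackVect f g).carrier) (pullbackVect f g).carrier where
  toFun e := MultilinearMap.codRestrict
    (((A.str.act r e).compLinearMap fun _ => pullbackFstLin f g).prod
      ((B.str.act r e).compLinearMap fun _ => pullbackSndLin f g)) _ (fun x => by
      change f.toFun (A.str.act r e _) = g.toFun (B.str.act r e _)
      rw [f.map_act, g.map_act]
      exact congrArg _ (funext fun i => pullback_condition_lin f g (x i)))
  map_add' e e' := by
    refine MultilinearMap.ext fun x => pullback_ext (f := f) (g := g) ?_ ?_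
    · exact congrArg (fun m => m fun i => pullbackFstLin f g (x i)) (map_add (A.str.act r) e e')
    · exact congrArg (fun m => m fun i => pullbackSndLin f g (x i)) (map_add (B.str.act r) e e')
  map_smul' c e := by
    refine MultilinearMap.ext fun x => pullback_ext (f := f) (g := g) ?_ ?_
    · exact congrArg (fun m => m fun i => pullbackFstLin f g (x i)) (map_smul (A.str.act r) c e)
    · exact congrArg (fun m => m fun i => pullbackSndLin f g (x i)) (map_smul (B.str.act r) c e)

end DGAlg

/-- An algebra structure on `V` whose operations are detected by jointly injective chain maps to
algebras. -/
def AlgStr.ofJointlyInjective {k : Type u} [Field k] {O : DGOperad k} {V : DGVect k} {ι : Type*}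
    (A : ι → DGAlg O) (f : ∀ i, V.carrier →ₗ[k] (A i).carrier)
    (inj : ∀ x y, (∀ i, f i x = f i y) → x = y)
    (mem : ∀ n x, x ∈ V.gr n ↔ ∀ i, f i x ∈ (A i).gr n)
    (hd : ∀ i x, f i (V.d x) = (A i).d (f i x))
    (act : ∀ r, (O.O r).carrier →ₗ[k] MultilinearMap k (fun _ : Fin r => V.carrier) V.carrier)
    (hact : ∀ i r e x, f i (act r e x) = (A i).str.act r e fun j => f i (x j)) : AlgStr O V where
  act := act
  act_mem he hx := (mem _ _).2 fun i => by
    rw [hact]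
    exact (A i).str.act_mem he fun j => (mem _ _).1 (hx j) i
  act_d := fun {r p q e x} he hx => inj _ _ fun a => by
    rw [hd, hact, (A a).str.act_d he (fun i => (mem _ _).1 (hx i) a), map_add, hact, map_sum]
    congr 1
    refine Finset.sum_congr rfl fun i _ => ?_
    rw [Units.smul_def, Units.smul_def, map_zsmul, hact]
    congr 2
    funext j
    by_cases hj : j = i
    · subst hj; simp [hd]
    · simp [hj]
  act_one x := inj _ _ fun a => by rw [hact, (A a).str.act_one]
  act_swap i j h e x hx := inj _ _ fun a => by
    rw [hact, (A a).str.act_swap i j h e (fun i => (mem _ _).1 (hx i) a), Units.smul_def,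
      Units.smul_def, map_zsmul, hact]
    rfl
  act_comp h i p q a b x hb hx := inj _ _ fun c => by
    rw [hact, (A c).str.act_comp h i a hb (fun i => (mem _ _).1 (hx i) c), Units.smul_def,
      Units.smul_def, map_zsmul, hact]
    congr 2
    funext j
    split_ifs
    · rw [hact]
    · rfl

namespace DGAlg

variable {k : Type u} [Field k] {O : DGOperad k} {A B C : DGAlg O} (f : A ⟶ C) (g : B ⟶ C)

/-- The pullback of two morphisms of algebras. -/
def pullback : DGAlg O where
  toDGVect := pullbackVect f g
  str := AlgStr.ofJointlyInjective (fun b : Bool => match b with | true => A | false => B)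
    (fun b => match b with | true => pullbackFstLin f g | false => pullbackSndLin f g)
    (fun _ _ h => pullback_ext (h true) (h false))
    (fun _ _ => ⟨fun h b => match b with | true => h.1 | false => h.2,
      fun h => ⟨h true, h false⟩⟩)
    (fun b _ => match b with | true => rfl | false => rfl)
    (pullbackAct f g)
    (fun b _ _ _ => match b with | true => rfl | false => rfl)

/-- The first projection. -/
def pullbackFst : pullback f g ⟶ A where
  toFun := pullbackFstLin f g
  map_mem hx := hx.1
  map_d _ := rfl
  map_act _ _ := rfl

/-- The second projection. -/
def pullbackSnd : pullback f g ⟶ B where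
  toFun := pullbackSndLin f g
  map_mem hx := hx.2
  map_d _ := rfl
  map_act _ _ := rfl

lemma pullback_condition : pullbackFst f g ≫ f = pullbackSnd f g ≫ g :=
  hom_ext fun x => pullback_condition_lin f g x

variable {f g} in
/-- The morphism to the pullback induced by a commutative square. -/
def pullbackLift {D : DGAlg O} (a : D ⟶ A) (b : D ⟶ B) (h : a ≫ f = b ≫ g) :
    D ⟶ pullback f g where
  toFun := (a.toFun.prod b.toFun).codRestrict _ fun x =>
    congrArg (fun φ => DGAlg.Hom.toFun φ x) h
  map_mem hx := ⟨a.map_mem hx, b.map_mem hx⟩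
  map_d x := pullback_ext (a.map_d x) (b.map_d x)
  map_act e x := pullback_ext (a.map_act e x) (b.map_act e x)

lemma pullbackLift_fst {D : DGAlg O} (a : D ⟶ A) (b : D ⟶ B) (h : a ≫ f = b ≫ g) :
    pullbackLift a b h ≫ pullbackFst f g = a := rfl

lemma pullbackLift_snd {D : DGAlg O} (a : D ⟶ A) (b : D ⟶ B) (h : a ≫ f = b ≫ g) :
    pullbackLift a b h ≫ pullbackSnd f g = b := rfl

variable {f g} in
lemma exists_pullback {a : A.carrier} {b : B.carrier} (h : f.toFun a = g.toFun b) :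
    ∃ x, (pullbackFst f g).toFun x = a ∧ (pullbackSnd f g).toFun x = b := ⟨⟨(a, b), h⟩, rfl, rfl⟩

end DGAlg

/-! ### The homotopy lifting property -/

namespace DGAlg

variable {k : Type u} [Field k] {O : DGOperad k}

lemma WeakEquiv.comp {A B C : DGAlg O} {f : A ⟶ B} {g : B ⟶ C} (hf : WeakEquiv f)
    (hg : WeakEquiv g) : WeakEquiv (f ≫ g) :=
  DGVect.QuasiIso.comp f.map_d g.map_d hf hg

lemma toFun_of_comp_eq_id {A B : DGAlg O} {i : A ⟶ B} {p : B ⟶ A} (h : i ≫ p = 𝟙 A)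
    (x : A.carrier) : p.toFun (i.toFun x) = x := congrArg (fun φ => Hom.toFun φ x) h

lemma WeakEquiv.of_section {A B : DGAlg O} {i : A ⟶ B} {p : B ⟶ A} (h : i ≫ p = 𝟙 A)
    (hi : WeakEquiv i) : WeakEquiv p :=
  DGVect.QuasiIso.of_section i.map_d p.map_d (toFun_of_comp_eq_id h) hi

lemma WeakEquiv.of_retraction {A B : DGAlg O} {i : A ⟶ B} {p : B ⟶ A} (h : i ≫ p = 𝟙 A)
    (hp : WeakEquiv p) : WeakEquiv i :=
  DGVect.QuasiIso.of_retraction i.map_d p.map_d (toFun_of_comp_eq_id h) hp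

lemma WeakEquiv.of_isIso {A B : DGAlg O} (f : A ⟶ B) [IsIso f] : WeakEquiv f := by
  have h : ∀ x, f.toFun ((inv f).toFun x) = x := toFun_of_comp_eq_id (IsIso.inv_hom_id f)
  have h' : ∀ x, (inv f).toFun (f.toFun x) = x := toFun_of_comp_eq_id (IsIso.hom_inv_id f)
  refine DGVect.QuasiIso.of_surjective f.map_d (fun x => ⟨_, h x⟩) fun x hx _ => ⟨0, map_zero _, ?_⟩
  rw [← h' x, hx, map_zero, map_zero]

end DGAlg

/-! ### Lifting against surjections for the inclusion of `X × {e}` -/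

namespace CochainAlgebras

open Simplicial DGAlg

variable {k : Type u} [Field k] {O : DGOperad k} (K : CochainAlgebras O)

/-- The comparison map `B ^ Y ⟶ C ^ Y ×_{C ^ X} B ^ X` for `f : X ⟶ Y` and `p : B ⟶ C`. -/
noncomputable def pullbackCotensor {X Y : SSet.{u}} (f : X ⟶ Y) {B C : DGAlg O} (p : B ⟶ C) :
    (K.cotensor Y).obj B ⟶ pullback ((K.restr f).app C) ((K.cotensor X).map p) :=
  pullbackLift ((K.cotensor Y).map p) ((K.restr f).app B) ((K.restr f).naturality p)

variable {B C : DGAlg O} {p : B ⟶ C} (hp : Function.Surjective p.toFun) (X : SSet.{u})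
  {S : Type u} (e : S)

include hp in
-- The inclusion of `X × {e}` is injective, so values there can be prescribed, while on the
-- remaining nondegenerate simplices any homogeneous lift along `p` will do.
lemma pullbackCotensor_surjective :
    Function.Surjective (K.pullbackCotensor (prodEGIncl X e) p).toFun := by
  classical
  refine DGVect.surjective_of_homogeneous fun n y hy => ?_
  set c : (C.toDGVect.cochains (prodEG X S)).carrier := (pullbackFst _ _).toFun y with hc
  set b : (B.toDGVect.cochains X).carrier := (pullbackSnd _ _).toFun y with hb
  have hcb : ∀ {q : ℕ} (x : X _⦋q⦌), DGVect.cochainEval ((prodEGIncl X e).app _ x) c =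
      p.toFun (DGVect.cochainEval x b) := fun x =>
    congrArg (fun φ => DGVect.cochainEval x (DGAlg.Hom.toFun φ y))
      (pullback_condition ((K.restr (prodEGIncl X e)).app C) ((K.cotensor X).map p))
  have hcn := DGVect.mem_cochains_gr.1 (show c ∈ _ from (pullbackFst _ _).map_mem hy)
  have hbn := DGVect.mem_cochains_gr.1 (show b ∈ _ from (pullbackSnd _ _).map_mem hy)
  choose l hl hl' using fun (q : ℕ) (z : prodEG X S _⦋q⦌) =>
    DGVect.exists_homogeneous_lift p.map_mem hp (hcn q z)
  -- Prescribed value on `X × {e}`, zero on the other degenerate simplices, a lift elsewhere.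
  -- Degenerate simplices of `X × {e}` fall under the first case, where `b` vanishes because their
  -- projection to `X` is degenerate.
  let F : ∀ q : ℕ, prodEG X S _⦋q⦌ → B.carrier := fun q z =>
    if z.2 = fun _ => e then DGVect.cochainEval z.1 b
    else if z ∈ (prodEG X S).degenerate q then 0 else l q z
  have hF : F ∈ DGVect.cochainGr (prodEG X S) B.toDGVect n := by
    refine ⟨fun q z => ?_, fun q z hz => ?_⟩
    · simp only [F]
      split_ifs
      · exact hbn _ _
      · exact zero_mem _
      · exact hl _ _
    · simp only [F, if_pos hz]
      split_ifs
      · exact DGVect.cochainEval_degenerate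
          (SSet.degenerate_le_preimage (prodEGFst X S) q hz) b
      · rfl
  refine ⟨DGVect.mkCochain n F hF, pullback_ext ?_ ?_⟩
  · refine DGVect.cochain_ext fun q z => ?_
    change p.toFun (F q z) = DGVect.cochainEval z c
    simp only [F]
    split_ifs with h1 h2
    · rw [← hcb]
      exact congrArg (fun z => DGVect.cochainEval z c) (Prod.ext rfl h1.symm)
    · rw [map_zero, DGVect.cochainEval_degenerate h2]
    · exact hl' q z
  · refine DGVect.cochain_ext fun q x => ?_
    change F q ((prodEGIncl X e).app _ x) = DGVect.cochainEval x b
    exact if_pos rfl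

/-- The contraction fixes the vertex `e`: on `X × {e}` its operators are the degeneracies of `X`.
Hence the homotopy operator preserves cochains that vanish on `X × {e}`. -/
lemma cochainEval_incl_cochainHomotopy {V : DGVect k} {c : (V.cochains (prodEG X S)).carrier}
    (hc : ∀ q (x : X _⦋q⦌), DGVect.cochainEval ((prodEGIncl X e).app _ x) c = 0) {q : ℕ}
    (x : X _⦋q⦌) : DGVect.cochainEval ((prodEGIncl X e).app _ x)
      (DGVect.cochainHomotopy (prodEGHomotopy X e) V c) = 0 := by
  rw [DGVect.cochainEval_cochainHomotopy]
  refine Finset.sum_eq_zero fun i _ => ?_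
  have : (prodEGHomotopy X e).h i ((prodEGIncl X e).app _ x) =
      (prodEGIncl X e).app _ (X.σ i x) := Prod.ext rfl (funext fun j => ite_self e)
  rw [this, hc, smul_zero]

/-- The end of the contraction factors through `X × {e}`, where `c` vanishes, so the correction term
of the homotopy formula is zero: relative cocycles are explicit coboundaries. -/
lemma d_cochainHomotopy_prodEG {V : DGVect k} {c : (V.cochains (prodEG X S)).carrier}
    (hc : ∀ q (x : X _⦋q⦌), DGVect.cochainEval ((prodEGIncl X e).app _ x) c = 0)
    (hd : (V.cochains _).d c = 0) :
    (V.cochains _).d (DGVect.cochainHomotopy (prodEGHomotopy X e) V c) = c := by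
  rw [DGVect.d_cochainHomotopy _ hd]
  exact sub_eq_self.2 (DGVect.cochain_ext fun q z => hc q z.1)

include hp in
-- An element of the kernel has values in `ker p` and vanishes on `X × {e}`. The homotopy operator
-- respects both conditions, so the kernel is acyclic.
lemma pullbackCotensor_weakEquiv :
    WeakEquiv (K.pullbackCotensor (prodEGIncl X e) p) := by
  refine DGVect.QuasiIso.of_surjective (Hom.map_d _) (K.pullbackCotensor_surjective hp X e)
    fun (c : (B.toDGVect.cochains (prodEG X S)).carrier) hc hdc => ?_
  have h1 : ∀ {q : ℕ} (z : prodEG X S _⦋q⦌), p.toFun (DGVect.cochainEval z c) = 0 := fun z =>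
    congrArg (fun y => DGVect.cochainEval z ((pullbackFst _ _).toFun y)) hc
  have h2 : ∀ q (x : X _⦋q⦌), DGVect.cochainEval ((prodEGIncl X e).app _ x) c = 0 := fun _ x =>
    congrArg (fun y => DGVect.cochainEval x ((pullbackSnd _ _).toFun y)) hc
  refine ⟨DGVect.cochainHomotopy (prodEGHomotopy X e) B.toDGVect c, pullback_ext ?_ ?_,
    (d_cochainHomotopy_prodEG X e h2 hdc).symm⟩
  · refine DGVect.cochain_ext fun q z => ?_
    change p.toFun (DGVect.cochainEval z
      (DGVect.cochainHomotopy (prodEGHomotopy X e) B.toDGVect c)) = 0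
    rw [DGVect.cochainEval_cochainHomotopy, map_sum]
    exact Finset.sum_eq_zero fun i _ => by rw [map_smul, h1, smul_zero]
  · exact DGVect.cochain_ext fun q x => cochainEval_incl_cochainHomotopy X e h2 x

include hp in
/-- The map `X ⊗ Q ⟶ (X × EG S) ⊗ Q` has the left lifting property with respect to surjections,
if `Q` is cofibrant. -/
lemma exists_lift_tensor_prodEGIncl {Q : DGAlg O} (hQ : Q.IsCofibrant)
    (b : K.tensor X Q ⟶ B) (c : K.tensor (prodEG X S) Q ⟶ C)
    (h : b ≫ p = K.tensorMap (prodEGIncl X e) (𝟙 Q) ≫ c) :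
    ∃ l : K.tensor (prodEG X S) Q ⟶ B,
      K.tensorMap (prodEGIncl X e) (𝟙 Q) ≫ l = b ∧ l ≫ p = c := by
  have h' : K.tensorHomEquiv _ _ _ c ≫ (K.restr (prodEGIncl X e)).app C =
      K.tensorHomEquiv _ _ _ b ≫ (K.cotensor X).map p := by
    rw [← tensorHomEquiv_naturality, h, tensorHomEquiv_tensorMap, Category.id_comp]
  -- The transposed problem asks to lift a map out of `Q` along a surjective quasi-isomorphism,
  -- which cofibrancy allows.
  obtain ⟨l, hl⟩ := hQ _ _ (K.pullbackCotensor (prodEGIncl X e) p) (pullbackLift _ _ h')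
    (K.pullbackCotensor_surjective hp X e) (K.pullbackCotensor_weakEquiv hp X e)
  refine ⟨(K.tensorHomEquiv _ _ _).symm l, ?_, ?_⟩
  · apply (K.tensorHomEquiv _ _ _).injective
    rw [tensorHomEquiv_tensorMap, Equiv.apply_symm_apply, Category.id_comp]
    exact congrArg (· ≫ pullbackSnd _ _) hl
  · apply (K.tensorHomEquiv _ _ _).injective
    rw [tensorHomEquiv_naturality, Equiv.apply_symm_apply]
    exact congrArg (· ≫ pullbackFst _ _) hl

end CochainAlgebras

/-! ### Bijective morphisms of algebras -/

namespace DGAlg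

variable {k : Type u} [Field k] {O : DGOperad k}

lemma isIso_of_bijective {A B : DGAlg O} (f : A ⟶ B) (hf : Function.Bijective f.toFun) :
    IsIso f := by
  let l := LinearEquiv.ofBijective f.toFun hf
  have hl : ∀ x, f.toFun (l.symm x) = x := l.apply_symm_apply
  refine ⟨⟨l.symm.toLinearMap, fun {n x} hx => ?_, fun x => hf.1 ?_, fun e x => hf.1 ?_⟩,
    hom_ext fun x => l.symm_apply_apply x, hom_ext hl⟩
  -- The inverse preserves degrees: by injectivity, a preimage of a homogeneous element equals its
  -- own component.
  · have : A.component n (l.symm x) = l.symm x := hf.1 (by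
      rw [DGVect.component_map f.map_mem, hl, DGVect.component_self _ hx])
    rw [LinearEquiv.coe_coe, ← this]
    exact A.component_mem n _
  · rw [f.map_d, LinearEquiv.coe_coe, hl, hl]
  · rw [f.map_act, LinearEquiv.coe_coe, hl]
    exact congrArg _ (funext fun i => (hl _).symm)

end DGAlg

/-! ### Path algebras, factorizations and the weak equivalence `X ⊗ Q ⟶ (X × EG S) ⊗ Q` -/

namespace CochainAlgebras

open Simplicial DGAlg

variable {k : Type u} [Field k] {O : DGOperad k} (K : CochainAlgebras O)

/-- The vertex of the point. -/
def pointVertex : (Δ[0] : SSet.{u}) _⦋0⦌ := SSet.stdSimplex.objEquiv.symm (𝟙 _)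

lemma eq_pointVertex (x : (Δ[0] : SSet.{u}) _⦋0⦌) : x = pointVertex :=
  SSet.stdSimplex.objEquiv.injective (Subsingleton.elim _ _)

lemma degenerate_point {q : ℕ} (x : (Δ[0] : SSet.{u}) _⦋q + 1⦌) :
    x ∈ (Δ[0] : SSet.{u}).degenerate (q + 1) := by
  have : x = (Δ[0] : SSet.{u}).σ 0 ((Δ[0] : SSet.{u}).δ 0 x) :=
    SSet.stdSimplex.objEquiv.injective (Subsingleton.elim _ _)
  rw [this]
  exact SSet.σ_mem_degenerate _ _ _

/-- Evaluation at the vertex of the point. -/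
noncomputable def evalPoint (B : DGAlg O) : (K.cotensor Δ[0]).obj B ⟶ B where
  toFun := DGVect.cochainEval pointVertex
  map_mem hx := by
    have h := DGVect.mem_cochains_gr.1 hx 0 pointVertex
    rwa [Nat.cast_zero, add_zero] at h
  map_d c := DGVect.cochainEval_d_zero c pointVertex
  -- This is where the normalization of the cochain algebra structure at the point enters.
  map_act e c := K.point B pointVertex e c

/-- All simplices of the point of positive dimension are degenerate, so a normalized cochain is just
its value at the vertex. -/
instance (B : DGAlg O) : IsIso (K.evalPoint B) := by
  refine isIso_of_bijective _ ⟨fun c c' h => DGVect.cochain_ext fun q x => ?_,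
    DGVect.surjective_of_homogeneous fun n b hb => ?_⟩
  · cases q with
    | zero => rw [eq_pointVertex x]; exact h
    | succ q =>
      exact (DGVect.cochainEval_degenerate (degenerate_point x) c).trans
        (DGVect.cochainEval_degenerate (degenerate_point x) c').symm
  · refine ⟨DGVect.mkCochain n (fun q _ => if q = 0 then b else 0)
      ⟨fun q x => ?_, fun q x hx => ?_⟩, ?_⟩
    · dsimp only
      split_ifs with h
      · subst h; simpa using hb
      · exact zero_mem _
    · dsimp only
      rw [if_neg]
      rintro rfl
      simp at hx
    · change (if (0 : ℕ) = 0 then b else 0) = b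
      exact if_pos rfl

/-- Evaluation of paths, modelled on the contractible simplicial set `EG S`, at a vertex. -/
noncomputable def evalPath (S : Type u) (B : DGAlg O) (e : S) :
    (K.cotensor (prodEG Δ[0] S)).obj B ⟶ B :=
  (K.restr (prodEGIncl Δ[0] e)).app B ≫ K.evalPoint B

/-- Constant paths. -/
noncomputable def constPath (S : Type u) (B : DGAlg O) :
    B ⟶ (K.cotensor (prodEG Δ[0] S)).obj B :=
  inv (K.evalPoint B) ≫ (K.restr (prodEGFst Δ[0] S)).app B

lemma constPath_evalPath (S : Type u) (B : DGAlg O) (e : S) :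
    K.constPath S B ≫ K.evalPath S B e = 𝟙 B := by
  have : (K.restr (prodEGFst Δ[0] S)).app B ≫ (K.restr (prodEGIncl Δ[0] e)).app B = 𝟙 _ := rfl
  rw [constPath, evalPath, Category.assoc, reassoc_of% this, IsIso.inv_hom_id]

/-- Take the cochain supported on the vertex `e'` with value `b` there. It need not be a cocycle,
since only surjectivity of the evaluation at `e'` is at stake. -/
lemma exists_path {S : Type u} {B : DGAlg O} {e e' : S} (he : e ≠ e') {n : ℤ} {b : B.carrier}
    (hb : b ∈ B.gr n) : ∃ c, (K.evalPath S B e).toFun c = 0 ∧ (K.evalPath S B e').toFun c = b := by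
  classical
  refine ⟨DGVect.mkCochain n (fun q z => if q = 0 ∧ z.2 0 = e' then b else 0)
      ⟨fun q z => ?_, fun q z hz => ?_⟩, ?_, ?_⟩
  · dsimp only
    split_ifs with h
    · obtain ⟨rfl, -⟩ := h; simpa using hb
    · exact zero_mem _
  · dsimp only
    rw [if_neg]
    rintro ⟨rfl, -⟩
    simp at hz
  · exact if_neg fun h => he h.2
  · exact if_pos ⟨rfl, rfl⟩

include K in
/-- A morphism of algebras factors as a section of a weak equivalence followed by a surjection. -/
lemma exists_factorization {U V : DGAlg O} (i : U ⟶ V) : ∃ (W : DGAlg O) (j : U ⟶ W) (p : W ⟶ V),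
    j ≫ p = i ∧ WeakEquiv j ∧ Function.Surjective p.toFun := by
  -- `EG` of a two-element set plays the role of the interval; `e` and `e'` are its endpoints.
  let S := ULift.{u} Bool
  let e : S := ⟨false⟩
  let e' : S := ⟨true⟩
  have he : e ≠ e' := fun h => Bool.false_ne_true (congrArg ULift.down h)
  have hj : 𝟙 U ≫ i = (i ≫ K.constPath S V) ≫ K.evalPath S V e := by
    rw [Category.assoc, constPath_evalPath, Category.comp_id, Category.id_comp]
  -- The mapping path space: pairs of `u` and a path starting at `i u`. The map `j` adds the
  -- constant path, and `p` takes the end point.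
  refine ⟨pullback i (K.evalPath S V e), pullbackLift _ _ hj,
    pullbackSnd _ _ ≫ K.evalPath S V e', ?_, ?_, ?_⟩
  · rw [← Category.assoc, pullbackLift_snd, Category.assoc, constPath_evalPath, Category.comp_id]
  -- `j` is a section of the projection to `U`, whose kernel consists of paths that vanish at `e`;
  -- the contraction of `EG S` to `e` makes it acyclic.
  · refine WeakEquiv.of_retraction (pullbackLift_fst _ _ _ _ hj) ?_
    refine DGVect.QuasiIso.of_surjective (Hom.map_d _)
      (fun x => ⟨_, toFun_of_comp_eq_id (pullbackLift_fst _ _ _ _ hj) x⟩) fun x hx hdx => ?_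
    set c : (V.toDGVect.cochains (prodEG Δ[0] S)).carrier := (pullbackSnd _ _).toFun x with hc
    have h0 : (K.evalPath S V e).toFun c = 0 := by
      have := congrArg (fun φ => Hom.toFun φ x) (pullback_condition i (K.evalPath S V e))
      exact this.symm.trans ((congrArg i.toFun hx).trans (map_zero _))
    have hinj : Function.Injective (K.evalPoint V).toFun := fun y y' h => by
      rw [← toFun_of_comp_eq_id (IsIso.hom_inv_id (K.evalPoint V)) y, h,
        toFun_of_comp_eq_id (IsIso.hom_inv_id (K.evalPoint V)) y']
    have h1 : ((K.restr (prodEGIncl Δ[0] e)).app V).toFun c = 0 :=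
      hinj (h0.trans (map_zero _).symm)
    have h2 : ∀ q (x : Δ[0] _⦋q⦌), DGVect.cochainEval ((prodEGIncl Δ[0] e).app _ x) c = 0 :=
      fun q x => congrArg (DGVect.cochainEval x) h1
    have hdc : (V.toDGVect.cochains (prodEG Δ[0] S)).d c = 0 :=
      ((pullbackSnd i (K.evalPath S V e)).map_d x).symm.trans
        ((congrArg _ hdx).trans (map_zero _))
    let h := DGVect.cochainHomotopy (prodEGHomotopy Δ[0] e) V.toDGVect c
    obtain ⟨z, hz, hz'⟩ := exists_pullback (f := i) (g := K.evalPath S V e) (a := 0) (b := h)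
      ((map_zero _).trans (cochainEval_incl_cochainHomotopy Δ[0] e h2 pointVertex).symm)
    refine ⟨z, hz, pullback_ext ?_ ?_⟩
    · refine hx.trans ((map_zero U.d).symm.trans ((congrArg U.d hz.symm).trans ?_))
      exact ((pullbackFst i (K.evalPath S V e)).map_d z).symm
    · refine (d_cochainHomotopy_prodEG Δ[0] e h2 hdc).symm.trans ?_
      refine (congrArg _ hz'.symm).trans ?_
      exact ((pullbackSnd i (K.evalPath S V e)).map_d z).symm
  · refine DGVect.surjective_of_homogeneous fun n v hv => ?_
    obtain ⟨c, hc, hc'⟩ := K.exists_path he hv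
    -- A path from `0` to `v`, paired with `0` in `U`, maps to `v`.
    obtain ⟨x, -, hx⟩ := exists_pullback (f := i) (g := K.evalPath S V e) (a := 0) (b := c)
      ((map_zero _).trans hc.symm)
    exact ⟨x, (congrArg _ hx).trans hc'⟩

/-- The inclusion `X ⊗ Q ⟶ (X × EG S) ⊗ Q` is a weak equivalence if `Q` is cofibrant. -/
lemma weakEquiv_tensorMap_prodEGIncl (X : SSet.{u}) {S : Type u} (e : S) {Q : DGAlg O}
    (hQ : Q.IsCofibrant) : WeakEquiv (K.tensorMap (prodEGIncl X e) (𝟙 Q)) := by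
  obtain ⟨W, j, p, hjp, hj, hp⟩ := K.exists_factorization (K.tensorMap (prodEGIncl X e) (𝟙 Q))
  -- Retract argument: lifting the identity along `p` gives `l` with left inverse `p`, and the
  -- inclusion followed by `l` is the weak equivalence `j`.
  obtain ⟨l, hl, hlp⟩ := K.exists_lift_tensor_prodEGIncl hp X e hQ j (𝟙 _)
    (by rw [hjp, Category.comp_id])
  refine DGVect.QuasiIso.of_retract l.map_d p.map_d (toFun_of_comp_eq_id hlp) ?_
  rw [← hl] at hj
  exact hj

/-- The projection `(X × EG S) ⊗ Q ⟶ X ⊗ Q` is a weak equivalence if `Q` is cofibrant. -/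
lemma weakEquiv_tensorMap_prodEGFst (X : SSet.{u}) (S : Type u) [Nonempty S] {Q : DGAlg O}
    (hQ : Q.IsCofibrant) : WeakEquiv (K.tensorMap (prodEGFst X S) (𝟙 Q)) := by
  obtain ⟨e⟩ := ‹Nonempty S›
  refine WeakEquiv.of_section ?_ (K.weakEquiv_tensorMap_prodEGIncl X e hQ)
  rw [tensorMap_comp]
  exact K.tensorMap_of_id (prodEGIncl_fst X e) (Category.comp_id _)

end CochainAlgebras

/-! ### Tensors as colimits over simplices -/

namespace CochainAlgebras

open Simplicial DGAlg

variable {k : Type u} [Field k] {O : DGOperad k} (K : CochainAlgebras O)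

/-- The map `Δ[n] ⊗ Q ⟶ Z ⊗ Q'` given by a simplex of `Z` and a map of algebras. -/
noncomputable def cell {Z : SSet.{u}} {n : SimplexCategory} (z : Z.obj (op n)) {Q Q' : DGAlg O}
    (a : Q ⟶ Q') : K.tensor (SSet.stdSimplex.obj n) Q ⟶ K.tensor Z Q' :=
  K.tensorMap (SSet.yonedaEquiv.symm z) a

lemma cell_comp_tensorMap {Z Z' : SSet.{u}} {n : SimplexCategory} (z : Z.obj (op n))
    (f : Z ⟶ Z') {Q Q' Q'' : DGAlg O} (a : Q ⟶ Q') (b : Q' ⟶ Q'') :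
    K.cell z a ≫ K.tensorMap f b = K.cell (f.app _ z) (a ≫ b) := by
  rw [cell, tensorMap_comp, SSet.yonedaEquiv_symm_comp, cell]

lemma stdSimplex_map_comp_yonedaEquiv_symm {Z : SSet.{u}} {m n : SimplexCategory} (θ : m ⟶ n)
    (z : Z.obj (op n)) : SSet.stdSimplex.map θ ≫ SSet.yonedaEquiv.symm z =
      SSet.yonedaEquiv.symm (Z.map θ.op z) := by
  apply SSet.yonedaEquiv.injective
  rw [Equiv.apply_symm_apply, SSet.yonedaEquiv_comp, SSet.yonedaEquiv_map]
  rfl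

lemma tensorMap_comp_cell {Z : SSet.{u}} {m n : SimplexCategory} (θ : m ⟶ n)
    (z : Z.obj (op n)) {Q Q' Q'' : DGAlg O} (a : Q ⟶ Q') (b : Q' ⟶ Q'') :
    K.tensorMap (SSet.stdSimplex.map θ) a ≫ K.cell z b = K.cell (Z.map θ.op z) (a ≫ b) := by
  rw [cell, tensorMap_comp, stdSimplex_map_comp_yonedaEquiv_symm, cell]

/-- Cells are jointly epimorphic: the value of an adjoint map at a simplex `z` is the value at the
top simplex of `Δ[q]` of its restriction along `z`. -/
lemma tensor_hom_ext {Z : SSet.{u}} {Q B : DGAlg O} {f g : K.tensor Z Q ⟶ B}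
    (h : ∀ (n : SimplexCategory) (z : Z.obj (op n)), K.cell z (𝟙 Q) ≫ f = K.cell z (𝟙 Q) ≫ g) :
    f = g := by
  apply (K.tensorHomEquiv Z Q B).injective
  refine DGAlg.hom_ext fun x => DGVect.cochain_ext fun q z => ?_
  have h' := congrArg (K.tensorHomEquiv _ _ _) (h _ z)
  rw [cell, tensorHomEquiv_tensorMap, tensorHomEquiv_tensorMap] at h'
  have := congrArg (fun φ => DGVect.cochainEval (SSet.yonedaEquiv (𝟙 _)) (Hom.toFun φ x)) h'
  have e : (SSet.yonedaEquiv.symm z).app _ (SSet.yonedaEquiv (𝟙 Δ[q])) = z :=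
    SSet.yonedaEquiv_symm_app_id z
  refine Eq.trans ?_ (this.trans ?_)
  · exact congrArg (fun y => DGVect.cochainEval y ((K.tensorHomEquiv Z Q B f).toFun x)) e.symm
  · exact congrArg (fun y => DGVect.cochainEval y ((K.tensorHomEquiv Z Q B g).toFun x)) e

/-! ### Gluing morphisms along the simplices of `Z` -/

section Desc

variable {Z : SSet.{u}} {Q B : DGAlg O}
  (F : ∀ (n : SimplexCategory), Z.obj (op n) → (Q ⟶ (K.cotensor (SSet.stdSimplex.obj n)).obj B))
  (hF : ∀ (m n : SimplexCategory) (θ : m ⟶ n) (z : Z.obj (op n)),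
    F n z ≫ (K.restr (SSet.stdSimplex.map θ)).app B = F m (Z.map θ.op z))

include hF in
-- Compatibility means that the whole family is determined by its values at top simplices. The glued
-- map is built from exactly these values.
lemma cochainEval_of_compatible {n : SimplexCategory} (z : Z.obj (op n)) {q : ℕ} (θ : ⦋q⦌ ⟶ n)
    (x : Q.carrier) : DGVect.cochainEval (SSet.stdSimplex.objEquiv.symm θ) ((F n z).toFun x) =
      DGVect.cochainEval (SSet.yonedaEquiv (𝟙 Δ[q])) ((F ⦋q⦌ (Z.map θ.op z)).toFun x) := by
  rw [← hF]
  have e : (SSet.stdSimplex.map θ).app _ (SSet.yonedaEquiv (𝟙 Δ[q])) =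
      SSet.stdSimplex.objEquiv.symm θ := by
    rw [← SSet.yonedaEquiv_comp, Category.id_comp, SSet.yonedaEquiv_map]
  exact congrArg (fun y => DGVect.cochainEval y ((F n z).toFun x)) e.symm

/-- The linear map to the cochains on `Z` glued from linear maps to the cochains on the simplices
of `Z`. -/
noncomputable def glueLin : Q.carrier →ₗ[k] (B.toDGVect.cochains Z).carrier :=
  DGVect.toCochains 0
    (fun q z => DGVect.cochainEval (SSet.yonedaEquiv (𝟙 Δ[q])) ∘ₗ (F ⦋q⦌ z).toFun)
    (fun q z n x hx => by
      rw [add_zero]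
      exact DGVect.mem_cochains_gr.1 ((F ⦋q⦌ z).map_mem hx) _ _)
    (fun q z hz x => by
      cases q with
      | zero => simp at hz
      | succ q =>
        rw [SSet.degenerate_eq_iUnion_range_σ] at hz
        obtain ⟨s, hs⟩ := Set.mem_iUnion.1 hz
        obtain ⟨y, rfl⟩ := hs
        -- The value at `σ s y` is the value of the normalized cochain attached to `y` on a
        -- degenerate simplex of the standard simplex.
        refine (K.cochainEval_of_compatible F hF y (SimplexCategory.σ s) x).symm.trans ?_
        refine DGVect.cochainEval_degenerate ?_ _
        exact SSet.σ_mem_degenerate _ s (SSet.yonedaEquiv (𝟙 Δ[q])))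

lemma restr_glueLin {q : ℕ} (z : Z _⦋q⦌) (x : Q.carrier) :
    ((K.restr (SSet.yonedaEquiv.symm z)).app B).toFun (K.glueLin F hF x) = (F ⦋q⦌ z).toFun x := by
  refine DGVect.cochain_ext fun p θ => ?_
  obtain ⟨θ, rfl⟩ := SSet.stdSimplex.objEquiv.symm.surjective θ
  exact (K.cochainEval_of_compatible F hF z θ x).symm

lemma cochainEval_eq_restr {q : ℕ} (z : Z _⦋q⦌) (c : (B.toDGVect.cochains Z).carrier) :
    DGVect.cochainEval z c = DGVect.cochainEval (SSet.yonedaEquiv (𝟙 Δ[q]))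
      (((K.restr (SSet.yonedaEquiv.symm z)).app B).toFun c) :=
  congrArg (fun y => DGVect.cochainEval y c) (SSet.yonedaEquiv_symm_app_id z).symm

/-- The morphism to the cochain algebra of `Z` glued from morphisms to the cochain algebras of the
simplices of `Z`. -/
noncomputable def glue : Q ⟶ (K.cotensor Z).obj B where
  toFun := K.glueLin F hF
  map_mem {n x} hx := DGVect.mem_cochains_gr.2 fun q z =>
    DGVect.mem_cochains_gr.1 ((F ⦋q⦌ z).map_mem hx) _ _
  -- Differential and operations on `B ^ Z` are natural in `Z`, so they can be compared after
  -- restriction to each simplex, where the glued map is the given morphism `F`.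
  map_d x := DGVect.cochain_ext fun q z => by
    refine (K.cochainEval_eq_restr z _).trans (Eq.trans ?_ (K.cochainEval_eq_restr z _).symm)
    refine congrArg _ ((K.restr_glueLin F hF z _).trans (((F ⦋q⦌ z).map_d x).trans ?_))
    refine Eq.trans ?_ (((K.restr (SSet.yonedaEquiv.symm z)).app B).map_d _).symm
    exact congrArg _ (K.restr_glueLin F hF z x).symm
  map_act e x := DGVect.cochain_ext fun q z => by
    refine (K.cochainEval_eq_restr z _).trans (Eq.trans ?_ (K.cochainEval_eq_restr z _).symm)
    refine congrArg _ ((K.restr_glueLin F hF z _).trans (((F ⦋q⦌ z).map_act e x).trans ?_))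
    refine Eq.trans ?_ (((K.restr (SSet.yonedaEquiv.symm z)).app B).map_act e _).symm
    exact congrArg _ (funext fun i => (K.restr_glueLin F hF z (x i)).symm)

lemma glue_restr {n : SimplexCategory} (z : Z.obj (op n)) :
    K.glue F hF ≫ (K.restr (SSet.yonedaEquiv.symm z)).app B = F n z :=
  DGAlg.hom_ext fun x => K.restr_glueLin F hF (q := n.len) z x

end Desc

/-- The morphism out of `Z ⊗ Q` given by a compatible family of morphisms on the simplices
of `Z`. -/
noncomputable def tensorDesc {Z : SSet.{u}} {Q B : DGAlg O}
    (F : ∀ (n : SimplexCategory), Z.obj (op n) → (K.tensor (SSet.stdSimplex.obj n) Q ⟶ B))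
    (hF : ∀ (m n : SimplexCategory) (θ : m ⟶ n) (z : Z.obj (op n)),
      K.tensorMap (SSet.stdSimplex.map θ) (𝟙 Q) ≫ F n z = F m (Z.map θ.op z)) :
    K.tensor Z Q ⟶ B :=
  (K.tensorHomEquiv Z Q B).symm (K.glue (fun n z => K.tensorHomEquiv _ _ _ (F n z))
    (fun m n θ z => by rw [← hF, tensorHomEquiv_tensorMap, Category.id_comp]))

lemma cell_tensorDesc {Z : SSet.{u}} {Q B : DGAlg O}
    (F : ∀ (n : SimplexCategory), Z.obj (op n) → (K.tensor (SSet.stdSimplex.obj n) Q ⟶ B))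
    (hF) {n : SimplexCategory} (z : Z.obj (op n)) :
    K.cell z (𝟙 Q) ≫ K.tensorDesc F hF = F n z := by
  apply (K.tensorHomEquiv _ _ _).injective
  rw [cell, tensorHomEquiv_tensorMap, Category.id_comp, tensorDesc, Equiv.apply_symm_apply,
    glue_restr]

end CochainAlgebras

/-! ### Strings of arrows in a group -/

section Strings

variable {G : Type u} [Group G]

/-- The arrow from `i` to `j` in a string of composable arrows of `∗ // G`. -/
def stringArrow {n : SimplexCategory} (s : (nerve (SingleObj G)).obj (op n))
    (i j : Fin (n.len + 1)) (h : i ≤ j) : G := s.map (homOfLE h)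

/-- Composition in `SingleObj G` is multiplication in reverse order, so the later arrow stands on
the left. -/
lemma stringArrow_mul {n : SimplexCategory} (s : (nerve (SingleObj G)).obj (op n))
    {i j l : Fin (n.len + 1)} (h : i ≤ j) (h' : j ≤ l) :
    stringArrow s j l h' * stringArrow s i j h = stringArrow s i l (h.trans h') :=
  (s.map_comp (homOfLE h) (homOfLE h')).symm

lemma string_ext {n : SimplexCategory} {s s' : (nerve (SingleObj G)).obj (op n)}
    (h : ∀ i j hij, stringArrow s i j hij = stringArrow s' i j hij) : s = s' := by
  refine CategoryTheory.Functor.ext (fun _ => rfl) (fun i j f => ?_)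
  simp only [eqToHom_refl, Category.id_comp, Category.comp_id]
  exact h i j (leOfHom f)

/-- The string of arrows `yⱼ⁻¹ yᵢ`. -/
def tupleString {n : SimplexCategory} (y : Fin (n.len + 1) → G) :
    (nerve (SingleObj G)).obj (op n) where
  obj _ := SingleObj.star G
  map {i j} _ := ((y j)⁻¹ * y i : G)
  map_id i := inv_mul_cancel (y i)
  map_comp {i j l} _ _ := by
    change (y l)⁻¹ * y i = ((y l)⁻¹ * y j) * ((y j)⁻¹ * y i)
    group

lemma stringArrow_tupleString {n : SimplexCategory} (y : Fin (n.len + 1) → G) (i j) (h : i ≤ j) :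
    stringArrow (tupleString y) i j h = (y j)⁻¹ * y i := rfl

/-- The tuple `h · (arrow of s from i to the end)`. -/
def stringTuple {n : SimplexCategory} (s : (nerve (SingleObj G)).obj (op n)) (h : G) :
    Fin (n.len + 1) → G := fun i => h * stringArrow s i (Fin.last _) (Fin.le_last i)

lemma stringTuple_inv_mul {n : SimplexCategory} (s : (nerve (SingleObj G)).obj (op n)) (h : G)
    {i j} (hij : i ≤ j) : (stringTuple s h j)⁻¹ * stringTuple s h i = stringArrow s i j hij := by
  rw [stringTuple, stringTuple, ← stringArrow_mul s hij (Fin.le_last j)]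
  group

lemma tupleString_comp {n m : SimplexCategory} (y : Fin (n.len + 1) → G) (θ : m ⟶ n) :
    tupleString (y ∘ θ.toOrderHom) = (nerve (SingleObj G)).map θ.op (tupleString y) :=
  string_ext fun _ _ _ => rfl

lemma stringTuple_tupleString {n : SimplexCategory} (y : Fin (n.len + 1) → G) :
    stringTuple (tupleString y) (y (Fin.last _)) = y :=
  funext fun _ => mul_inv_cancel_left _ _

/-- Restricting `s` along `θ` loses the arrows after `θ` of the last vertex. Multiplying `h` by
them, which is how the bar construction acts on the bundle, makes the tuple restrict strictly. -/
lemma stringTuple_map {n m : SimplexCategory} (s : (nerve (SingleObj G)).obj (op n)) (h : G)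
    (θ : m ⟶ n) : stringTuple ((nerve (SingleObj G)).map θ.op s)
      (h * stringArrow s (θ.toOrderHom (Fin.last _)) (Fin.last _) (Fin.le_last _)) =
        stringTuple s h ∘ θ.toOrderHom :=
  funext fun i => (mul_assoc _ _ _).trans (congrArg (h * ·)
    (stringArrow_mul s (θ.toOrderHom.monotone (Fin.le_last i)) (Fin.le_last _)))

end Strings

/-! ### Trivializations -/

namespace Trivialization

variable {G : Type u} [Group G] {X : SSet.{u}} {φ : X ⟶ BG G} (τ : Trivialization φ)

/-- The `G`-coordinate of a simplex of the total space. -/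
def label {n : SimplexCategoryᵒᵖ} (w : (totalSpace φ).obj n) : G := (τ.iso.hom.app n w).2

/-- The factor `G` of the trivial bundle is discrete, so simplicial operators do not change the
label. -/
lemma label_map {m n : SimplexCategoryᵒᵖ} (f : m ⟶ n) (w : (totalSpace φ).obj m) :
    τ.label ((totalSpace φ).map f w) = τ.label w :=
  congrArg Prod.snd (congrArg (fun g => g w) (τ.iso.hom.naturality f))

lemma label_mul {n : SimplexCategoryᵒᵖ} (w : (totalSpace φ).obj n) (g : G) :
    τ.label ((totalSpaceMul φ g).app n w) = τ.label w * g := τ.equivariant n w g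

lemma hom_sect (h : G) {n : SimplexCategoryᵒᵖ} (x : X.obj n) :
    τ.iso.hom.app n ((τ.sect h).app n x) = ((x, h) : X.obj n × G) :=
  congrArg (fun f : prodDiscrete X G ⟶ prodDiscrete X G => f.app n ((x, h) : X.obj n × G))
    τ.iso.inv_hom_id

lemma label_sect (h : G) {n : SimplexCategoryᵒᵖ} (x : X.obj n) :
    τ.label ((τ.sect h).app n x) = h := congrArg Prod.snd (τ.hom_sect h x)

lemma base_sect (h : G) {n : SimplexCategoryᵒᵖ} (x : X.obj n) :
    ((τ.sect h).app n x).1.1 = x :=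
  (τ.over_base n _).symm.trans (congrArg Prod.fst (τ.hom_sect h x))

lemma sect_label {n : SimplexCategoryᵒᵖ} (w : (totalSpace φ).obj n) :
    (τ.sect (τ.label w)).app n w.1.1 = w := by
  have h : ((w.1.1, τ.label w) : X.obj n × G) = τ.iso.hom.app n w :=
    Prod.ext (τ.over_base n w).symm rfl
  refine (congrArg (τ.iso.inv.app n) h).trans ?_
  exact congrArg (fun f : totalSpace φ ⟶ totalSpace φ => f.app n w) τ.iso.hom_inv_id

/-- A simplex of a trivialized bundle is determined by its base simplex and its label. -/
lemma eq_sect {n : SimplexCategoryᵒᵖ} {w : (totalSpace φ).obj n} {x : X.obj n} {h : G}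
    (hx : w.1.1 = x) (hh : τ.label w = h) : w = (τ.sect h).app n x := by
  subst hx hh
  exact (τ.sect_label w).symm

end Trivialization

/-! ### The universal property of the equivariant chains -/

namespace CochainAlgebras

open Simplicial DGAlg

variable {k : Type u} [Field k] {O : DGOperad k} (K : CochainAlgebras O) {G : Type u} [Group G]
  {X : SSet.{u}} (φ : X ⟶ BG G) (Q : SingleObj G ⥤ DGAlg O)

/-- The action of an element of `G`. -/
abbrev groupAct (g : G) : Q.obj (SingleObj.star G) ⟶ Q.obj (SingleObj.star G) :=
  Q.map (X := SingleObj.star G) (Y := SingleObj.star G) g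

lemma groupAct_comp (g g' : G) : groupAct Q g ≫ groupAct Q g' = groupAct Q (g' * g) :=
  (Q.map_comp (X := SingleObj.star G) (Y := SingleObj.star G) (Z := SingleObj.star G) g g').symm

lemma groupAct_one : groupAct Q 1 = 𝟙 _ := Q.map_id (SingleObj.star G)

variable {Q} in
lemma equivariantChains_hom_ext {B : DGAlg O} {f g : K.equivariantChains φ Q ⟶ B}
    (h : ∀ (n : SimplexCategory) (s : (nerve (SingleObj G)).obj (op n)),
      K.equivariantChainsι φ Q s ≫ f = K.equivariantChainsι φ Q s ≫ g) : f = g := by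
  refine coend.hom_ext fun n => Limits.Sigma.hom_ext _ _ fun s => ?_
  exact (Category.assoc _ _ _).symm.trans ((h n s).trans (Category.assoc _ _ _))

/-- The coend relation for `θ`, on the summand `s`: end arrows move the bundle, initial arrows act
on the coefficients. -/
lemma equivariantChains_condition {m n : SimplexCategory} (θ : m ⟶ n)
    (s : (nerve (SingleObj G)).obj (op n)) :
    K.tensorMap (totalSpaceMul φ (stringArrow s (θ.toOrderHom (Fin.last _)) (Fin.last _)
        (Fin.le_last _)) ▷ SSet.stdSimplex.obj m)
      (groupAct Q (stringArrow s 0 (θ.toOrderHom 0) (Fin.zero_le _))) ≫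
        K.equivariantChainsι φ Q ((nerve (SingleObj G)).map θ.op s) =
    K.tensorMap (totalSpace φ ◁ SSet.stdSimplex.map θ) (𝟙 _) ≫ K.equivariantChainsι φ Q s := by
  have h := congrArg (K.barι (bundle φ) Q (op n) m s ≫ ·) (coend.condition (K.bar (bundle φ) Q) θ)
  have h1 : K.barι (bundle φ) Q (op n) m s ≫ ((K.bar (bundle φ) Q).map θ.op).app m = _ :=
    Limits.Sigma.ι_desc _ s
  have h2 : K.barι (bundle φ) Q (op n) m s ≫ ((K.bar (bundle φ) Q).obj (op n)).map θ = _ :=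
    Limits.Sigma.ι_desc _ s
  exact (Category.assoc _ _ _).symm.trans ((congrArg (· ≫ coend.ι (K.bar (bundle φ) Q) m)
    h1.symm).trans ((Category.assoc _ _ _).trans (h.trans ((Category.assoc _ _ _).symm.trans
      ((congrArg (· ≫ coend.ι (K.bar (bundle φ) Q) n) h2).trans (Category.assoc _ _ _))))))

variable {Q} in
/-- The morphism out of the equivariant chains given by compatible morphisms on the summands. -/
noncomputable def equivariantChainsDesc {B : DGAlg O}
    (ψ : ∀ (n : SimplexCategory), (nerve (SingleObj G)).obj (op n) →
      (K.tensor (totalSpace φ ⊗ SSet.stdSimplex.obj n) (Q.obj (SingleObj.star G)) ⟶ B))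
    (hψ : ∀ (m n : SimplexCategory) (θ : m ⟶ n) (s : (nerve (SingleObj G)).obj (op n)),
      K.tensorMap (totalSpaceMul φ (stringArrow s (θ.toOrderHom (Fin.last _)) (Fin.last _)
          (Fin.le_last _)) ▷ SSet.stdSimplex.obj m)
        (groupAct Q (stringArrow s 0 (θ.toOrderHom 0) (Fin.zero_le _))) ≫
          ψ m ((nerve (SingleObj G)).map θ.op s) =
      K.tensorMap (totalSpace φ ◁ SSet.stdSimplex.map θ) (𝟙 _) ≫ ψ n s) :
    K.equivariantChains φ Q ⟶ B :=
  coend.desc (fun n => Limits.Sigma.desc fun s => ψ n s) (fun m n θ => by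
    refine Limits.Sigma.hom_ext _ _ fun s => ?_
    have h1 : K.barι (bundle φ) Q (op n) m s ≫ ((K.bar (bundle φ) Q).map θ.op).app m = _ :=
      Limits.Sigma.ι_desc _ s
    have h2 : K.barι (bundle φ) Q (op n) m s ≫ ((K.bar (bundle φ) Q).obj (op n)).map θ = _ :=
      Limits.Sigma.ι_desc _ s
    refine (Category.assoc _ _ _).symm.trans ((eq_whisker h1 _).trans
      ((Category.assoc _ _ _).trans ?_))
    refine Eq.trans ?_ ((Category.assoc _ _ _).symm.trans ((eq_whisker h2 _).trans
      (Category.assoc _ _ _))).symm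
    refine (whisker_eq _ (Limits.Sigma.ι_desc (ψ m) _)).trans (Eq.trans ?_
      (whisker_eq _ (Limits.Sigma.ι_desc (ψ n) _)).symm)
    exact hψ m n θ s)

variable {Q} in
lemma equivariantChainsι_desc {B : DGAlg O}
    (ψ : ∀ (n : SimplexCategory), (nerve (SingleObj G)).obj (op n) →
      (K.tensor (totalSpace φ ⊗ SSet.stdSimplex.obj n) (Q.obj (SingleObj.star G)) ⟶ B))
    (hψ) {n : SimplexCategory} (s : (nerve (SingleObj G)).obj (op n)) :
    K.equivariantChainsι φ Q s ≫ K.equivariantChainsDesc φ ψ hψ = ψ n s := by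
  have h : coend.ι (K.bar (bundle φ) Q) n ≫ K.equivariantChainsDesc φ ψ hψ =
      Limits.Sigma.desc fun s => ψ n s := coend.ι_desc _ _ n
  exact (Category.assoc _ _ _).trans ((whisker_eq (K.barι (bundle φ) Q (op n) n s) h).trans
    (Limits.Sigma.ι_desc (ψ n) s))

end CochainAlgebras

/-! ### The equivariant chains of a trivialized bundle -/

namespace CochainAlgebras

open Simplicial DGAlg

variable {k : Type u} [Field k] {O : DGOperad k} (K : CochainAlgebras O) {G : Type u} [Group G]
  {X : SSet.{u}} {φ : X ⟶ BG G} (Q : SingleObj G ⥤ DGAlg O)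

/-- A simplex of a product. -/
def pairSimplex {Z W : SSet.{u}} {n : SimplexCategoryᵒᵖ} (z : Z.obj n) (w : W.obj n) :
    (Z ⊗ W).obj n := (z, w)

/-- A simplex of `X × EG S`. -/
def egSimplex {Z : SSet.{u}} {S : Type u} {n : SimplexCategory} (z : Z.obj (op n))
    (y : Fin (n.len + 1) → S) : (prodEG Z S).obj (op n) := (z, y)

/-- The coend relation applied to the top simplex of `Δ[m]`. It moves any cell to one whose
`Δ`-coordinate is a top simplex, so that only such cells matter in computations with `∫_φ A`. -/
lemma cell_pairSimplex_comp_ι {m n : SimplexCategory} (s : (nerve (SingleObj G)).obj (op n))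
    (w : (totalSpace φ).obj (op m)) (θ : m ⟶ n) {A : DGAlg O}
    (a : A ⟶ Q.obj (SingleObj.star G)) :
    K.cell (pairSimplex w (SSet.stdSimplex.objEquiv.symm θ : (SSet.stdSimplex.{u}.obj n).obj _)) a ≫
        K.equivariantChainsι φ Q s =
      K.cell (pairSimplex ((totalSpaceMul φ (stringArrow s (θ.toOrderHom (Fin.last _))
          (Fin.last _) (Fin.le_last _))).app _ w) (SSet.yonedaEquiv (𝟙 _)))
        (a ≫ groupAct Q (stringArrow s 0 (θ.toOrderHom 0) (Fin.zero_le _))) ≫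
        K.equivariantChainsι φ Q ((nerve (SingleObj G)).map θ.op s) := by
  have h := congrArg (K.cell (pairSimplex w (SSet.yonedaEquiv (𝟙 _))) a ≫ ·)
    (K.equivariantChains_condition φ Q θ s)
  dsimp only at h
  rw [← Category.assoc, ← Category.assoc, cell_comp_tensorMap, cell_comp_tensorMap,
    Category.comp_id] at h
  refine Eq.trans ?_ h.symm
  have e : (SSet.stdSimplex.map θ).app _ (SSet.yonedaEquiv (𝟙 _)) =
      SSet.stdSimplex.objEquiv.symm θ := by
    rw [← SSet.yonedaEquiv_comp, Category.id_comp, SSet.yonedaEquiv_map]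
  rw [← e]
  rfl

variable (τ : Trivialization φ)

/-- The string of arrows and the simplex of `φ^* EG` that correspond to a simplex of `X × EG`. -/
noncomputable def toChainsCell (n : SimplexCategory) (z : (prodEG X G).obj (op n)) :
    K.tensor (SSet.stdSimplex.obj n) (Q.obj (SingleObj.star G)) ⟶ K.equivariantChains φ Q :=
  K.cell (pairSimplex ((τ.sect (z.2 (Fin.last _))).app _ z.1) (SSet.yonedaEquiv (𝟙 _)))
    (groupAct Q (z.2 0)⁻¹) ≫ K.equivariantChainsι φ Q (tupleString z.2)

/-- Restriction along `θ` puts `θ` into the `Δ[n]`-coordinate, and the coend relation removes it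
again. The label becomes `yₙ (yₙ⁻¹ y_{θ m}) = y_{θ m}` and the twist `(y_{θ 0}⁻¹ y₀) y₀⁻¹ = y_{θ
0}⁻¹`, as required for the restricted tuple. -/
lemma toChainsCell_map (m n : SimplexCategory) (θ : m ⟶ n) (z : (prodEG X G).obj (op n)) :
    K.tensorMap (SSet.stdSimplex.map θ) (𝟙 _) ≫ K.toChainsCell Q τ n z =
      K.toChainsCell Q τ m ((prodEG X G).map θ.op z) := by
  rw [toChainsCell, ← Category.assoc, tensorMap_comp_cell, Category.id_comp]
  have e : (totalSpace φ ⊗ SSet.stdSimplex.obj n).map θ.op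
      (pairSimplex ((τ.sect (z.2 (Fin.last _))).app _ z.1) (SSet.yonedaEquiv (𝟙 _))) =
      pairSimplex ((τ.sect (z.2 (Fin.last _))).app _ (X.map θ.op z.1))
        (SSet.stdSimplex.objEquiv.symm θ) := by
    refine Prod.ext ?_ (SSet.stdSimplex.objEquiv.injective (Category.comp_id θ))
    exact (congrArg (fun f => f z.1) ((τ.sect (z.2 (Fin.last _))).naturality θ.op)).symm
  rw [e, cell_pairSimplex_comp_ι, groupAct_comp, toChainsCell]
  have e₁ : (totalSpaceMul φ (stringArrow (tupleString z.2) (θ.toOrderHom (Fin.last _))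
      (Fin.last _) (Fin.le_last _))).app _ ((τ.sect (z.2 (Fin.last _))).app _ (X.map θ.op z.1)) =
      (τ.sect (z.2 (θ.toOrderHom (Fin.last _)))).app _ (X.map θ.op z.1) :=
    τ.eq_sect (τ.base_sect _ _) (by
      rw [τ.label_mul, τ.label_sect, stringArrow_tupleString, mul_inv_cancel_left])
  have e₂ : stringArrow (tupleString z.2) 0 (θ.toOrderHom 0) (Fin.zero_le _) * (z.2 0)⁻¹ =
      (z.2 (θ.toOrderHom 0))⁻¹ := by
    rw [stringArrow_tupleString, mul_inv_cancel_right]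
  rw [e₁, e₂, ← tupleString_comp]
  rfl

/-- The comparison map `(X × EG) ⊗ Q ⟶ ∫_φ A`. -/
noncomputable def toChains : K.tensor (prodEG X G) (Q.obj (SingleObj.star G)) ⟶
    K.equivariantChains φ Q :=
  K.tensorDesc (K.toChainsCell Q τ) (K.toChainsCell_map Q τ)

/-- The simplex of `X × EG` that corresponds to a string of arrows and a simplex of `φ^* EG`. -/
noncomputable def ofChainsCell {n : SimplexCategory} (s : (nerve (SingleObj G)).obj (op n))
    (m : SimplexCategory) (z : (totalSpace φ ⊗ SSet.stdSimplex.obj n).obj (op m)) :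
    K.tensor (SSet.stdSimplex.obj m) (Q.obj (SingleObj.star G)) ⟶
      K.tensor (prodEG X G) (Q.obj (SingleObj.star G)) :=
  K.cell (egSimplex z.1.1.1 (stringTuple s (τ.label z.1) ∘
    (SSet.stdSimplex.objEquiv z.2).toOrderHom)) (groupAct Q (τ.label z.1 * total s))

/-- The comparison map on the summand with index `s`. -/
noncomputable def ofChainsSummand {n : SimplexCategory} (s : (nerve (SingleObj G)).obj (op n)) :
    K.tensor (totalSpace φ ⊗ SSet.stdSimplex.obj n) (Q.obj (SingleObj.star G)) ⟶
      K.tensor (prodEG X G) (Q.obj (SingleObj.star G)) :=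
  K.tensorDesc (K.ofChainsCell Q τ s) (fun l m θ z => by
    rw [ofChainsCell, ofChainsCell, tensorMap_comp_cell, Category.id_comp]
    have e : τ.label ((totalSpace φ ⊗ SSet.stdSimplex.obj n).map θ.op z).1 = τ.label z.1 :=
      τ.label_map θ.op z.1
    rw [e]
    rfl)

lemma cell_ofChainsSummand {n m : SimplexCategory} (s : (nerve (SingleObj G)).obj (op n))
    (w : (totalSpace φ).obj (op m)) (ξ : (SSet.stdSimplex.{u}.obj n).obj (op m)) {A : DGAlg O}
    (a : A ⟶ Q.obj (SingleObj.star G)) :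
    K.cell (pairSimplex w ξ) a ≫ K.ofChainsSummand Q τ s =
      K.cell (egSimplex w.1.1 (stringTuple s (τ.label w) ∘
        (SSet.stdSimplex.objEquiv ξ).toOrderHom)) (a ≫ groupAct Q (τ.label w * total s)) := by
  have h : K.cell (pairSimplex w ξ) a =
      K.tensorMap (𝟙 _) a ≫ K.cell (pairSimplex w ξ) (𝟙 _) := by
    rw [cell, cell, tensorMap_comp, Category.id_comp, Category.comp_id]
  rw [h, Category.assoc, ofChainsSummand, cell_tensorDesc, ofChainsCell, cell, tensorMap_comp,
    Category.id_comp]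
  rfl

/-- Both sides give the same simplex of `X × EG` by `stringTuple_map`; it remains to compare the two
group elements acting on `Q`. -/
lemma ofChainsSummand_condition (m n : SimplexCategory) (θ : m ⟶ n)
    (s : (nerve (SingleObj G)).obj (op n)) :
    K.tensorMap (totalSpaceMul φ (stringArrow s (θ.toOrderHom (Fin.last _)) (Fin.last _)
        (Fin.le_last _)) ▷ SSet.stdSimplex.obj m)
      (groupAct Q (stringArrow s 0 (θ.toOrderHom 0) (Fin.zero_le _))) ≫
        K.ofChainsSummand Q τ ((nerve (SingleObj G)).map θ.op s) =
    K.tensorMap (totalSpace φ ◁ SSet.stdSimplex.map θ) (𝟙 _) ≫ K.ofChainsSummand Q τ s := by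
  refine K.tensor_hom_ext fun l z => ?_
  obtain ⟨w, ξ, rfl⟩ : ∃ w ξ, z = pairSimplex w ξ := ⟨z.1, z.2, rfl⟩
  rw [← Category.assoc, ← Category.assoc, cell_comp_tensorMap, cell_comp_tensorMap]
  refine (K.cell_ofChainsSummand Q τ _ ((totalSpaceMul φ _).app _ w) ξ _).trans
    (Eq.trans ?_ (K.cell_ofChainsSummand Q τ s w ((SSet.stdSimplex.map θ).app _ ξ) _).symm)
  rw [τ.label_mul, stringTuple_map, Category.id_comp, Category.id_comp, Category.id_comp,
    groupAct_comp, mul_assoc, mul_assoc]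
  -- The arrows of `s` from `0` to `θ 0`, on to `θ` of the last vertex, and on to the end compose to
  -- the total arrow.
  have e : stringArrow s (θ.toOrderHom (Fin.last _)) (Fin.last _) (Fin.le_last _) *
      (total ((nerve (SingleObj G)).map θ.op s) *
        stringArrow s 0 (θ.toOrderHom 0) (Fin.zero_le _)) = total s := by
    refine Eq.trans (congrArg (_ * ·) (stringArrow_mul s (Fin.zero_le _)
      (θ.toOrderHom.monotone (Fin.zero_le (Fin.last _))))) (stringArrow_mul s _ _)
  rw [e]
  rfl

/-- The comparison map `∫_φ A ⟶ (X × EG) ⊗ Q`. -/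
noncomputable def ofChains : K.equivariantChains φ Q ⟶
    K.tensor (prodEG X G) (Q.obj (SingleObj.star G)) :=
  K.equivariantChainsDesc φ (fun _ s => K.ofChainsSummand Q τ s) (K.ofChainsSummand_condition Q τ)

lemma equivariantChainsι_ofChains {n : SimplexCategory} (s : (nerve (SingleObj G)).obj (op n)) :
    K.equivariantChainsι φ Q s ≫ K.ofChains Q τ = K.ofChainsSummand Q τ s :=
  K.equivariantChainsι_desc φ _ _ s

/-- The tuple returns to itself, and the two twists cancel: `yₙ (yₙ⁻¹ y₀) y₀⁻¹ = 1`. -/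
lemma toChains_ofChains : K.toChains Q τ ≫ K.ofChains Q τ = 𝟙 _ := by
  refine K.tensor_hom_ext fun n z => ?_
  rw [← Category.assoc, toChains, cell_tensorDesc, toChainsCell, Category.assoc,
    equivariantChainsι_ofChains, cell_ofChainsSummand, τ.label_sect, stringTuple_tupleString,
    τ.base_sect, groupAct_comp, Category.comp_id]
  have e : z.2 (Fin.last _) * total (tupleString z.2) * (z.2 0)⁻¹ = 1 := by
    change z.2 (Fin.last _) * ((z.2 (Fin.last _))⁻¹ * z.2 0) * (z.2 0)⁻¹ = 1
    rw [mul_inv_cancel_left, mul_inv_cancel]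
  rw [e, groupAct_one]
  rfl

lemma cell_toChains {m : SimplexCategory} (z : (prodEG X G).obj (op m)) {A : DGAlg O}
    (a : A ⟶ Q.obj (SingleObj.star G)) : K.cell z a ≫ K.toChains Q τ =
      K.cell (pairSimplex ((τ.sect (z.2 (Fin.last _))).app _ z.1) (SSet.yonedaEquiv (𝟙 _)))
        (a ≫ groupAct Q (z.2 0)⁻¹) ≫ K.equivariantChainsι φ Q (tupleString z.2) := by
  have h : K.cell z a = K.tensorMap (𝟙 _) a ≫ K.cell z (𝟙 _) := by
    rw [cell, cell, tensorMap_comp, Category.id_comp, Category.comp_id]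
  rw [h, Category.assoc, toChains, cell_tensorDesc, toChainsCell, ← Category.assoc, cell,
    tensorMap_comp, Category.id_comp, cell]

lemma stringTuple_last {n : SimplexCategory} (s : (nerve (SingleObj G)).obj (op n)) (h : G) :
    stringTuple s h (Fin.last _) = h :=
  (congrArg (h * ·) (s.map_id (Fin.last n.len))).trans (mul_one h)

/-- On top simplices the string and the bundle simplex are recovered from the tuple, whose vertex
`y₀` is the label times the total arrow, so the twists cancel. -/
lemma cell_ofChainsSummand_toChains {n : SimplexCategory} (s : (nerve (SingleObj G)).obj (op n))
    (w : (totalSpace φ).obj (op n)) {A : DGAlg O} (a : A ⟶ Q.obj (SingleObj.star G)) :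
    K.cell (pairSimplex w (SSet.yonedaEquiv (𝟙 (SSet.stdSimplex.obj n)))) a ≫
        K.ofChainsSummand Q τ s ≫ K.toChains Q τ =
      K.cell (pairSimplex w (SSet.yonedaEquiv (𝟙 _))) a ≫ K.equivariantChainsι φ Q s := by
  have h₁ : (τ.sect (stringTuple s (τ.label w) (Fin.last _))).app _ w.1.1 = w := by
    rw [stringTuple_last, τ.sect_label]
  have h₂ : groupAct Q (τ.label w * total s) ≫ groupAct Q (stringTuple s (τ.label w) 0)⁻¹ =
      𝟙 _ := by
    rw [groupAct_comp, ← groupAct_one]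
    exact congrArg (groupAct Q) (inv_mul_cancel (τ.label w * total s))
  have h₃ : tupleString (stringTuple s (τ.label w)) = s :=
    string_ext fun _ _ hij => stringTuple_inv_mul s _ hij
  rw [← Category.assoc, cell_ofChainsSummand]
  refine (K.cell_toChains Q τ (egSimplex w.1.1 (stringTuple s (τ.label w))) _).trans ?_
  simp only [egSimplex]
  rw [h₁, h₃, Category.assoc, h₂, Category.comp_id]

lemma ofChains_toChains : K.ofChains Q τ ≫ K.toChains Q τ = 𝟙 _ := by
  refine K.equivariantChains_hom_ext φ fun n s => K.tensor_hom_ext fun m z => ?_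
  obtain ⟨w, ξ, rfl⟩ : ∃ w ξ, z = pairSimplex w ξ := ⟨z.1, z.2, rfl⟩
  obtain ⟨θ, rfl⟩ := SSet.stdSimplex.objEquiv.symm.surjective ξ
  -- The coend relation reduces an arbitrary simplex `θ` of `Δ[n]` to a top simplex.
  rw [Category.comp_id, ← Category.assoc, cell_pairSimplex_comp_ι, Category.assoc,
    ← Category.assoc (K.equivariantChainsι φ Q _), equivariantChainsι_ofChains]
  exact K.cell_ofChainsSummand_toChains Q τ _ _ _

lemma weakEquiv_ofChains : WeakEquiv (K.ofChains Q τ) :=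
  have : IsIso (K.ofChains Q τ) := ⟨K.toChains Q τ, K.ofChains_toChains Q τ, K.toChains_ofChains Q τ⟩
  WeakEquiv.of_isIso _

/-- The augmentation `∫_φ A ⟶ X ⊗ Q`. -/
noncomputable def augmentation : K.equivariantChains φ Q ⟶
    K.hochschildChains X (Q.obj (SingleObj.star G)) :=
  K.ofChains Q τ ≫ K.tensorMap (prodEGFst X G) (𝟙 _)

lemma weakEquiv_augmentation (hQ : (Q.obj (SingleObj.star G)).IsCofibrant) :
    WeakEquiv (K.augmentation Q τ) :=
  (K.weakEquiv_ofChains Q τ).comp (K.weakEquiv_tensorMap_prodEGFst X G hQ)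

lemma equivariantChainsι_augmentation {n : SimplexCategory}
    (s : (nerve (SingleObj G)).obj (op n)) :
    K.equivariantChainsι φ Q s ≫ K.augmentation Q τ =
      K.ofChainsSummand Q τ s ≫ K.tensorMap (prodEGFst X G) (𝟙 _) :=
  (Category.assoc _ _ _).symm.trans (eq_whisker (K.equivariantChainsι_ofChains Q τ s) _)

lemma isAugmentation_augmentation : K.IsAugmentation τ (K.augmentation Q τ) := by
  refine fun n s h => K.tensor_hom_ext fun m z => ?_
  obtain ⟨x, ξ, rfl⟩ : ∃ x ξ, z = pairSimplex x ξ := ⟨z.1, z.2, rfl⟩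
  have e : K.cell (pairSimplex ((τ.sect h).app _ x) ξ) (𝟙 _) ≫ K.ofChainsSummand Q τ s ≫
      K.tensorMap (prodEGFst X G) (𝟙 _) = K.cell x (groupAct Q (h * total s)) := by
    rw [← Category.assoc, cell_ofChainsSummand, cell_comp_tensorMap, τ.label_sect,
      Category.id_comp, Category.comp_id]
    exact congrArg (fun x => K.cell x _) (τ.base_sect h x)
  refine (whisker_eq _ (whisker_eq _ (K.equivariantChainsι_augmentation Q τ s))).trans ?_
  refine (Category.assoc _ _ _).symm.trans ?_
  refine (eq_whisker ((K.cell_comp_tensorMap (pairSimplex x ξ) _ _ _).trans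
    (congrArg (K.cell _) (Category.comp_id _))) _).trans ?_
  refine e.trans (Eq.trans ?_ (K.cell_comp_tensorMap (pairSimplex x ξ) _ _ _).symm)
  rw [Category.id_comp]
  rfl

variable {Q τ} in
-- Every simplex of the bundle lies on the sheet given by its label, so the prescribed restrictions
-- determine the morphism on all cells.
lemma IsAugmentation.unique {f f' : K.equivariantChains φ Q ⟶
    K.hochschildChains X (Q.obj (SingleObj.star G))} (hf : K.IsAugmentation τ f)
    (hf' : K.IsAugmentation τ f') : f = f' := by
  refine K.equivariantChains_hom_ext φ fun n s => K.tensor_hom_ext fun m z => ?_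
  obtain ⟨w, ξ, rfl⟩ : ∃ w ξ, z = pairSimplex w ξ := ⟨z.1, z.2, rfl⟩
  have h : K.cell (pairSimplex w ξ) (𝟙 (Q.obj (SingleObj.star G))) = K.cell (pairSimplex w.1.1 ξ) (𝟙 _) ≫
      K.tensorMap (τ.sect (τ.label w) ▷ SSet.stdSimplex.obj n) (𝟙 _) := by
    rw [cell_comp_tensorMap, Category.comp_id]
    exact congrArg (fun w => K.cell (pairSimplex w ξ) (𝟙 _)) (τ.sect_label w).symm
  rw [h, Category.assoc, hf n s (τ.label w), Category.assoc, hf' n s (τ.label w)]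

end CochainAlgebras

/-! ### The value on the point -/

section Point

open Simplicial DGAlg

variable {k : Type u} [Field k] {O : DGOperad k} (K : CochainAlgebras O) {G : Type u} [Group G]

lemma map_eq_one_of_dim_zero (v : (nerve (SingleObj G)).obj (op ⦋0⦌)) {a b : Fin 1} (e : a ⟶ b) :
    (v.map e : G) = 1 := by
  obtain rfl : a = 0 := Subsingleton.elim _ _
  obtain rfl : b = 0 := Subsingleton.elim _ _
  exact v.map_id 0

/-- Every simplex of the point is pulled back from its vertex, so all arrows of its image are
identities. -/
lemma stringArrow_of_point (φ : (Δ[0] : SSet.{u}) ⟶ BG G) {n : SimplexCategory}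
    (x : (Δ[0] : SSet.{u}).obj (op n)) {i j : Fin (n.len + 1)} (e : i ≤ j) :
    stringArrow (φ.app _ x) i j e = 1 := by
  have hx : x = (Δ[0] : SSet.{u}).map (SSet.stdSimplex.objEquiv x).op CochainAlgebras.pointVertex :=
    SSet.stdSimplex.objEquiv.injective (Subsingleton.elim _ _)
  have h := (congrArg (φ.app _) hx).trans (NatTrans.naturality_apply φ _ _)
  rw [h]
  exact map_eq_one_of_dim_zero _ _

/-- The edges `xᵢ x₀⁻¹` of the image in `BG` are trivial. Hence the fibre over the point is the
discrete set `G`, which gives the trivialization. -/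
lemma totalSpace_point_constant (φ : (Δ[0] : SSet.{u}) ⟶ BG G) {n : SimplexCategory}
    (w : (totalSpace φ).obj (op n)) (i : Fin (n.len + 1)) : w.1.2 i = w.1.2 0 := by
  refine mul_inv_eq_one.1 (Eq.trans ?_ (stringArrow_of_point φ w.1.1 (Fin.zero_le i)))
  rw [w.2]
  rfl

/-- The bundle over the point is trivial. -/
def pointTrivialization (φ : (Δ[0] : SSet.{u}) ⟶ BG G) : Trivialization φ where
  iso :=
    { hom := { app _ := ↾fun w => (w.1.1, w.1.2 0)
               naturality _ _ _ := types_hom_ext fun w =>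
                Prod.ext rfl (totalSpace_point_constant φ w _) }
      inv := { app _ := ↾fun z => ⟨(z.1, fun _ => z.2), string_ext fun _ _ e =>
                (stringArrow_of_point φ z.1 e).trans (mul_inv_cancel z.2).symm⟩
               naturality _ _ _ := rfl }
      hom_inv_id := SSet.hom_ext fun _ => types_hom_ext fun w => Subtype.ext (Prod.ext rfl
        (funext fun i => (totalSpace_point_constant φ w i).symm))
      inv_hom_id := rfl }
  over_base _ _ := rfl
  equivariant _ _ _ := rfl

namespace CochainAlgebras

lemma cotensor_map_evalPoint {A B : DGAlg O} (f : A ⟶ B) :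
    (K.cotensor Δ[0]).map f ≫ K.evalPoint B = K.evalPoint A ≫ f := rfl

/-- The isomorphism `Δ[0] ⊗ A ⟶ A`. -/
noncomputable def tensorPoint (A : DGAlg O) : K.tensor Δ[0] A ⟶ A :=
  (K.tensorHomEquiv Δ[0] A A).symm (inv (K.evalPoint A))

/-- Since `B ^ Δ[0] ≅ B` naturally, `Δ[0] ⊗ A` and `A` corepresent the same functor; the inverse is
the unit followed by evaluation. -/
instance (A : DGAlg O) : IsIso (K.tensorPoint A) := by
  have h : (K.tensorHomEquiv Δ[0] A _ (𝟙 _) ≫ K.evalPoint _) ≫ K.tensorPoint A = 𝟙 A := by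
    rw [Category.assoc, ← cotensor_map_evalPoint, ← Category.assoc, ← tensorHomEquiv_naturality,
      Category.id_comp, tensorPoint, Equiv.apply_symm_apply, IsIso.inv_hom_id]
  refine ⟨K.tensorHomEquiv Δ[0] A _ (𝟙 _) ≫ K.evalPoint _, ?_, h⟩
  apply (K.tensorHomEquiv Δ[0] A _).injective
  rw [tensorHomEquiv_naturality, tensorPoint, Equiv.apply_symm_apply,
    ← cancel_mono (K.evalPoint _), Category.assoc, cotensor_map_evalPoint, IsIso.inv_hom_id_assoc]

end CochainAlgebras

end Point

theorem lemma2p6 {k : Type u} [Field k] (O : DGOperad k) (hO : O.IsEInfty)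
    (K : CochainAlgebras O) {G : Type u} [Group G] (A Q : SingleObj G ⥤ DGAlg O) (q : Q ⟶ A)
    (hq : IsCofibrantReplacement q) :
    (∀ (X : SSet.{u}) (φ : X ⟶ BG G) (τ : Trivialization φ),
      ∃ f : K.equivariantChains φ Q ⟶ K.hochschildChains X (Q.obj (SingleObj.star G)),
        K.IsAugmentation τ f ∧ (∀ f', K.IsAugmentation τ f' → f' = f) ∧ DGAlg.WeakEquiv f) ∧
    (∀ φ : SSet.stdSimplex.obj (SimplexCategory.mk 0) ⟶ BG G,
      ∃ f : K.equivariantChains φ Q ⟶ A.obj (SingleObj.star G), DGAlg.WeakEquiv f) := by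
  refine ⟨fun X φ τ => ⟨K.augmentation Q τ, K.isAugmentation_augmentation Q τ,
    fun f' hf' => hf'.unique K (K.isAugmentation_augmentation Q τ),
    K.weakEquiv_augmentation Q τ hq.cofibrant⟩, fun φ => ?_⟩
  -- The map is the composite `∫_φ A ⟶ Δ[0] ⊗ Q ≅ Q ⟶ A`.
  exact ⟨_, ((K.weakEquiv_augmentation Q (pointTrivialization φ) hq.cofibrant).comp
    (DGAlg.WeakEquiv.of_isIso (K.tensorPoint _))).comp hq.weakEquiv⟩
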